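/- **Setting.** Let $K\subset\mathbb R^3$ be a polyhedral element: a nonempty bounded open set whose boundary is the union of the closures of finitely many pairwise disjoint, relatively open, planar polygonal faces $F$, with outward unit normals $n_F$; the relative boundary of each face is a finite union of non-overlapping straight edges $e$. Let $h_K,h_F$ be the diameters of $K,F$, and $h_e$ the length of $e$. For $\gamma,\sigma>0$, call $K$ $(\gamma,\sigma)$-regular if $K$ is star-shaped with respect to a ball of diameter $\gamma h_K$, each face $F$ is star-shaped with respect to a disc (in its plane) of diameter $\gamma h_F$, and $\sigma^{-1}h_K\le h_F\le\sigma h_K$, $\sigma^{-1}h_F\le h_e\le \sigma h_F$ for all faces $F$ of $K$ and all edges $e$ of $F$. The seminorm $|\cdot|_{s,K}$ is the $L^2(K)$ norm for $s=0$, the Gagliardo (Sobolev–Slobodeckij) seminorm $\big(\int_K\int_K |v(x)-v(y)|^2|x-y|^{-3-2s}\,dx\,dy\big)^{1/2}$ for $0<s<1$, and $\|\nabla v\|_{0,K}$ for $s=1$; for vector fields the squares of the seminorms of the components are summed. Put $\|\chi\|_{H(\mathrm{div},K)}^2=\|\chi\|_{0,K}^2+\|\mathrm{div}\,\chi\|_{0,K}^2$,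 with the divergence in the weak sense. The low order face virtual element space $V(K)$ consists of the fields $\psi_h\in[L^2(K)]^3$ such that the weak divergence $\mathrm{div}\,\psi_h$ and the weak curl $\mathrm{curl}\,\psi_h$ are constant, the normal trace of $\psi_h$ is constant on each face, and $\int_K\psi_h\cdot\big((x-x_K)\times q_0\big)\,dx=0$ for all $q_0\in\mathbb R^3$, where $x_K$ is the barycenter of $K$. Given $\psi\in[H^\varepsilon(K)]^3$ with $\varepsilon>0$ and $\mathrm{div}\,\psi\in L^2(K)$, a face interpolant of $\psi$ is a field $\psi_I\in V(K)$ with $\int_F(\psi-\psi_I)\cdot n_F=0$ for every face $F$ of $K$; here $\int_F\psi\cdot n_F$ is understood as the extension by density of the flux of fields smooth up to the boundary, with respect to the norm of $[H^\varepsilon(K)]^3$ for the field and of $L^2(K)$ for its divergence. **Statement.** Let $\gamma,\sigma>0$. (i) There is a constant $C>0$, depending only on $\gamma$ and $\sigma$, such that for every $(\gamma,\sigma)$-regular polyhedral element $K$, all $\varepsilon>0$ and $0\le s\le 1$, and every $\psi\in[H^\varepsilon(K)]^3$ with $\mathrm{div}\,\psi\in H^s(K)$, a face interpolant of $\psi$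 exists, and every face interpolant $\psi_I$ of $\psi$ satisfies $$\mathrm{div}\,\psi_I=\frac1{|K|}\int_K\mathrm{div}\,\psi\,dx,\qquad \|\mathrm{div}(\psi-\psi_I)\|_{0,K}\le C\,h_K^s\,|\mathrm{div}\,\psi|_{s,K}.$$ (ii) For every $1/2<s\le1$ there is a constant $C>0$, depending only on $\gamma$, $\sigma$ and $s$, such that for every $(\gamma,\sigma)$-regular polyhedral element $K$, every $\psi\in[H^s(K)]^3$ with $\mathrm{div}\,\psi\in H^s(K)$, and every face interpolant $\psi_I$ of $\psi$ (with $\varepsilon = s$), $$\|\psi-\psi_I\|_{H(\mathrm{div},K)}\le C\,h_K^s\,\big(|\psi|_{s,K}^2+|\mathrm{div}\,\psi|_{s,K}^2\big)^{1/2}.$$ -/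

import Mathlib

open MeasureTheory Set Filter Topology
open scoped ENNReal ContDiff RealInnerProductSpace

noncomputable section

namespace FaceVEM

/-- Three-dimensional Euclidean space. -/
abbrev E3 : Type := EuclideanSpace ℝ (Fin 3)

/-- The vector product of `ℝ³`. -/
def cross (u v : E3) : E3 := WithLp.toLp 2 (crossProduct u.ofLp v.ofLp)

/-- The classical divergence of a differentiable vector field. -/
def divergence (Ψ : E3 → E3) (x : E3) : ℝ :=
  ∑ i : Fin 3, (fderiv ℝ Ψ x (EuclideanSpace.single i 1)) i

/-! ### Weak derivatives -/

/-- Test functions `C_c^∞(K)`. -/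
structure IsTestFunction (K : Set E3) (φ : E3 → ℝ) : Prop where
  smooth : ContDiff ℝ ∞ φ
  compact : HasCompactSupport φ
  support_subset : tsupport φ ⊆ K

/-- `g` is the weak gradient of the scalar function `f` on the open set `K`. -/
structure HasWeakGradient (K : Set E3) (f : E3 → ℝ) (g : E3 → E3) : Prop where
  locallyIntegrable : LocallyIntegrableOn f K volume
  locallyIntegrable_grad : LocallyIntegrableOn g K volume
  integral_eq : ∀ φ, IsTestFunction K φ →
    ∫ x in K, f x • gradient φ x = - ∫ x in K, φ x • g x

/-- `d` is the weak divergence of the vector field `ψ` on the open set `K`. -/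
structure HasWeakDiv (K : Set E3) (ψ : E3 → E3) (d : E3 → ℝ) : Prop where
  locallyIntegrable : LocallyIntegrableOn ψ K volume
  locallyIntegrable_div : LocallyIntegrableOn d K volume
  integral_eq : ∀ φ, IsTestFunction K φ →
    ∫ x in K, ⟪ψ x, gradient φ x⟫ = - ∫ x in K, φ x * d x

/-- `q` is the weak curl of the vector field `ψ` on the open set `K`
(the integrated form of `curl (φ ψ) = ∇φ × ψ + φ curl ψ`). -/
structure HasWeakCurl (K : Set E3) (ψ : E3 → E3) (q : E3 → E3) : Prop where
  locallyIntegrable : LocallyIntegrableOn ψ K volume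
  locallyIntegrable_curl : LocallyIntegrableOn q K volume
  integral_eq : ∀ φ, IsTestFunction K φ →
    ∫ x in K, φ x • q x = ∫ x in K, cross (ψ x) (gradient φ x)

/-! ### Sobolev spaces of real order `s ≥ 0` -/

/-- The Gagliardo (Sobolev-Slobodeckij) seminorm of order `σ ∈ (0,1)` on `K ⊆ ℝ³`. -/
def gagliardo (K : Set E3) (σ : ℝ) (f : E3 → ℝ) : ℝ≥0∞ :=
  (∫⁻ x in K, ∫⁻ y in K, ‖f x - f y‖ₑ ^ 2 / edist x y ^ (3 + 2 * σ)) ^ (1 / 2 : ℝ)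

/-- The Sobolev seminorm of order `m + σ`, with `m` an integer and `0 ≤ σ < 1`. It is the
`L²` norm for `m + σ = 0`. Weak gradients are unique almost everywhere, so the
infimum is the value at the weak gradient, and it is infinite if there is none. -/
def seminormAux (K : Set E3) (σ : ℝ) : ℕ → (E3 → ℝ) → ℝ≥0∞
  | 0, f => if σ = 0 then eLpNorm f 2 (volume.restrict K) else gagliardo K σ f
  | m + 1, f => ⨅ (g : E3 → E3) (_ : HasWeakGradient K f g),
      (∑ i : Fin 3, seminormAux K σ m (fun x => g x i) ^ 2) ^ (1 / 2 : ℝ)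

/-- The seminorm `|f|_{s,K}` for real `s ≥ 0`. -/
def hSeminorm (K : Set E3) (s : ℝ) (f : E3 → ℝ) : ℝ≥0∞ :=
  seminormAux K (s - ⌊s⌋₊) ⌊s⌋₊ f

/-- The norm `‖f‖_{s,K}`: its square is the sum of `|f|_{j,K}²` over the integers `0 ≤ j < s`,
plus `|f|_{s,K}²`. -/
def hNorm (K : Set E3) (s : ℝ) (f : E3 → ℝ) : ℝ≥0∞ :=
  ((∑ j ∈ Finset.range ⌈s⌉₊, hSeminorm K j f ^ 2) + hSeminorm K s f ^ 2) ^ (1 / 2 : ℝ)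

/-- `f ∈ H^s(K)`. -/
def MemHs (K : Set E3) (s : ℝ) (f : E3 → ℝ) : Prop :=
  MemLp f 2 (volume.restrict K) ∧ hNorm K s f < ⊤

/-- `ψ ∈ [H^s(K)]³`. -/
def MemHsVec (K : Set E3) (s : ℝ) (ψ : E3 → E3) : Prop :=
  ∀ i : Fin 3, MemHs K s (fun x => ψ x i)

/-- The seminorm `|ψ|_{s,K}` of a vector field. -/
def hSeminormVec (K : Set E3) (s : ℝ) (ψ : E3 → E3) : ℝ≥0∞ :=
  (∑ i : Fin 3, hSeminorm K s (fun x => ψ x i) ^ 2) ^ (1 / 2 : ℝ)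

/-! ### Polyhedral elements -/

/-- A polyhedron `K` (a bounded open set) whose boundary is made of finitely many planar faces.
Faces are relatively open in their planes and pairwise disjoint; the relative boundary of each face
is a finite union of non-overlapping straight edges. Coplanar faces and aligned edges are allowed,
as in general polyhedral meshes. -/
structure PolyhedralElement where
  /-- the (open) element -/
  K : Set E3
  isOpen : IsOpen K
  nonempty : K.Nonempty
  isBounded : Bornology.IsBounded K
  /-- number of faces -/
  numFaces : ℕ
  /-- the relatively open faces -/
  face : Fin numFaces → Set E3
  /-- the outward unit normals -/
  normal : Fin numFaces → E3
  norm_normal : ∀ i, ‖normal i‖ = 1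
  /-- the plane of the `i`-th face is `{x | ⟪normal i, x⟫ = offset i}` -/
  offset : Fin numFaces → ℝ
  face_nonempty : ∀ i, (face i).Nonempty
  face_relOpen : ∀ i, ∃ U : Set E3, IsOpen U ∧ face i = U ∩ {x | ⟪normal i, x⟫ = offset i}
  face_disjoint : ∀ i j, i ≠ j → Disjoint (face i) (face j)
  frontier_eq : frontier K = ⋃ i, closure (face i)
  outward : ∀ i, ∀ x ∈ face i, ∃ δ > 0, ∀ t ∈ Ioo (0 : ℝ) δ,
    x - t • normal i ∈ K ∧ x + t • normal i ∉ closure K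
  /-- number of edges of each face -/
  numEdges : Fin numFaces → ℕ
  /-- end points of the edges of each face -/
  edgeA : ∀ i, Fin (numEdges i) → E3
  edgeB : ∀ i, Fin (numEdges i) → E3
  edge_ne : ∀ i e, edgeA i e ≠ edgeB i e
  edge_disjoint : ∀ i e e', e ≠ e' →
    Disjoint (openSegment ℝ (edgeA i e) (edgeB i e)) (segment ℝ (edgeA i e') (edgeB i e'))
  face_boundary : ∀ i, closure (face i) \ face i = ⋃ e, segment ℝ (edgeA i e) (edgeB i e)

namespace PolyhedralElement

/-- The diameter `h_K`. -/
def h (P : PolyhedralElement) : ℝ := Metric.diam P.K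

/-- The plane containing a face. -/
def plane (P : PolyhedralElement) (i : Fin P.numFaces) : Set E3 :=
  {x | ⟪P.normal i, x⟫ = P.offset i}

/-- The diameter `h_F` of a face. -/
def hFace (P : PolyhedralElement) (i : Fin P.numFaces) : ℝ := Metric.diam (P.face i)

/-- The length `h_e` of an edge of a face. -/
def hEdge (P : PolyhedralElement) (i : Fin P.numFaces) (e : Fin (P.numEdges i)) : ℝ :=
  dist (P.edgeA i e) (P.edgeB i e)

/-- The barycenter of the element. -/
def barycenter (P : PolyhedralElement) : E3 := ⨍ x in P.K, x

/-- Shape regularity with parameters `γ` (star-shapedness) and `σ` (the constant in the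
equivalences `h_K ≈ h_F` and `h_F ≈ h_e`). The element is star-shaped with respect to
a ball of diameter `γ h_K`, and each face with respect to a disc of diameter `γ h_F`. -/
structure IsRegular (P : PolyhedralElement) (γ σ : ℝ) : Prop where
  star : ∃ x₀, ∀ y ∈ Metric.ball x₀ (γ * P.h / 2), StarConvex ℝ y P.K
  star_face : ∀ i, ∃ x₀ ∈ P.plane i, ∀ y ∈ Metric.ball x₀ (γ * P.hFace i / 2) ∩ P.plane i,
    StarConvex ℝ y (P.face i)
  h_face : ∀ i, P.h ≤ σ * P.hFace i ∧ P.hFace i ≤ σ * P.h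
  h_edge : ∀ i e, P.hFace i ≤ σ * P.hEdge i e ∧ P.hEdge i e ≤ σ * P.hFace i

/-- Integral over a face with respect to the surface measure. -/
def faceIntegral (P : PolyhedralElement) (i : Fin P.numFaces) (f : E3 → ℝ) : ℝ :=
  ∫ x in P.face i, f x ∂(Measure.euclideanHausdorffMeasure 2)

end PolyhedralElement

/-! ### The face virtual element space and the face interpolant -/

/-- The normal trace of the field `ψ`, with weak divergence `d`, is the constant `c i` on
the face `i`: Green's formula holds for all functions smooth up to the boundary. -/
def HasFaceNormalComponents (P : PolyhedralElement) (ψ : E3 → E3) (d : E3 → ℝ)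
    (c : Fin P.numFaces → ℝ) : Prop :=
  ∀ φ : E3 → ℝ, ContDiff ℝ ∞ φ → HasCompactSupport φ →
    (∫ x in P.K, ⟪ψ x, gradient φ x⟫) + (∫ x in P.K, φ x * d x)
      = ∑ i, P.faceIntegral i (fun x => c i * φ x)

/-- The fields of the face space `V(K)` whose normal component on the face `i` is `c i`. -/
structure MemFaceSpaceWith (P : PolyhedralElement) (ψ : E3 → E3) (c : Fin P.numFaces → ℝ) :
    Prop where
  memLp : MemLp ψ 2 (volume.restrict P.K)
  div_normal : ∃ d₀ : ℝ, HasWeakDiv P.K ψ (fun _ => d₀) ∧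
    HasFaceNormalComponents P ψ (fun _ => d₀) c
  curl : ∃ q₀ : E3, HasWeakCurl P.K ψ (fun _ => q₀)
  enhancing : ∀ q₀ : E3, ∫ x in P.K, ⟪ψ x, cross (x - P.barycenter) q₀⟫ = 0

/-- The low order face virtual element space `V(K)`. -/
def faceSpace (P : PolyhedralElement) : Set (E3 → E3) := {ψ | ∃ c, MemFaceSpaceWith P ψ c}

/-- `ℓ i` is the flux `∫_{F_i} ψ · n` of `ψ ∈ [H^ε(K)]³`, with weak divergence `d ∈ L²(K)`, through
each face: the fluxes are extended by density from fields smooth up to the boundary, with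
respect to the norm of `[H^ε(K)]³` for the field and of `L²(K)` for its divergence. -/
def HasFaceFluxes (P : PolyhedralElement) (ε : ℝ) (ψ : E3 → E3) (d : E3 → ℝ)
    (ℓ : Fin P.numFaces → ℝ) : Prop :=
  ∃ Ψ : ℕ → E3 → E3, (∀ k, ContDiff ℝ ∞ (Ψ k)) ∧
    (∀ i : Fin 3, Tendsto (fun k => hNorm P.K ε (fun x => ψ x i - Ψ k x i)) atTop (𝓝 0)) ∧
    Tendsto (fun k => eLpNorm (fun x => d x - divergence (Ψ k) x) 2 (volume.restrict P.K))
      atTop (𝓝 0) ∧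
    ∀ i, Tendsto (fun k => P.faceIntegral i (fun x => ⟪Ψ k x, P.normal i⟫)) atTop (𝓝 (ℓ i))

/-- `ψI` is the face interpolant of `ψ ∈ [H^ε(K)]³` with weak divergence `d`: it belongs to `V(K)`
and `∫_F ψI · n = ∫_F ψ · n` for each face `F`. -/
def IsFaceInterpolant (P : PolyhedralElement) (ε : ℝ) (ψ : E3 → E3) (d : E3 → ℝ)
    (ψI : E3 → E3) : Prop :=
  ∃ c : Fin P.numFaces → ℝ, MemFaceSpaceWith P ψI c ∧
    HasFaceFluxes P ε ψ d (fun i => P.faceIntegral i (fun _ => c i))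

/-- The `L²(K)` norm, for scalar or vector fields. -/
def l2Norm {V : Type*} [NormedAddCommGroup V] (K : Set E3) (f : E3 → V) : ℝ≥0∞ :=
  eLpNorm f 2 (volume.restrict K)

end FaceVEM

end

/-!
The divergence of the interpolant is settled by Green's formula with the constant function `1`: it
is the sum of the fluxes of `ψ` divided by `|K|`, hence the mean of `div ψ`
(`mul_volume_eq_of_hasFaceNormalComponents`, `HasFaceFluxes.sum_eq`). Its error is therefore the
distance of `div ψ` to its mean, and the Poincaré inequality in `H^s(K)` on a domain star-shaped
with respect to a ball (`IsStarBall.poincare`) bounds it with a constant that depends on `γ` only.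

**Existence.** Contracting `K` slightly towards the center of the ball and mollifying gives
smoothing operators that commute with weak derivatives up to the ratio of the contraction, and
converge in all the norms involved. They provide smooth approximations of `ψ`, but for `ε ≤ 1/2` the
flux through a single face need not be bounded in the norm of `H^ε(K)` and `H(div)`; an
approximating sequence with convergent fluxes exists nevertheless, since the kernel of an unbounded
linear functional is dense (`exists_seq_tendsto_functionals`, `exists_hasFaceFluxes`). A field of
the face space with given normal components is built without regularity theory
(`exists_memFaceSpaceWith`): the Riesz representation, in the closure of the gradients in `L²(K)`,
of the right-hand side of Green's formula has the required divergence and normal components and is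
curl free. The vanishing moments are then restored by adding a field that has a constant curl and is
orthogonal to all gradients, which affects neither the divergence nor the normal components
(`exists_rotPerp`).

**The `L²` estimate.** The interpolant of a constant field is the field itself
(`MemFaceSpaceWith.sub_const`), so that only the difference of `ψ` and its mean matters. For a field
of the face space, `exists_stability_constant` bounds the `L²` norm by the normal components. The
part of the field in the closure of the gradients is controlled through Green's formula and a trace
inequality. The other part differs from the linear field with the same curl by a curl free field,
that is, by a limit of gradients (`mem_gradSpace_of_curl_eq_zero`, a Poincaré lemma for smoothed
fields), so that the vanishing moments bound its norm by that of the first part, once the constant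
curl has been estimated by testing with a bump function (`norm_le_of_inner_rotL_eq_zero`). The
normal components of the interpolant are the fluxes of `ψ` divided by the areas of the faces. These
areas are bounded below by a multiple of `h_K²`, as each face contains a disc
(`IsRegular.le_faceIntegral_one`), and the fluxes are bounded by trace inequalities of order
`s > 1/2` (`lintegral_face_sub_average_le`).

**Geometry.** The ball with respect to which the element is star-shaped lies on
the inner side of each face (`le_height`), and up to a null set the element is the disjoint union of
the cones over its faces (`ae_eq_iUnion_faceCone`). Integration along the rays of a cone gives the
trace formula. The divergence theorem (`integral_divergence`) follows from the gauge of the element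
seen from the center of the ball: it is Lipschitz continuous, equal to `1` on the boundary, and
linear on each cone, with the normal of the face divided by its height as gradient.
-/

noncomputable section

namespace FaceVEM

/-! ### Affine changes of variables -/

theorem measurableEmbedding_smul_add {V : Type*} [NormedAddCommGroup V] [NormedSpace ℝ V]
    [MeasurableSpace V] [BorelSpace V] {l : ℝ} (hl : l ≠ 0) (b : V) :
    MeasurableEmbedding (fun x : V => l • x + b) :=
  ((Homeomorph.smulOfNeZero l hl).trans (Homeomorph.addRight b)).measurableEmbedding

section Affine

variable {V : Type*} [NormedAddCommGroup V] [NormedSpace ℝ V] [FiniteDimensional ℝ V]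
  [MeasurableSpace V] [BorelSpace V] (μ : Measure V) [μ.IsAddHaarMeasure]

theorem map_smul_add_addHaar {l : ℝ} (hl : l ≠ 0) (b : V) :
    μ.map (fun x => l • x + b) = ENNReal.ofReal |(l ^ Module.finrank ℝ V)⁻¹| • μ := by
  have h : (fun x : V => l • x + b) = (fun x => x + b) ∘ (fun x => l • x) := rfl
  rw [h, ← Measure.map_map (by fun_prop) (by fun_prop), Measure.map_addHaar_smul μ hl,
    Measure.map_smul, map_add_right_eq_self]

theorem lintegral_comp_smul_add {l : ℝ} (hl : l ≠ 0) (b : V) (F : V → ℝ≥0∞) :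
    ∫⁻ x, F (l • x + b) ∂μ = ENNReal.ofReal |(l ^ Module.finrank ℝ V)⁻¹| * ∫⁻ x, F x ∂μ := by
  rw [← (measurableEmbedding_smul_add hl b).lintegral_map (μ := μ) F, map_smul_add_addHaar μ hl,
    lintegral_smul_measure, smul_eq_mul]

theorem quasiMeasurePreserving_smul_add {l : ℝ} (hl : l ≠ 0) (b : V) :
    Measure.QuasiMeasurePreserving (fun x : V => l • x + b) μ μ :=
  ⟨(measurableEmbedding_smul_add hl b).measurable, by
    rw [map_smul_add_addHaar μ hl]; exact Measure.smul_absolutelyContinuous⟩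

theorem eLpNorm_two_comp_smul_add {l : ℝ} (hl : l ≠ 0) (b : V) (F : V → ℝ) :
    eLpNorm (fun x => F (l • x + b)) 2 μ
      = ENNReal.ofReal |(l ^ Module.finrank ℝ V)⁻¹| ^ (1 / 2 : ℝ) * eLpNorm F 2 μ := by
  rw [eLpNorm_eq_lintegral_rpow_enorm_toReal (by norm_num) (by norm_num),
    eLpNorm_eq_lintegral_rpow_enorm_toReal (by norm_num) (by norm_num),
    lintegral_comp_smul_add μ hl b (fun x => ‖F x‖ₑ ^ (2 : ℝ≥0∞).toReal),
    ENNReal.mul_rpow_of_nonneg _ _ (by norm_num)]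
  simp

/-- Rescaled affine perturbations of the identity act continuously on `L²`. -/
theorem tendsto_eLpNorm_sub_comp_smul_add {F : V → ℝ} (hF : MemLp F 2 μ) :
    Tendsto (fun p : ℝ × ℝ × V => eLpNorm (fun x => F x - p.1 * F (p.2.1 • x + p.2.2)) 2 μ)
      (𝓝 (1, 1, 0)) (𝓝 0) := by
  rw [ENNReal.tendsto_nhds_zero]
  intro ε hε
  set n := Module.finrank ℝ V
  set A : ℝ≥0∞ := 2 * ENNReal.ofReal (2 ^ n) ^ (1 / 2 : ℝ) with hA
  have hA0 : A ≠ 0 := by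
    have : ENNReal.ofReal (2 ^ n) ≠ 0 := by simp
    simp [hA]
  have hAt : A ≠ ⊤ := by
    rw [hA]
    exact ENNReal.mul_ne_top (by norm_num)
      (ENNReal.rpow_ne_top_of_nonneg (by norm_num) ENNReal.ofReal_ne_top)
  -- approximate `F` by a continuous function `g` with compact support
  obtain ⟨g, hgs, hgF, hgc, hgm⟩ := hF.exists_hasCompactSupport_eLpNorm_sub_le (by norm_num)
    (ε := (ε / 3) / (1 + A)) (by
      refine (ENNReal.div_pos (ENNReal.div_pos hε.ne' (by norm_num)).ne' ?_).ne'
      exact ENNReal.add_ne_top.2 ⟨by norm_num, hAt⟩)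
  have hgF' : (1 + A) * eLpNorm (F - g) 2 μ ≤ ε / 3 := by
    calc (1 + A) * eLpNorm (F - g) 2 μ ≤ (1 + A) * ((ε / 3) / (1 + A)) := by gcongr
      _ ≤ ε / 3 := ENNReal.mul_div_le
  obtain ⟨R, hR⟩ := (hgs.isCompact.isBounded).subset_closedBall (0 : V)
  obtain ⟨M, hM⟩ := hgc.bounded_above_of_compact_support hgs
  have hgR : ∀ x, R < ‖x‖ → g x = 0 := by
    intro x hx
    by_contra h
    have := hR (subset_tsupport g h)
    simp at this
    linarith
  -- near `(1, 1, 0)` the preimages of the support of `g` stay in a fixed ball and the factors are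
  -- bounded
  have hnear : ∀ᶠ p : ℝ × ℝ × V in 𝓝 (1, 1, 0), |p.1| ≤ 2 ∧ 1 / 2 < p.2.1 ∧ p.2.1 < 2 ∧ ‖p.2.2‖ < 1 := by
    have h1 : ∀ᶠ p : ℝ × ℝ × V in 𝓝 (1, 1, 0), |p.1| < 2 :=
      (continuous_fst.abs).continuousAt.eventually_lt continuousAt_const (by norm_num)
    have h2 : ∀ᶠ p : ℝ × ℝ × V in 𝓝 (1, 1, 0), 1 / 2 < p.2.1 :=
      continuousAt_const.eventually_lt (by fun_prop) (by norm_num)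
    have h3 : ∀ᶠ p : ℝ × ℝ × V in 𝓝 (1, 1, 0), p.2.1 < 2 :=
      ContinuousAt.eventually_lt (by fun_prop) continuousAt_const (by norm_num)
    have h4 : ∀ᶠ p : ℝ × ℝ × V in 𝓝 (1, 1, 0), ‖p.2.2‖ < 1 :=
      ContinuousAt.eventually_lt (by fun_prop) continuousAt_const (by norm_num)
    filter_upwards [h1, h2, h3, h4] with p a b c d using ⟨a.le, b, c, d⟩
  -- for the continuous function `g`, by dominated convergence
  have hmid : Tendsto (fun p : ℝ × ℝ × V =>
      eLpNorm (fun x => g x - p.1 * g (p.2.1 • x + p.2.2)) 2 μ) (𝓝 (1, 1, 0)) (𝓝 0) := by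
    have key : Tendsto (fun p : ℝ × ℝ × V =>
        ∫⁻ x, ‖g x - p.1 * g (p.2.1 • x + p.2.2)‖ₑ ^ (2 : ℝ) ∂μ) (𝓝 (1, 1, 0)) (𝓝 0) := by
      have h0 : (0 : ℝ≥0∞) = ∫⁻ x, (0 : V → ℝ≥0∞) x ∂μ := by simp
      rw [h0]
      refine tendsto_lintegral_filter_of_dominated_convergence
        ((Metric.closedBall (0 : V) (2 * (|R| + 1))).indicator
          (fun _ => ENNReal.ofReal (3 * M) ^ (2 : ℝ))) ?_ ?_ ?_ ?_
      · refine Eventually.of_forall fun p => ?_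
        have : Continuous fun x => g x - p.1 * g (p.2.1 • x + p.2.2) := by fun_prop
        exact (this.enorm.measurable).pow_const _
      · filter_upwards [hnear] with p hp
        obtain ⟨h1, h2, h3, h4⟩ := hp
        refine Eventually.of_forall fun x => ?_
        by_cases hx : x ∈ Metric.closedBall (0 : V) (2 * (|R| + 1))
        · rw [indicator_of_mem hx]
          gcongr
          rw [← ofReal_norm]
          apply ENNReal.ofReal_le_ofReal
          have := norm_sub_le (g x) (p.1 * g (p.2.1 • x + p.2.2))
          have h5 : ‖p.1 * g (p.2.1 • x + p.2.2)‖ ≤ 2 * M := by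
            rw [norm_mul]
            exact mul_le_mul h1 (hM _) (norm_nonneg _) (by norm_num)
          linarith [hM x]
        · have hx' : 2 * (|R| + 1) < ‖x‖ := by simpa using hx
          have hRR := le_abs_self R
          have h6 : g x = 0 := hgR x (by linarith [abs_nonneg R])
          have h7 : g (p.2.1 • x + p.2.2) = 0 := by
            apply hgR
            have h8 : ‖p.2.1 • x‖ ≤ ‖p.2.1 • x + p.2.2‖ + ‖p.2.2‖ := by
              have := norm_sub_le (p.2.1 • x + p.2.2) p.2.2
              simpa using this
            rw [norm_smul, Real.norm_eq_abs, abs_of_pos (by linarith)] at h8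
            have h9 : 1 / 2 * ‖x‖ ≤ p.2.1 * ‖x‖ := by gcongr
            linarith
          simp [h6, h7]
      · rw [lintegral_indicator measurableSet_closedBall]
        simp only [lintegral_const, Measure.restrict_apply, MeasurableSet.univ, univ_inter]
        exact ENNReal.mul_ne_top (ENNReal.rpow_ne_top_of_nonneg (by norm_num) ENNReal.ofReal_ne_top)
          (isCompact_closedBall _ _).measure_lt_top.ne
      · refine Eventually.of_forall fun x => ?_
        have hc : Continuous fun p : ℝ × ℝ × V => ‖g x - p.1 * g (p.2.1 • x + p.2.2)‖ₑ ^ (2 : ℝ) := by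
          have : Continuous fun p : ℝ × ℝ × V => g x - p.1 * g (p.2.1 • x + p.2.2) := by fun_prop
          exact ENNReal.continuous_rpow_const.comp this.enorm
        have := hc.tendsto (1, 1, 0)
        simpa using this
    have h2 := (ENNReal.continuous_rpow_const (y := (1 / 2 : ℝ))).tendsto 0 |>.comp key
    simp only [Function.comp_def] at h2
    rw [ENNReal.zero_rpow_of_pos (by norm_num)] at h2
    refine h2.congr fun p => ?_
    rw [eLpNorm_eq_lintegral_rpow_enorm_toReal (by norm_num) (by norm_num)]
    simp
  filter_upwards [hnear, (ENNReal.tendsto_nhds_zero.1 hmid) (ε / 3)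
    (ENNReal.div_pos hε.ne' (by norm_num))] with p hp hmidp
  obtain ⟨h1, h2, h3, h4⟩ := hp
  have hl : p.2.1 ≠ 0 := by linarith
  have hFg : AEStronglyMeasurable (F - g) μ := hF.1.sub hgm.1
  have hFgA : AEStronglyMeasurable (fun x => (F - g) (p.2.1 • x + p.2.2)) μ :=
    hFg.comp_quasiMeasurePreserving (quasiMeasurePreserving_smul_add μ hl _)
  -- the perturbation is applied to `F - g` and `g` separately; on the former it has norm at most
  -- `A`
  have hsplit : (fun x => F x - p.1 * F (p.2.1 • x + p.2.2))
      = ((F - g) - fun x => p.1 * (F - g) (p.2.1 • x + p.2.2))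
        + fun x => g x - p.1 * g (p.2.1 • x + p.2.2) := by
    funext x
    simp only [Pi.add_apply, Pi.sub_apply]
    ring
  have hgm' : AEStronglyMeasurable (fun x => g x - p.1 * g (p.2.1 • x + p.2.2)) μ := by
    have : Continuous fun x => g x - p.1 * g (p.2.1 • x + p.2.2) := by fun_prop
    exact this.aestronglyMeasurable
  have hA' : eLpNorm (fun x => p.1 * (F - g) (p.2.1 • x + p.2.2)) 2 μ ≤ A * eLpNorm (F - g) 2 μ := by
    have := eLpNorm_const_smul p.1 (fun x => (F - g) (p.2.1 • x + p.2.2)) 2 μ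
    have h5 : (fun x => p.1 * (F - g) (p.2.1 • x + p.2.2))
      = p.1 • (fun x => (F - g) (p.2.1 • x + p.2.2)) := rfl
    rw [h5, this, eLpNorm_two_comp_smul_add μ hl p.2.2 (F - g), hA, ← mul_assoc]
    gcongr
    · rw [← ofReal_norm]
      calc ENNReal.ofReal ‖p.1‖ ≤ ENNReal.ofReal 2 := ENNReal.ofReal_le_ofReal h1
        _ = 2 := by simp
    · rw [abs_inv, abs_of_pos (by positivity)]
      rw [inv_le_comm₀ (by positivity) (by positivity), ← inv_pow]
      exact pow_le_pow_left₀ (by norm_num) (by norm_num; linarith) _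
  rw [hsplit]
  calc _ ≤ eLpNorm ((F - g) - fun x => p.1 * (F - g) (p.2.1 • x + p.2.2)) 2 μ
        + eLpNorm (fun x => g x - p.1 * g (p.2.1 • x + p.2.2)) 2 μ :=
        eLpNorm_add_le (hFg.sub (hFgA.const_mul _)) hgm' (by norm_num)
    _ ≤ (eLpNorm (F - g) 2 μ + A * eLpNorm (F - g) 2 μ) + ε / 3 := by
        gcongr
        exact (eLpNorm_sub_le hFg (hFgA.const_mul _) (by norm_num)).trans (by gcongr)
    _ = (1 + A) * eLpNorm (F - g) 2 μ + ε / 3 := by ring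
    _ ≤ ε / 3 + ε / 3 := by gcongr
    _ ≤ ε / 3 + ε / 3 + ε / 3 := le_self_add
    _ = ε := ENNReal.add_thirds ε

end Affine

/-! ### Domains star-shaped with respect to a ball -/

/-- `K` is a nonempty bounded open set, star-shaped with respect to the ball of centre `x₀` and
radius `r > 0`. -/
structure IsStarBall (K : Set E3) (x₀ : E3) (r : ℝ) : Prop where
  isOpen : IsOpen K
  nonempty : K.Nonempty
  isBounded : Bornology.IsBounded K
  r_pos : 0 < r
  star : ∀ y ∈ Metric.ball x₀ r, StarConvex ℝ y K

namespace IsStarBall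

variable {K : Set E3} {x₀ : E3} {r : ℝ}

theorem mem_of_mem_ball (hK : IsStarBall K x₀ r) {y : E3} (hy : y ∈ Metric.ball x₀ r) : y ∈ K :=
  (hK.star y hy).mem hK.nonempty

theorem center_mem (hK : IsStarBall K x₀ r) : x₀ ∈ K :=
  hK.mem_of_mem_ball (Metric.mem_ball_self hK.r_pos)

/-- The half-open segments from the ball to points of the closure stay in the domain: moving the
end point slightly into `K` can be compensated by moving the starting point within the ball. -/
theorem combo_mem (hK : IsStarBall K x₀ r) {x y : E3} (hx : x ∈ closure K)
    (hy : y ∈ Metric.ball x₀ r) {t : ℝ} (ht0 : 0 < t) (ht1 : t ≤ 1) :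
    (1 - t) • x + t • y ∈ K := by
  have hcont : Tendsto (fun z : E3 => y + ((1 - t) / t) • (x - z)) (𝓝 x) (𝓝 y) := by
    have : Continuous fun z : E3 => y + ((1 - t) / t) • (x - z) := by fun_prop
    simpa using this.tendsto x
  have hev := hcont.eventually (Metric.isOpen_ball.mem_nhds hy)
  obtain ⟨z, hzK, hz⟩ := (mem_closure_iff_frequently.1 hx).and_eventually hev |>.exists
  have h := hK.star _ hz hzK ht0.le (sub_nonneg.2 ht1) (by ring)
  convert h using 1
  rw [smul_add, smul_smul, mul_div_cancel₀ _ ht0.ne', smul_sub]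
  abel

/-- Contracting the closure towards the centre leaves room for a ball. -/
theorem ball_subset (hK : IsStarBall K x₀ r) {x : E3} (hx : x ∈ closure K) {l : ℝ} (hl0 : 0 ≤ l)
    (hl1 : l < 1) : Metric.ball (l • x + (1 - l) • x₀) ((1 - l) * r) ⊆ K := by
  intro z hz
  have hl : 0 < 1 - l := by linarith
  have hy : x₀ + (1 - l)⁻¹ • (z - (l • x + (1 - l) • x₀)) ∈ Metric.ball x₀ r := by
    rw [Metric.mem_ball, dist_eq_norm] at hz ⊢
    rw [add_sub_cancel_left, norm_smul, norm_inv, Real.norm_of_nonneg hl.le, inv_mul_lt_iff₀ hl]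
    exact hz
  have h := hK.combo_mem hx hy hl (by linarith)
  convert h using 1
  rw [smul_add, smul_smul, mul_inv_cancel₀ hl.ne', one_smul, sub_sub_cancel]
  abel

theorem isCompact_closure (hK : IsStarBall K x₀ r) : IsCompact (closure K) :=
  hK.isBounded.isCompact_closure

theorem volume_lt_top (hK : IsStarBall K x₀ r) : volume K < ⊤ := hK.isBounded.measure_lt_top

theorem volume_pos (hK : IsStarBall K x₀ r) : 0 < volume K :=
  hK.isOpen.measure_pos volume hK.nonempty

theorem isFiniteMeasure (hK : IsStarBall K x₀ r) : IsFiniteMeasure (volume.restrict K) :=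
  ⟨by simpa using hK.volume_lt_top⟩

end IsStarBall

/-! ### Smoothing operators -/

/-- The data of a smoothing operator: mollification with a bump function, preceded by the affine
map `x ↦ l • x + c` contracting `K` well inside the compact set `A ⊆ K`. -/
structure Smoothing (K : Set E3) where
  /-- the compact set outside of which functions are cut off -/
  A : Set E3
  /-- the bump function -/
  b : ContDiffBump (0 : E3)
  /-- the ratio of the contraction -/
  l : ℝ
  /-- the translation part of the contraction -/
  c : E3
  l_pos : 0 < l
  isCompact : IsCompact A
  subset : A ⊆ K
  closedBall_subset : ∀ x ∈ K, Metric.closedBall (l • x + c) b.rOut ⊆ A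

/-- The contraction `x ↦ (1 - t) x + t x₀` maps the closure of `K` to points at distance at least
`t r` from the complement, which leaves room for a mollifier of radius `t r / 2`. -/
theorem IsStarBall.exists_smoothing {K : Set E3} {x₀ : E3} {r : ℝ} (hK : IsStarBall K x₀ r) :
    ∃ D : ℕ → Smoothing K, Tendsto (fun n => (D n).l) atTop (𝓝 1) ∧
      Tendsto (fun n => (D n).c) atTop (𝓝 0) ∧ Tendsto (fun n => (D n).b.rOut) atTop (𝓝 0) := by
  set t : ℕ → ℝ := fun n => 1 / ((n : ℝ) + 2) with ht
  have ht0 : ∀ n, 0 < t n := fun n => by positivity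
  have ht1 : ∀ n, t n < 1 := fun n => by
    rw [ht]; simp only; rw [div_lt_one (by positivity)]; linarith [(n.cast_nonneg : (0 : ℝ) ≤ n)]
  have htt : Tendsto t atTop (𝓝 0) := by
    have := (tendsto_const_div_atTop_nhds_zero_nat (1 : ℝ)).comp (tendsto_add_atTop_nat 2)
    refine this.congr fun n => ?_
    simp [ht]
  have hr := hK.r_pos
  have hcomp : ∀ n, IsCompact ((fun x : E3 => (1 - t n) • x + t n • x₀) '' closure K) := fun n =>
    hK.isCompact_closure.image (by fun_prop)
  refine ⟨fun n =>
    { A := Metric.cthickening (t n * r / 2)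
        ((fun x : E3 => (1 - t n) • x + t n • x₀) '' closure K)
      b := ⟨t n * r / 4, t n * r / 2, by have := ht0 n; positivity, by
        have := mul_pos (ht0 n) hr; linarith⟩
      l := 1 - t n
      c := t n • x₀
      l_pos := by linarith [ht1 n]
      isCompact := (hcomp n).cthickening
      subset := ?_
      closedBall_subset := ?_ }, ?_, ?_, ?_⟩
  · intro z hz
    obtain ⟨y, ⟨x, hx, rfl⟩, hy⟩ := (hcomp n).exists_infDist_eq_dist
      (hK.nonempty.mono subset_closure |>.image _) z
    have hd : dist z ((1 - t n) • x + t n • x₀) ≤ t n * r / 2 := by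
      rw [← hy]
      exact ENNReal.toReal_le_of_le_ofReal (by have := ht0 n; positivity) hz
    have := hK.ball_subset hx (l := 1 - t n) (by linarith [ht1 n]) (by linarith [ht0 n])
    rw [sub_sub_cancel] at this
    exact this (Metric.mem_ball.2 (hd.trans_lt (by have := mul_pos (ht0 n) hr; linarith)))
  · intro x hx z hz
    exact Metric.mem_cthickening_of_dist_le _ _ _ _ (mem_image_of_mem _ (subset_closure hx)) hz
  · simpa using tendsto_const_nhds.sub htt
  · simpa using htt.smul_const x₀
  · have := (htt.mul_const r).div_const 2
    simpa using this

namespace Smoothing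

variable {K : Set E3} (D : Smoothing K)

/-- The smoothing operator: `f` is cut off outside of `A`, mollified, and composed with the
contraction. On `K` the cut-off is not seen. -/
def op (f : E3 → ℝ) (x : E3) : ℝ :=
  convolution (D.b.normed volume) (D.A.indicator f) (ContinuousLinearMap.lsmul ℝ ℝ) volume
    (D.l • x + D.c)

/-- The smoothing operator, acting on each component of a vector field. -/
def opVec (ψ : E3 → E3) (x : E3) : E3 := WithLp.toLp 2 fun i => D.op (fun y => ψ y i) x

/-- The mollifier centred at the image of `x` under the contraction. -/
def kernel (x w : E3) : ℝ := D.b.normed volume (D.l • x + D.c - w)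

@[simp] theorem opVec_apply (ψ : E3 → E3) (x : E3) (i : Fin 3) :
    D.opVec ψ x i = D.op (fun y => ψ y i) x := rfl

theorem integrable_indicator {F : Type*} [NormedAddCommGroup F] {f : E3 → F}
    (hf : LocallyIntegrableOn f K volume) : Integrable (D.A.indicator f) volume :=
  (hf.integrableOn_compact_subset D.subset D.isCompact).integrable_indicator D.isCompact.measurableSet

theorem contDiff_op {f : E3 → ℝ} (hf : LocallyIntegrableOn f K volume) : ContDiff ℝ ∞ (D.op f) := by
  have h := (D.b.hasCompactSupport_normed (μ := volume)).contDiff_convolution_left (μ := volume)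
    (ContinuousLinearMap.lsmul ℝ ℝ) (D.b.contDiff_normed (n := ⊤))
    (D.integrable_indicator hf).locallyIntegrable
  exact h.comp (by fun_prop)

theorem contDiff_opVec {ψ : E3 → E3} (hψ : ∀ i, LocallyIntegrableOn (fun x => ψ x i) K volume) :
    ContDiff ℝ ∞ (D.opVec ψ) :=
  contDiff_euclidean.2 fun i => D.contDiff_op (hψ i)

theorem tsupport_kernel_subset {x : E3} (hx : x ∈ K) : tsupport (D.kernel x) ⊆ D.A := by
  have h : tsupport (D.kernel x) ⊆ Metric.closedBall (D.l • x + D.c) D.b.rOut := by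
    refine closure_minimal (fun w hw => ?_) Metric.isClosed_closedBall
    have : D.l • x + D.c - w ∈ Function.support (D.b.normed (volume : Measure E3)) := hw
    rw [D.b.support_normed_eq] at this
    rw [Metric.mem_closedBall, dist_comm, dist_eq_norm]
    simpa using (mem_ball_zero_iff.1 this).le
  exact h.trans (D.closedBall_subset x hx)

theorem contDiff_kernel (x : E3) : ContDiff ℝ ∞ (D.kernel x) :=
  (D.b.contDiff_normed (n := ⊤) (μ := volume)).comp (by fun_prop)

/-- The identities that define weak derivatives can be tested with the kernel, whose support stays
away from the boundary. -/
theorem isTestFunction_kernel {x : E3} (hx : x ∈ K) : IsTestFunction K (D.kernel x) where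
  smooth := D.contDiff_kernel x
  compact := D.isCompact.of_isClosed_subset (isClosed_tsupport _) (D.tsupport_kernel_subset hx)
  support_subset := (D.tsupport_kernel_subset hx).trans D.subset

/-- An integral against a function supported in `A` sees neither the cut-off nor the values
outside of `K`. -/
theorem integral_mul_indicator (hKm : MeasurableSet K) {g : E3 → ℝ} (hg : Function.support g ⊆ D.A)
    (f : E3 → ℝ) : ∫ w, g w * D.A.indicator f w = ∫ w in K, g w * f w := by
  rw [← integral_indicator hKm]
  refine integral_congr_ae (Eventually.of_forall fun w => ?_)
  by_cases hw : w ∈ D.A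
  · simp [indicator_of_mem hw, indicator_of_mem (D.subset hw)]
  · have : g w = 0 := by
      by_contra h
      exact hw (hg h)
    simp only [this, zero_mul]
    by_cases hwK : w ∈ K <;> simp [hwK, this]

theorem op_eq_integral_kernel (hKm : MeasurableSet K) (f : E3 → ℝ) {x : E3} (hx : x ∈ K) :
    D.op f x = ∫ w in K, D.kernel x w * f w := by
  rw [← D.integral_mul_indicator hKm
    ((subset_tsupport _).trans (D.tsupport_kernel_subset hx)), op, convolution_eq_swap]
  rfl

/-- Differentiating under the integral sign moves the derivative to the mollifier. -/
theorem fderiv_op (hKm : MeasurableSet K) {f : E3 → ℝ} (hf : LocallyIntegrableOn f K volume)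
    {x : E3} (hx : x ∈ K) (v : E3) :
    fderiv ℝ (D.op f) x v = -D.l * ∫ w in K, fderiv ℝ (D.kernel x) w v * f w := by
  set η := D.b.normed (volume : Measure E3) with hη
  have hη1 : ContDiff ℝ 1 η := D.b.contDiff_normed (n := 1)
  have hηd : Differentiable ℝ η := hη1.differentiable (by norm_num)
  have h := D.b.hasCompactSupport_normed.hasFDerivAt_convolution_left (μ := volume)
    (ContinuousLinearMap.lsmul ℝ ℝ) hη1 (D.integrable_indicator hf).locallyIntegrable
    (D.l • x + D.c)
  have haff : HasFDerivAt (fun y : E3 => D.l • y + D.c) (D.l • ContinuousLinearMap.id ℝ E3) x :=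
    ((hasFDerivAt_id x).const_smul D.l).add_const D.c
  have h2 := h.comp x haff
  have h3 : fderiv ℝ (D.op f) x = _ := h2.fderiv
  have hk : ∀ w, fderiv ℝ (D.kernel x) w v = - fderiv ℝ η (D.l • x + D.c - w) v := by
    intro w
    have h4 : HasFDerivAt (fun w : E3 => D.l • x + D.c - w) (-ContinuousLinearMap.id ℝ E3) w :=
      (hasFDerivAt_id w).const_sub _
    have h5 := (hηd (D.l • x + D.c - w)).hasFDerivAt.comp w h4
    have h6 : fderiv ℝ (D.kernel x) w = _ := h5.fderiv
    rw [h6]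
    simp
  have hsupp : Function.support (fun w => fderiv ℝ (D.kernel x) w v) ⊆ D.A := by
    refine subset_trans ?_ (D.tsupport_kernel_subset hx)
    intro w hw
    apply support_fderiv_subset ℝ (f := D.kernel x)
    intro h0
    apply hw
    simp [h0]
  rw [h3]
  simp only [ContinuousLinearMap.comp_smul, ContinuousLinearMap.comp_id]
  rw [smul_apply, smul_eq_mul, neg_mul, ← mul_neg]
  congr 1
  rw [← D.integral_mul_indicator hKm hsupp, ← integral_neg]
  have hint : Integrable (fun t => ((ContinuousLinearMap.lsmul ℝ ℝ : ℝ →L[ℝ] ℝ →L[ℝ] ℝ).precompL E3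
      (fderiv ℝ η t)) (D.A.indicator f (D.l • x + D.c - t))) volume := by
    refine (D.b.hasCompactSupport_normed.fderiv ℝ).convolutionExists_left
      ((ContinuousLinearMap.lsmul ℝ ℝ : ℝ →L[ℝ] ℝ →L[ℝ] ℝ).precompL E3)
      (hη1.continuous_fderiv (by norm_num)) (D.integrable_indicator hf).locallyIntegrable _
  rw [convolution, ContinuousLinearMap.integral_apply hint]
  rw [← integral_sub_left_eq_self _ volume (D.l • x + D.c)]
  refine integral_congr_ae (Eventually.of_forall fun w => ?_)
  simp only [hk, sub_sub_cancel]
  simp [ContinuousLinearMap.precompL_apply]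

/-! ### Components of the gradient -/

theorem _root_.FaceVEM.gradient_apply_eq (f : E3 → ℝ) (x : E3) (i : Fin 3) :
    gradient f x i = fderiv ℝ f x (EuclideanSpace.single i 1) := by
  have h : ⟪gradient f x, EuclideanSpace.single i (1 : ℝ)⟫ = fderiv ℝ f x (EuclideanSpace.single i 1) := by
    rw [gradient, InnerProductSpace.toDual_symm_apply]
  rw [← h, EuclideanSpace.inner_single_right]
  simp

theorem _root_.FaceVEM.inner_gradient_eq (f : E3 → ℝ) (x v : E3) :
    ⟪v, gradient f x⟫ = fderiv ℝ f x v := by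
  rw [real_inner_comm, gradient, InnerProductSpace.toDual_symm_apply]

end Smoothing

/-! ### Weak derivatives -/

section WeakDerivatives

variable {K : Set E3}

theorem integrableOn_smul_of_tsupport_subset {F : Type*} [NormedAddCommGroup F] [NormedSpace ℝ F]
    {f : E3 → F} (hf : LocallyIntegrableOn f K volume) {φ : E3 → ℝ} (hφ : Continuous φ)
    (hc : HasCompactSupport φ) (hs : tsupport φ ⊆ K) : IntegrableOn (fun x => φ x • f x) K := by
  have h := ((hf.integrableOn_compact_subset hs hc).continuousOn_smul hφ.continuousOn hc)
  refine (integrableOn_iff_integrable_of_support_subset ?_).1 h |>.integrableOn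
  intro x hx
  apply subset_tsupport φ
  intro h0
  exact hx (by simp [h0])

theorem integrableOn_smul_of_tsupport_subset' {F : Type*} [NormedAddCommGroup F] [NormedSpace ℝ F]
    {f : E3 → ℝ} (hf : LocallyIntegrableOn f K volume) {φ : E3 → F} (hφ : Continuous φ)
    (hc : HasCompactSupport φ) (hs : tsupport φ ⊆ K) : IntegrableOn (fun x => f x • φ x) K := by
  have h := ((hf.integrableOn_compact_subset hs hc).smul_continuousOn hφ.continuousOn hc)
  refine (integrableOn_iff_integrable_of_support_subset ?_).1 h |>.integrableOn
  intro x hx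
  apply subset_tsupport φ
  intro h0
  exact hx (by simp [h0])

theorem continuous_gradient {φ : E3 → ℝ} (hφ : ContDiff ℝ 1 φ) : Continuous (gradient φ) :=
  (InnerProductSpace.toDual ℝ E3).symm.continuous.comp (hφ.continuous_fderiv (by norm_num))

theorem tsupport_gradient_subset (φ : E3 → ℝ) : tsupport (gradient φ) ⊆ tsupport φ := by
  refine closure_minimal (fun x hx => ?_) (isClosed_tsupport φ)
  apply support_fderiv_subset ℝ (f := φ)
  intro h0
  apply hx
  simp only [gradient, h0, map_zero]

theorem IsTestFunction.contDiff_one {φ : E3 → ℝ} (h : IsTestFunction K φ) : ContDiff ℝ 1 φ :=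
  h.smooth.of_le (by exact_mod_cast le_top)

theorem IsTestFunction.continuous_gradient {φ : E3 → ℝ} (h : IsTestFunction K φ) :
    Continuous (gradient φ) :=
  FaceVEM.continuous_gradient h.contDiff_one

theorem IsTestFunction.hasCompactSupport_gradient {φ : E3 → ℝ} (h : IsTestFunction K φ) :
    HasCompactSupport (gradient φ) :=
  h.compact.of_isClosed_subset (isClosed_tsupport _) (tsupport_gradient_subset φ)

theorem IsTestFunction.tsupport_gradient_subset {φ : E3 → ℝ} (h : IsTestFunction K φ) :
    tsupport (gradient φ) ⊆ K :=
  (FaceVEM.tsupport_gradient_subset φ).trans h.support_subset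

theorem locallyIntegrableOn_apply {g : E3 → E3} (hg : LocallyIntegrableOn g K volume) (i : Fin 3) :
    LocallyIntegrableOn (fun x => g x i) K volume := by
  intro x hx
  obtain ⟨s, hs, h⟩ := hg x hx
  exact ⟨s, hs, (EuclideanSpace.proj (𝕜 := ℝ) i).integrable_comp h⟩

/-- The components of the identity defining the weak gradient. -/
theorem HasWeakGradient.integral_fderiv {f : E3 → ℝ} {g : E3 → E3} (h : HasWeakGradient K f g)
    {φ : E3 → ℝ} (hφ : IsTestFunction K φ) (i : Fin 3) :
    ∫ x in K, fderiv ℝ φ x (EuclideanSpace.single i 1) * f x = -∫ x in K, φ x * g x i := by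
  have h1 := congrArg (EuclideanSpace.proj (𝕜 := ℝ) i) (h.integral_eq φ hφ)
  rw [map_neg, ← ContinuousLinearMap.integral_comp_comm, ← ContinuousLinearMap.integral_comp_comm]
    at h1
  · simp only [PiLp.proj_apply, PiLp.smul_apply, smul_eq_mul, gradient_apply_eq] at h1
    rw [← h1]
    exact integral_congr_ae (Eventually.of_forall fun x => mul_comm _ _)
  · exact integrableOn_smul_of_tsupport_subset h.locallyIntegrable_grad hφ.smooth.continuous
      hφ.compact hφ.support_subset
  · exact integrableOn_smul_of_tsupport_subset' h.locallyIntegrable hφ.continuous_gradient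
      hφ.hasCompactSupport_gradient hφ.tsupport_gradient_subset

/-- A function that is continuously differentiable on `K` has its gradient as weak gradient. -/
theorem hasWeakGradient_of_hasFDerivAt (hK : IsOpen K) {f : E3 → ℝ} {g : E3 → E3}
    (hf : ∀ x ∈ K, HasFDerivAt f (innerSL ℝ (g x)) x) (hg : ContinuousOn g K) :
    HasWeakGradient K f g := by
  have hfc : ContinuousOn f K := fun x hx => (hf x hx).continuousAt.continuousWithinAt
  have hfl : LocallyIntegrableOn f K volume := hfc.locallyIntegrableOn hK.measurableSet
  have hgl : LocallyIntegrableOn g K volume := hg.locallyIntegrableOn hK.measurableSet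
  refine ⟨hfl, hgl, fun φ hφ => ?_⟩
  have hi1 := integrableOn_smul_of_tsupport_subset hgl hφ.smooth.continuous
      hφ.compact hφ.support_subset
  have hi2 := integrableOn_smul_of_tsupport_subset' hfl hφ.continuous_gradient
      hφ.hasCompactSupport_gradient hφ.tsupport_gradient_subset
  have hi3 := integrableOn_smul_of_tsupport_subset hfl hφ.smooth.continuous
      hφ.compact hφ.support_subset
  have hz : ∀ x, x ∉ K → φ x = 0 := fun x hx => by
    by_contra h0
    exact hx (hφ.support_subset (subset_tsupport _ h0))
  have hz' : ∀ x, x ∉ K → gradient φ x = 0 := fun x hx => by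
    by_contra h0
    exact hx (hφ.tsupport_gradient_subset (subset_tsupport _ h0))
  rw [setIntegral_eq_integral_of_forall_compl_eq_zero (fun x hx => by rw [hz' x hx, smul_zero]),
    setIntegral_eq_integral_of_forall_compl_eq_zero (fun x hx => by rw [hz x hx, zero_smul])]
  rw [integrableOn_iff_integrable_of_support_subset (by
    intro x hx; by_contra h; exact hx (by simp [hz x h]))] at hi1 hi3
  rw [integrableOn_iff_integrable_of_support_subset (by
    intro x hx; by_contra h; exact hx (by simp [hz' x h]))] at hi2
  ext i
  have hp1 := (EuclideanSpace.proj (𝕜 := ℝ) i).integrable_comp hi1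
  have hp2 := (EuclideanSpace.proj (𝕜 := ℝ) i).integrable_comp hi2
  have e1 := (EuclideanSpace.proj (𝕜 := ℝ) i).integral_comp_comm hi1
  have e2 := (EuclideanSpace.proj (𝕜 := ℝ) i).integral_comp_comm hi2
  simp only [PiLp.proj_apply, PiLp.smul_apply, smul_eq_mul, gradient_apply_eq]
    at e1 e2 hp1 hp2
  rw [PiLp.neg_apply, ← e1, ← e2]
  have hfd : ∀ x, fderiv ℝ f x (EuclideanSpace.single i 1) * φ x = φ x * g x i := by
    intro x
    by_cases hx : x ∈ K
    · rw [(hf x hx).fderiv, mul_comm]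
      simp [EuclideanSpace.inner_single_right]
    · simp [hz x hx]
  rw [integral_mul_fderiv_eq_neg_fderiv_mul_of_integrable]
  · simp only [hfd]
  · simpa only [hfd] using hp1
  · exact hp2
  · simpa only [smul_eq_mul, mul_comm] using hi3
  · exact fun x hx => (hf x (hφ.support_subset hx)).differentiableAt
  · exact fun x _ => (hφ.contDiff_one.differentiable (by norm_num)) x

theorem hasWeakGradient_of_contDiff (hK : IsOpen K) {f : E3 → ℝ} (hf : ContDiff ℝ 1 f) :
    HasWeakGradient K f (gradient f) := by
  refine hasWeakGradient_of_hasFDerivAt hK (fun x _ => ?_) (continuous_gradient hf).continuousOn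
  have := (hf.differentiable (by norm_num) x).hasFDerivAt
  have h : innerSL ℝ (gradient f x) = fderiv ℝ f x := by
    refine ContinuousLinearMap.ext fun v => ?_
    rw [innerSL_apply_apply, real_inner_comm, inner_gradient_eq]
  rwa [h]

theorem HasWeakGradient.congr_grad (hK : IsOpen K) {f : E3 → ℝ} {g g' : E3 → E3}
    (h : HasWeakGradient K f g) (hg : ∀ x ∈ K, g x = g' x) : HasWeakGradient K f g' := by
  refine ⟨h.locallyIntegrable, ?_, fun φ hφ => ?_⟩
  · intro x hx
    obtain ⟨s, hs, hi⟩ := h.locallyIntegrable_grad x hx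
    refine ⟨s ∩ K, inter_mem hs self_mem_nhdsWithin, ?_⟩
    have hm : ∀ᵐ y ∂(volume.restrict (s ∩ K)), y ∈ K :=
      ae_restrict_of_ae_restrict_of_subset inter_subset_right (ae_restrict_mem hK.measurableSet)
    exact (hi.mono_set inter_subset_left).congr_fun_ae (hm.mono fun y hy => hg y hy)
  · rw [h.integral_eq φ hφ]
    congr 1
    exact setIntegral_congr_fun hK.measurableSet fun x hx => by simp only [hg x hx]

theorem HasWeakGradient.sub_const_mul {f₁ f₂ : E3 → ℝ} {g₁ g₂ : E3 → E3} (a : ℝ)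
    (h₁ : HasWeakGradient K f₁ g₁) (h₂ : HasWeakGradient K f₂ g₂) :
    HasWeakGradient K (fun x => f₁ x - a * f₂ x) (fun x => g₁ x - a • g₂ x) := by
  refine ⟨h₁.locallyIntegrable.sub (h₂.locallyIntegrable.smul a),
    h₁.locallyIntegrable_grad.sub (h₂.locallyIntegrable_grad.smul a), fun φ hφ => ?_⟩
  have hi1 := integrableOn_smul_of_tsupport_subset h₁.locallyIntegrable_grad hφ.smooth.continuous
      hφ.compact hφ.support_subset
  have hi2 := integrableOn_smul_of_tsupport_subset' h₁.locallyIntegrable hφ.continuous_gradient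
      hφ.hasCompactSupport_gradient hφ.tsupport_gradient_subset
  have hj1 := integrableOn_smul_of_tsupport_subset h₂.locallyIntegrable_grad hφ.smooth.continuous
      hφ.compact hφ.support_subset
  have hj2 := integrableOn_smul_of_tsupport_subset' h₂.locallyIntegrable hφ.continuous_gradient
      hφ.hasCompactSupport_gradient hφ.tsupport_gradient_subset
  have e1 : ∀ x, (f₁ x - a * f₂ x) • gradient φ x
      = f₁ x • gradient φ x - a • (f₂ x • gradient φ x) := fun x => by
    rw [sub_smul, mul_smul]
  have e2 : ∀ x, φ x • (g₁ x - a • g₂ x) = φ x • g₁ x - a • (φ x • g₂ x) := fun x => by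
    rw [smul_sub, smul_comm]
  simp only [e1, e2]
  rw [integral_sub hi2 (Integrable.fun_smul a hj2), integral_sub hi1 (Integrable.fun_smul a hj1),
    integral_smul, integral_smul, h₁.integral_eq φ hφ, h₂.integral_eq φ hφ, smul_neg]
  abel

theorem HasWeakGradient.ae_unique (hK : IsOpen K) {f : E3 → ℝ} {g₁ g₂ : E3 → E3}
    (h₁ : HasWeakGradient K f g₁) (h₂ : HasWeakGradient K f g₂) :
    g₁ =ᵐ[volume.restrict K] g₂ := by
  have h := hK.ae_eq_zero_of_integral_contDiff_smul_eq_zero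
    (h₁.locallyIntegrable_grad.sub h₂.locallyIntegrable_grad) (fun φ h1 h2 h3 => ?_)
  · rw [Filter.EventuallyEq, ae_restrict_iff' hK.measurableSet]
    filter_upwards [h] with x hx hxK
    exact sub_eq_zero.1 (hx hxK)
  · have hφ : IsTestFunction K φ := ⟨h1, h2, h3⟩
    have hi1 := integrableOn_smul_of_tsupport_subset h₁.locallyIntegrable_grad
      hφ.smooth.continuous hφ.compact hφ.support_subset
    have hj1 := integrableOn_smul_of_tsupport_subset h₂.locallyIntegrable_grad
      hφ.smooth.continuous hφ.compact hφ.support_subset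
    rw [← setIntegral_eq_integral_of_forall_compl_eq_zero (s := K) (fun x hx => ?_)]
    · simp only [Pi.sub_apply, smul_sub]
      rw [integral_sub hi1 hj1]
      exact sub_eq_zero.2 (neg_inj.1 ((h₁.integral_eq φ hφ).symm.trans (h₂.integral_eq φ hφ)))
    · have : φ x = 0 := by
        by_contra h0
        exact hx (hφ.support_subset (subset_tsupport _ h0))
      simp [this]

/-- Smoothing commutes with the weak gradient, up to the ratio of the contraction. -/
theorem Smoothing.gradient_op (D : Smoothing K) (hK : IsOpen K) {f : E3 → ℝ} {g : E3 → E3}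
    (h : HasWeakGradient K f g) {x : E3} (hx : x ∈ K) :
    gradient (D.op f) x = D.l • D.opVec g x := by
  ext i
  rw [gradient_apply_eq, D.fderiv_op hK.measurableSet h.locallyIntegrable hx,
    h.integral_fderiv (D.isTestFunction_kernel hx), PiLp.smul_apply, D.opVec_apply,
    D.op_eq_integral_kernel hK.measurableSet _ hx]
  simp

theorem Smoothing.hasWeakGradient_op (D : Smoothing K) (hK : IsOpen K) {f : E3 → ℝ} {g : E3 → E3}
    (h : HasWeakGradient K f g) : HasWeakGradient K (D.op f) (fun x => D.l • D.opVec g x) :=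
  (hasWeakGradient_of_contDiff hK ((D.contDiff_op h.locallyIntegrable).of_le
    (by exact_mod_cast le_top))).congr_grad hK fun _ hx => D.gradient_op hK h hx

theorem inner_eq_sum (u v : E3) : ⟪u, v⟫ = ∑ i, u i * v i := by
  rw [PiLp.inner_apply]
  exact Finset.sum_congr rfl fun i _ => by simp [mul_comm]

/-- Smoothing commutes with the weak divergence, up to the ratio of the contraction. -/
theorem Smoothing.divergence_opVec (D : Smoothing K) (hK : IsOpen K) {ψ : E3 → E3} {d : E3 → ℝ}
    (h : HasWeakDiv K ψ d) {x : E3} (hx : x ∈ K) :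
    divergence (D.opVec ψ) x = D.l * D.op d x := by
  have hψ := fun i => locallyIntegrableOn_apply h.locallyIntegrable i
  have hd : ∀ i, (fderiv ℝ (D.opVec ψ) x (EuclideanSpace.single i 1)) i
      = fderiv ℝ (D.op fun y => ψ y i) x (EuclideanSpace.single i 1) := by
    intro i
    have h1 : HasFDerivAt (D.opVec ψ) (fderiv ℝ (D.opVec ψ) x) x :=
      ((D.contDiff_opVec hψ).differentiable (by simp) x).hasFDerivAt
    have h2 := (EuclideanSpace.proj (𝕜 := ℝ) i).hasFDerivAt.comp x h1
    have h3 : fderiv ℝ (D.op fun y => ψ y i) x = _ := h2.fderiv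
    rw [h3]
    rfl
  have hφ := D.isTestFunction_kernel hx
  rw [divergence]
  simp only [hd, D.fderiv_op hK.measurableSet (hψ _) hx]
  rw [D.op_eq_integral_kernel hK.measurableSet _ hx, ← Finset.mul_sum, ← integral_finsetSum]
  · have := h.integral_eq _ hφ
    simp only [inner_eq_sum, gradient_apply_eq] at this
    simp only [mul_comm (fderiv ℝ _ _ _)]
    rw [this]
    ring
  · intro i _
    have := integrableOn_smul_of_tsupport_subset' (hψ i) hφ.continuous_gradient
      hφ.hasCompactSupport_gradient hφ.tsupport_gradient_subset
    have h4 := (EuclideanSpace.proj (𝕜 := ℝ) i).integrable_comp this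
    simpa [gradient_apply_eq, mul_comm] using h4

end WeakDerivatives

/-! ### Convergence of smoothed functions -/

theorem eLpNorm_two_sq {α F : Type*} [MeasurableSpace α] [NormedAddCommGroup F] (f : α → F)
    (μ : Measure α) : eLpNorm f 2 μ ^ 2 = ∫⁻ x, ‖f x‖ₑ ^ 2 ∂μ := by
  rw [eLpNorm_eq_lintegral_rpow_enorm_toReal (by norm_num) (by norm_num), ← ENNReal.rpow_natCast,
    ← ENNReal.rpow_mul]
  simp

theorem eLpNorm_two_eq {α F : Type*} [MeasurableSpace α] [NormedAddCommGroup F] (f : α → F)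
    (μ : Measure α) : eLpNorm f 2 μ = (∫⁻ x, ‖f x‖ₑ ^ 2 ∂μ) ^ (1 / 2 : ℝ) := by
  rw [← eLpNorm_two_sq, ← ENNReal.rpow_natCast, ← ENNReal.rpow_mul]
  simp

theorem locallyIntegrableOn_of_memLp {F : Type*} [NormedAddCommGroup F] {K : Set E3}
    (hK : IsOpen K) {f : E3 → F} (hf : MemLp f 2 (volume.restrict K)) :
    LocallyIntegrableOn f K volume := by
  intro x hx
  obtain ⟨u, hu, hxu⟩ := Metric.isOpen_iff.1 hK x hx
  refine ⟨Metric.ball x u, mem_nhdsWithin_of_mem_nhds (Metric.ball_mem_nhds _ hu), ?_⟩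
  have : MemLp f 2 (volume.restrict (Metric.ball x u)) :=
    hf.mono_measure (Measure.restrict_mono hxu le_rfl)
  have hfin : IsFiniteMeasure ((volume : Measure E3).restrict (Metric.ball x u)) :=
    ⟨by rw [Measure.restrict_apply_univ]; exact measure_ball_lt_top⟩
  exact this.integrable (by norm_num)

theorem lintegral_sq_le {α : Type*} [MeasurableSpace α] {ν : Measure α} [IsProbabilityMeasure ν]
    {f : α → ℝ≥0∞} (hf : AEMeasurable f ν) : (∫⁻ x, f x ∂ν) ^ 2 ≤ ∫⁻ x, f x ^ 2 ∂ν := by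
  have h := ENNReal.lintegral_mul_le_Lp_mul_Lq ν (Real.HolderConjugate.two_two) hf
    (aemeasurable_const (b := (1 : ℝ≥0∞)))
  simp only [Pi.mul_apply, mul_one, ENNReal.one_rpow, lintegral_const, measure_univ] at h
  calc (∫⁻ x, f x ∂ν) ^ 2 ≤ ((∫⁻ x, f x ^ (2 : ℝ) ∂ν) ^ (1 / 2 : ℝ)) ^ 2 := by gcongr
    _ = ∫⁻ x, f x ^ 2 ∂ν := by
      rw [← ENNReal.rpow_natCast, ← ENNReal.rpow_mul]
      simp

/-- If `G` is pointwise bounded by averages of `F - κ F ∘ A_z` over affine maps `A_z`, then its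
`L²` norm is bounded by the supremum of the norms of these differences (Jensen's inequality). -/
theorem eLpNorm_le_of_average {V : Type*} [NormedAddCommGroup V] [NormedSpace ℝ V]
    [FiniteDimensional ℝ V] [MeasurableSpace V] [BorelSpace V] {μ : Measure V} [μ.IsAddHaarMeasure]
    {ν : Measure E3} [IsProbabilityMeasure ν] {F G : V → ℝ} (hF : Measurable F) {S : Set V}
    (hS : MeasurableSet S) {κ l : ℝ} {T : E3 → V} (hT : Continuous T)
    (hG : ∀ x ∈ S, ‖G x‖ₑ ≤ ∫⁻ z, ‖F x - κ * F (l • x + T z)‖ₑ ∂ν) {ε : ℝ≥0∞}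
    (hε : ∀ᵐ z ∂ν, eLpNorm (fun x => F x - κ * F (l • x + T z)) 2 μ ≤ ε) :
    eLpNorm G 2 (μ.restrict S) ≤ ε := by
  have hm : Measurable (Function.uncurry fun (x : V) (z : E3) =>
      ‖F x - κ * F (l • x + T z)‖ₑ ^ 2) := by
    have hTm := hT.measurable
    simp only [Function.uncurry_def]
    fun_prop
  have hsq : eLpNorm G 2 (μ.restrict S) ^ 2 ≤ ε ^ 2 := by
    rw [eLpNorm_two_sq]
    calc ∫⁻ x in S, ‖G x‖ₑ ^ 2 ∂μ
        ≤ ∫⁻ x in S, ∫⁻ z, ‖F x - κ * F (l • x + T z)‖ₑ ^ 2 ∂ν ∂μ := by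
          refine setLIntegral_mono' hS fun x hx => ?_
          calc ‖G x‖ₑ ^ 2 ≤ (∫⁻ z, ‖F x - κ * F (l • x + T z)‖ₑ ∂ν) ^ 2 := by
                gcongr; exact hG x hx
            _ ≤ _ := by
              refine lintegral_sq_le (Measurable.aemeasurable ?_)
              have hTm := hT.measurable
              fun_prop
      _ ≤ ∫⁻ x, ∫⁻ z, ‖F x - κ * F (l • x + T z)‖ₑ ^ 2 ∂ν ∂μ := setLIntegral_le_lintegral _ _
      _ = ∫⁻ z, ∫⁻ x, ‖F x - κ * F (l • x + T z)‖ₑ ^ 2 ∂μ ∂ν :=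
          lintegral_lintegral_swap hm.aemeasurable
      _ ≤ ∫⁻ _, ε ^ 2 ∂ν := by
          refine lintegral_mono_ae ?_
          filter_upwards [hε] with z hz
          rw [← eLpNorm_two_sq]
          gcongr
      _ = ε ^ 2 := by simp
  exact (ENNReal.pow_le_pow_left_iff two_ne_zero).1 hsq

namespace Smoothing

variable {K : Set E3} (D : Smoothing K)

/-- The probability measure whose density is the mollifier. -/
def prob : Measure E3 := volume.withDensity fun z => ENNReal.ofReal (D.b.normed volume z)

theorem measurable_density :
    Measurable fun z => ENNReal.ofReal (D.b.normed (volume : Measure E3) z) :=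
  ENNReal.measurable_ofReal.comp D.b.continuous_normed.measurable

instance : IsProbabilityMeasure D.prob := by
  refine ⟨?_⟩
  rw [prob, withDensity_apply _ MeasurableSet.univ, Measure.restrict_univ,
    ← ofReal_integral_eq_lintegral_ofReal D.b.integrable_normed
      (Eventually.of_forall D.b.nonneg_normed), D.b.integral_normed]
  simp

theorem ae_prob : ∀ᵐ z ∂D.prob, ‖z‖ < D.b.rOut := by
  rw [prob, ae_withDensity_iff D.measurable_density]
  refine Eventually.of_forall fun z hz => ?_
  have : z ∈ Function.support (D.b.normed (volume : Measure E3)) := by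
    intro h0
    exact hz (by simp [h0])
  rw [D.b.support_normed_eq] at this
  simpa using this

theorem op_eq_integral_prob (f : E3 → ℝ) (x : E3) :
    D.op f x = ∫ z, D.A.indicator f (D.l • x + (D.c - z)) ∂D.prob := by
  rw [prob, integral_withDensity_eq_integral_toReal_smul
    D.measurable_density (Eventually.of_forall fun _ => by simp)]
  rw [op, convolution]
  refine integral_congr_ae (Eventually.of_forall fun z => ?_)
  simp only [ContinuousLinearMap.lsmul_apply]
  rw [ENNReal.toReal_ofReal (D.b.nonneg_normed z), add_sub_assoc]

theorem integrable_prob {f : E3 → ℝ} (hf : LocallyIntegrableOn f K volume) (x : E3) :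
    Integrable (fun z => D.A.indicator f (D.l • x + (D.c - z))) D.prob := by
  rw [prob, integrable_withDensity_iff_integrable_smul'
    D.measurable_density (Eventually.of_forall fun _ => by simp)]
  have h := (D.b.hasCompactSupport_normed (μ := volume)).convolutionExists_left (μ := volume)
    (ContinuousLinearMap.lsmul ℝ ℝ) D.b.continuous_normed
    (D.integrable_indicator hf).locallyIntegrable (D.l • x + D.c)
  refine Integrable.congr h (Eventually.of_forall fun z => ?_)
  simp only [ContinuousLinearMap.lsmul_apply]
  rw [ENNReal.toReal_ofReal (D.b.nonneg_normed z), add_sub_assoc]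

theorem ae_mem {x : E3} (hx : x ∈ K) :
    ∀ᵐ z ∂D.prob, D.l • x + (D.c - z) ∈ D.A := by
  filter_upwards [D.ae_prob] with z hz
  apply D.closedBall_subset x hx
  rw [Metric.mem_closedBall, dist_eq_norm]
  have : D.l • x + (D.c - z) - (D.l • x + D.c) = -z := by abel
  rw [this, norm_neg]
  exact hz.le

theorem op_congr (hKm : MeasurableSet K) {f g : E3 → ℝ} (h : f =ᵐ[volume.restrict K] g) {x : E3}
    (hx : x ∈ K) : D.op f x = D.op g x := by
  rw [D.op_eq_integral_kernel hKm f hx, D.op_eq_integral_kernel hKm g hx]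
  refine integral_congr_ae ?_
  filter_upwards [h] with w hw
  rw [hw]

end Smoothing

/-- A sequence of smoothing operators tending to the identity. -/
structure SmoothingSeq (K : Set E3) where
  /-- the operators -/
  D : ℕ → Smoothing K
  tendsto_l : Tendsto (fun n => (D n).l) atTop (𝓝 1)
  tendsto_c : Tendsto (fun n => (D n).c) atTop (𝓝 0)
  tendsto_rOut : Tendsto (fun n => (D n).b.rOut) atTop (𝓝 0)

namespace SmoothingSeq

variable {K : Set E3} (A : SmoothingSeq K)

/-- The perturbations of the identity appearing in the `n`-th smoothing operator are eventually
uniformly small. -/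
theorem eventually_forall {V : Type*} [NormedAddCommGroup V] {T : E3 → V} (hT : Continuous T)
    (hT0 : T 0 = 0) {κ : ℕ → ℝ} (hκ : Tendsto κ atTop (𝓝 1)) {P : ℝ × ℝ × V → Prop}
    (hP : ∀ᶠ p in 𝓝 (1, 1, 0), P p) :
    ∀ᶠ n in atTop, ∀ z, ‖z‖ < (A.D n).b.rOut → P (κ n, (A.D n).l, T ((A.D n).c - z)) := by
  have hc : Tendsto (fun p : ℝ × ℝ × E3 => (p.1, p.2.1, T p.2.2)) (𝓝 (1, 1, 0)) (𝓝 (1, 1, 0)) := by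
    have : Continuous fun p : ℝ × ℝ × E3 => (p.1, p.2.1, T p.2.2) := by fun_prop
    simpa [hT0] using this.tendsto (1, 1, 0)
  obtain ⟨δ, hδ, h⟩ := Metric.eventually_nhds_iff.1 (hc.eventually hP)
  have h1 := Metric.tendsto_nhds.1 hκ δ hδ
  have h2 := Metric.tendsto_nhds.1 A.tendsto_l δ hδ
  have h3 := Metric.tendsto_nhds.1 A.tendsto_c (δ / 2) (by positivity)
  have h4 := Metric.tendsto_nhds.1 A.tendsto_rOut (δ / 2) (by positivity)
  filter_upwards [h1, h2, h3, h4] with n h1 h2 h3 h4 z hz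
  refine h (y := (κ n, (A.D n).l, (A.D n).c - z)) ?_
  rw [Prod.dist_eq, Prod.dist_eq]
  refine max_lt h1 (max_lt h2 ?_)
  rw [dist_zero_right] at h3 h4 ⊢
  have := norm_sub_le (A.D n).c z
  rw [Real.norm_eq_abs] at h4
  linarith [le_abs_self (A.D n).b.rOut]

/-- Smoothing converges in `L²(K)`. -/
theorem tendsto_eLpNorm (hK : IsOpen K) {f : E3 → ℝ} (hf : MemLp f 2 (volume.restrict K))
    {κ : ℕ → ℝ} (hκ : Tendsto κ atTop (𝓝 1)) :
    Tendsto (fun n => eLpNorm (fun x => f x - κ n * (A.D n).op f x) 2 (volume.restrict K))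
      atTop (𝓝 0) := by
  have hKm := hK.measurableSet
  obtain ⟨g, hgm, hfg⟩ := hf.1
  have hg : MemLp g 2 (volume.restrict K) := hf.ae_eq hfg
  have hgl : LocallyIntegrableOn g K volume := locallyIntegrableOn_of_memLp hK hg
  set F := K.indicator g with hF
  have hFm : Measurable F := hgm.measurable.indicator hKm
  have hF2 : MemLp F 2 volume := (memLp_indicator_iff_restrict hKm).2 hg
  have hlim := tendsto_eLpNorm_sub_comp_smul_add volume hF2
  rw [ENNReal.tendsto_nhds_zero] at hlim ⊢
  intro ε hε
  have hev := A.eventually_forall (T := fun z => z) continuous_id rfl hκ (hlim ε hε)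
  filter_upwards [hev] with n hn
  set D := A.D n
  have hcongr : (fun x => f x - κ n * D.op f x) =ᵐ[volume.restrict K]
      fun x => g x - κ n * D.op g x := by
    filter_upwards [hfg, ae_restrict_mem hKm] with x hx hxK
    rw [hx, D.op_congr hKm hfg hxK]
  rw [eLpNorm_congr_ae hcongr]
  -- the operator is an average of affine perturbations of the identity
  refine eLpNorm_le_of_average (ν := D.prob) hFm hKm (T := fun z => D.c - z) (by fun_prop)
    (κ := κ n) (l := D.l) (fun x hx => ?_) (D.ae_prob.mono fun z hz => hn z hz)
  have h1 : g x - κ n * D.op g x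
      = ∫ z, (g x - κ n * D.A.indicator g (D.l • x + (D.c - z))) ∂D.prob := by
    rw [integral_sub (integrable_const _) ((D.integrable_prob hgl x).const_mul _),
      integral_const_mul, ← D.op_eq_integral_prob]
    simp
  rw [h1]
  refine (enorm_integral_le_lintegral_enorm _).trans (le_of_eq (lintegral_congr_ae ?_))
  filter_upwards [D.ae_mem hx] with z hz
  rw [hF, indicator_of_mem hx, indicator_of_mem (D.subset hz), indicator_of_mem hz]

end SmoothingSeq

/-! ### The Gagliardo seminorm as an `L²` norm on the product -/

/-- The difference quotient whose `L²(K × K)` norm is the Gagliardo seminorm. -/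
def gagQuot (σ : ℝ) (f : E3 → ℝ) (p : E3 × E3) : ℝ :=
  (f p.1 - f p.2) / ‖p.1 - p.2‖ ^ ((3 + 2 * σ) / 2)

theorem enorm_gagQuot_sq (σ : ℝ) (f : E3 → ℝ) (x y : E3) :
    ‖gagQuot σ f (x, y)‖ₑ ^ 2 = ‖f x - f y‖ₑ ^ 2 / edist x y ^ (3 + 2 * σ) := by
  rcases eq_or_ne x y with rfl | hxy
  · simp [gagQuot]
  · have h0 : 0 < ‖x - y‖ := norm_pos_iff.2 (sub_ne_zero.2 hxy)
    have h1 : 0 < ‖x - y‖ ^ ((3 + 2 * σ) / 2) := Real.rpow_pos_of_pos h0 _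
    rw [gagQuot, edist_eq_enorm_sub, ← ofReal_norm (x - y), ENNReal.ofReal_rpow_of_pos h0]
    simp only
    rw [← ofReal_norm, ← ofReal_norm, norm_div, Real.norm_of_nonneg h1.le,
      ← ENNReal.ofReal_pow (by positivity), ← ENNReal.ofReal_pow (by positivity),
      ← ENNReal.ofReal_div_of_pos (by positivity), div_pow]
    congr 2
    rw [← Real.rpow_natCast, ← Real.rpow_mul h0.le]
    congr 1
    push_cast
    ring

theorem aestronglyMeasurable_gagQuot {μ : Measure E3} [SFinite μ] {f : E3 → ℝ}
    (hf : AEStronglyMeasurable f μ) (σ : ℝ) :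
    AEStronglyMeasurable (gagQuot σ f) (μ.prod μ) := by
  have h1 : AEStronglyMeasurable (fun p : E3 × E3 => f p.1 - f p.2) (μ.prod μ) :=
    hf.comp_fst.sub hf.comp_snd
  have h2 : Measurable fun p : E3 × E3 => ‖p.1 - p.2‖ ^ ((3 + 2 * σ) / 2) := by fun_prop
  exact (h1.aemeasurable.div h2.aemeasurable).aestronglyMeasurable

theorem gagliardo_eq_eLpNorm {K : Set E3} (σ : ℝ) {f : E3 → ℝ}
    (hf : AEStronglyMeasurable f (volume.restrict K)) :
    gagliardo K σ f
      = eLpNorm (gagQuot σ f) 2 ((volume.restrict K).prod (volume.restrict K)) := by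
  rw [eLpNorm_two_eq, lintegral_prod _
    ((aestronglyMeasurable_gagQuot hf σ).enorm.pow_const 2), gagliardo]
  simp only [enorm_gagQuot_sq σ]

theorem gagQuot_congr {μ : Measure E3} [SFinite μ] {f g : E3 → ℝ} (h : f =ᵐ[μ] g) (σ : ℝ) :
    gagQuot σ f =ᵐ[μ.prod μ] gagQuot σ g := by
  filter_upwards [Measure.quasiMeasurePreserving_fst.ae_eq h,
    Measure.quasiMeasurePreserving_snd.ae_eq h] with p h1 h2
  simp only [Function.comp_apply] at h1 h2
  simp only [gagQuot, h1, h2]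

namespace SmoothingSeq

variable {K : Set E3} (A : SmoothingSeq K)

/-- Smoothing converges in the Gagliardo seminorm. -/
theorem tendsto_gagliardo (hK : IsOpen K) {σ : ℝ} {f : E3 → ℝ}
    (hfl : LocallyIntegrableOn f K volume) (hfσ : gagliardo K σ f < ⊤)
    {κ : ℕ → ℝ} (hκ : Tendsto κ atTop (𝓝 1)) :
    Tendsto (fun n => gagliardo K σ (fun x => f x - κ n * (A.D n).op f x)) atTop (𝓝 0) := by
  have hKm := hK.measurableSet
  have hf : AEStronglyMeasurable f (volume.restrict K) := hfl.aestronglyMeasurable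
  have hlocop : ∀ n, Continuous ((A.D n).op f) := fun n => ((A.D n).contDiff_op hfl).continuous
  have hmeas : ∀ n, AEStronglyMeasurable (fun x => f x - κ n * (A.D n).op f x)
      (volume.restrict K) := fun n =>
    hf.sub ((hlocop n).aestronglyMeasurable.const_mul (κ n))
  simp only [gagliardo_eq_eLpNorm σ (hmeas _)]
  rw [gagliardo_eq_eLpNorm σ hf] at hfσ
  have hfσ' : MemLp (gagQuot σ f) 2 ((volume.restrict K).prod (volume.restrict K)) :=
    ⟨aestronglyMeasurable_gagQuot hf σ, hfσ⟩
  obtain ⟨g, hgm, hfg⟩ := id hf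
  have hgl : LocallyIntegrableOn g K volume := by
    intro x hx
    obtain ⟨s, hs, hi⟩ := hfl x hx
    refine ⟨s ∩ K, inter_mem hs self_mem_nhdsWithin, ?_⟩
    exact (hi.mono_set inter_subset_left).congr_fun_ae
      (ae_restrict_of_ae_restrict_of_subset inter_subset_right hfg)
  have hg : MemLp (gagQuot σ g) 2 ((volume.restrict K).prod (volume.restrict K)) :=
    hfσ'.ae_eq (gagQuot_congr hfg σ)
  rw [Measure.prod_restrict] at hg ⊢
  have hKK : MeasurableSet (K ×ˢ K) := hKm.prod hKm
  set a := (3 + 2 * σ) / 2 with ha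
  -- the difference quotient is extended by zero, in order to let the affine maps act on the whole
  -- space
  set F := (K ×ˢ K).indicator (gagQuot σ g) with hF
  have hqm : Measurable (gagQuot σ g) := by
    have := hgm.measurable
    unfold gagQuot
    fun_prop
  have hFm : Measurable F := hqm.indicator hKK
  have hF2 : MemLp F 2 ((volume : Measure E3).prod (volume : Measure E3)) :=
    (memLp_indicator_iff_restrict hKK).2 hg
  have hlim := tendsto_eLpNorm_sub_comp_smul_add ((volume : Measure E3).prod volume) hF2
  rw [ENNReal.tendsto_nhds_zero] at hlim ⊢
  intro ε hε
  -- the difference quotient of `f (l • · + c)` is `l ^ a` times the difference quotient of `f` at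
  -- the image
  have hκ' : Tendsto (fun n => κ n * (A.D n).l ^ a) atTop (𝓝 1) := by
    have h1 : Tendsto (fun n => (A.D n).l ^ a) atTop (𝓝 ((1 : ℝ) ^ a)) :=
      A.tendsto_l.rpow_const (Or.inl one_ne_zero)
    simpa using hκ.mul h1
  have hev := A.eventually_forall (T := fun z : E3 => (z, z)) (by fun_prop) rfl hκ' (hlim ε hε)
  filter_upwards [hev] with n hn
  set D := A.D n
  have hcongr : gagQuot σ (fun x => f x - κ n * D.op f x)
      =ᵐ[((volume : Measure E3).prod volume).restrict (K ×ˢ K)]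
      gagQuot σ (fun x => g x - κ n * D.op g x) := by
    rw [← Measure.prod_restrict]
    apply gagQuot_congr
    filter_upwards [hfg, ae_restrict_mem hKm] with x hx hxK
    rw [hx, D.op_congr hKm hfg hxK]
  rw [eLpNorm_congr_ae hcongr]
  refine eLpNorm_le_of_average (ν := D.prob) hFm hKK (T := fun z => (D.c - z, D.c - z))
    (by fun_prop) (κ := κ n * D.l ^ a) (l := D.l) ?_ (D.ae_prob.mono fun z hz => hn z hz)
  rintro ⟨x, y⟩ ⟨hx, hy⟩
  simp only at hx hy
  have h1 : gagQuot σ (fun x => g x - κ n * D.op g x) (x, y)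
      = ∫ z, (gagQuot σ g (x, y) - κ n * ((D.A.indicator g (D.l • x + (D.c - z))
        - D.A.indicator g (D.l • y + (D.c - z))) / ‖x - y‖ ^ a)) ∂D.prob := by
    have hi : Integrable (fun z => (D.A.indicator g (D.l • x + (D.c - z))
        - D.A.indicator g (D.l • y + (D.c - z))) / ‖x - y‖ ^ a) D.prob :=
      (Integrable.sub (D.integrable_prob hgl x) (D.integrable_prob hgl y)).div_const _
    rw [integral_sub (integrable_const _) (hi.const_mul _), integral_const_mul, integral_div,
      integral_sub (D.integrable_prob hgl x) (D.integrable_prob hgl y),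
      ← D.op_eq_integral_prob, ← D.op_eq_integral_prob]
    simp only [gagQuot, integral_const, probReal_univ, one_smul]
    ring
  rw [h1]
  refine (enorm_integral_le_lintegral_enorm _).trans (le_of_eq (lintegral_congr_ae ?_))
  filter_upwards [D.ae_mem hx, D.ae_mem hy] with z hzx hzy
  have hmem : D.l • (x, y) + (D.c - z, D.c - z) ∈ K ×ˢ K := ⟨D.subset hzx, D.subset hzy⟩
  rw [hF, indicator_of_mem (show (x, y) ∈ K ×ˢ K from ⟨hx, hy⟩), indicator_of_mem hmem,
    indicator_of_mem hzx, indicator_of_mem hzy]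
  congr 1
  congr 1
  rw [mul_assoc]
  congr 1
  simp only [gagQuot, Prod.smul_mk, Prod.mk_add_mk]
  rw [add_sub_add_right_eq_sub (D.l • x), ← smul_sub, norm_smul, Real.norm_of_nonneg D.l_pos.le,
    Real.mul_rpow D.l_pos.le (norm_nonneg _), ← ha, mul_div,
    mul_div_mul_left _ _ (Real.rpow_pos_of_pos D.l_pos a).ne']

/-- Smoothing converges in all the Sobolev seminorms. The factors `κ n` absorb the ratio of the
contraction, which appears with each derivative. -/
theorem tendsto_seminormAux (hK : IsOpen K) {σ : ℝ} (m : ℕ) {f : E3 → ℝ}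
    (hf : LocallyIntegrableOn f K volume) (hfin : seminormAux K σ m f < ⊤)
    {κ : ℕ → ℝ} (hκ : Tendsto κ atTop (𝓝 1)) :
    Tendsto (fun n => seminormAux K σ m (fun x => f x - κ n * (A.D n).op f x)) atTop (𝓝 0) := by
  induction m generalizing f κ with
  | zero =>
    by_cases h0 : σ = 0
    · simp only [seminormAux, h0, if_true] at hfin ⊢
      exact A.tendsto_eLpNorm hK ⟨hf.aestronglyMeasurable, hfin⟩ hκ
    · simp only [seminormAux, h0, if_false] at hfin ⊢
      exact A.tendsto_gagliardo hK hf hfin hκ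
  | succ m ih =>
    rw [seminormAux] at hfin
    simp only [iInf_lt_iff] at hfin
    obtain ⟨g, hg, hgfin⟩ := hfin
    have hgi : ∀ i, seminormAux K σ m (fun x => g x i) < ⊤ := by
      intro i
      have h1 : ∑ i : Fin 3, seminormAux K σ m (fun x => g x i) ^ 2 < ⊤ := by
        by_contra h
        rw [not_lt_top_iff.1 h, ENNReal.top_rpow_of_pos (by norm_num)] at hgfin
        exact lt_irrefl _ hgfin
      have h2 := (ENNReal.sum_lt_top.1 h1) i (Finset.mem_univ i)
      exact (ENNReal.pow_lt_top_iff.1 h2).resolve_right (by norm_num)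
    have hκ' : Tendsto (fun n => κ n * (A.D n).l) atTop (𝓝 1) := by
      simpa using hκ.mul A.tendsto_l
    have hlim : Tendsto (fun n => (∑ i : Fin 3, seminormAux K σ m
        (fun x => g x i - κ n * (A.D n).l * (A.D n).op (fun y => g y i) x) ^ 2) ^ (1 / 2 : ℝ))
        atTop (𝓝 0) := by
      have h1 : Tendsto (fun n => ∑ i : Fin 3, seminormAux K σ m
          (fun x => g x i - κ n * (A.D n).l * (A.D n).op (fun y => g y i) x) ^ 2) atTop
          (𝓝 (∑ i : Fin 3, (0 : ℝ≥0∞) ^ 2)) := by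
        refine tendsto_finsetSum _ fun i _ => ?_
        exact ((ENNReal.continuous_pow 2).tendsto 0).comp
          (ih (locallyIntegrableOn_apply hg.locallyIntegrable_grad i) (hgi i) hκ')
      have h2 := ((ENNReal.continuous_rpow_const (y := (1 / 2 : ℝ))).tendsto _).comp h1
      simpa [Function.comp_def] using h2
    refine tendsto_of_tendsto_of_tendsto_of_le_of_le tendsto_const_nhds hlim (fun _ => zero_le)
      fun n => ?_
    rw [seminormAux]
    refine iInf₂_le_of_le _ (hg.sub_const_mul (κ n) ((A.D n).hasWeakGradient_op hK hg)) ?_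
    simp only [PiLp.sub_apply, PiLp.smul_apply, smul_eq_mul, Smoothing.opVec_apply, ← mul_assoc]
    exact le_rfl

theorem tendsto_hSeminorm (hK : IsOpen K) {s : ℝ} {f : E3 → ℝ}
    (hf : LocallyIntegrableOn f K volume) (hfin : hSeminorm K s f < ⊤) :
    Tendsto (fun n => hSeminorm K s (fun x => f x - (A.D n).op f x)) atTop (𝓝 0) := by
  simpa [hSeminorm] using A.tendsto_seminormAux hK ⌊s⌋₊ hf hfin tendsto_const_nhds

theorem _root_.FaceVEM.hNorm_lt_top_iff {K : Set E3} {s : ℝ} {f : E3 → ℝ} :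
    hNorm K s f < ⊤ ↔ (∀ j ∈ Finset.range ⌈s⌉₊, hSeminorm K j f < ⊤) ∧ hSeminorm K s f < ⊤ := by
  rw [hNorm, ENNReal.rpow_lt_top_iff_of_pos (by norm_num), ENNReal.add_lt_top, ENNReal.sum_lt_top]
  simp [ENNReal.pow_lt_top_iff]

theorem _root_.FaceVEM.hSeminorm_le_hNorm (K : Set E3) (s : ℝ) (f : E3 → ℝ) :
    hSeminorm K s f ≤ hNorm K s f := by
  have h : hSeminorm K s f = (hSeminorm K s f ^ 2) ^ (1 / 2 : ℝ) := by
    rw [← ENNReal.rpow_natCast, ← ENNReal.rpow_mul]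
    simp
  rw [h, hNorm]
  gcongr
  exact le_add_self

theorem _root_.FaceVEM.hSeminorm_nat_le_hNorm (K : Set E3) {s : ℝ} (f : E3 → ℝ) {j : ℕ}
    (hj : j < ⌈s⌉₊) : hSeminorm K j f ≤ hNorm K s f := by
  have h : hSeminorm K j f = (hSeminorm K j f ^ 2) ^ (1 / 2 : ℝ) := by
    rw [← ENNReal.rpow_natCast, ← ENNReal.rpow_mul]
    simp
  rw [h, hNorm]
  gcongr
  exact (Finset.single_le_sum (f := fun j : ℕ => hSeminorm K j f ^ 2) (fun _ _ => zero_le)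
    (Finset.mem_range.2 hj)).trans le_self_add

theorem tendsto_hNorm (hK : IsOpen K) {s : ℝ} {f : E3 → ℝ} (hf : MemHs K s f) :
    Tendsto (fun n => hNorm K s (fun x => f x - (A.D n).op f x)) atTop (𝓝 0) := by
  have hfl := locallyIntegrableOn_of_memLp hK hf.1
  obtain ⟨h1, h2⟩ := hNorm_lt_top_iff.1 hf.2
  have h3 : Tendsto (fun n => (∑ j ∈ Finset.range ⌈s⌉₊,
      hSeminorm K j (fun x => f x - (A.D n).op f x) ^ 2)
      + hSeminorm K s (fun x => f x - (A.D n).op f x) ^ 2) atTop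
      (𝓝 ((∑ j ∈ Finset.range ⌈s⌉₊, (0 : ℝ≥0∞) ^ 2) + 0 ^ 2)) := by
    refine Tendsto.add (tendsto_finsetSum _ fun j hj => ?_) ?_
    · exact ((ENNReal.continuous_pow 2).tendsto 0).comp (A.tendsto_hSeminorm hK hfl (h1 j hj))
    · exact ((ENNReal.continuous_pow 2).tendsto 0).comp (A.tendsto_hSeminorm hK hfl h2)
  have h4 := ((ENNReal.continuous_rpow_const (y := (1 / 2 : ℝ))).tendsto _).comp h3
  simpa [Function.comp_def, hNorm] using h4

end SmoothingSeq

theorem IsStarBall.exists_smoothingSeq {K : Set E3} {x₀ : E3} {r : ℝ} (hK : IsStarBall K x₀ r) :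
    Nonempty (SmoothingSeq K) := by
  obtain ⟨D, h1, h2, h3⟩ := hK.exists_smoothing
  exact ⟨⟨D, h1, h2, h3⟩⟩

/-! ### Low order seminorms -/

theorem hSeminorm_zero (K : Set E3) (f : E3 → ℝ) :
    hSeminorm K 0 f = eLpNorm f 2 (volume.restrict K) := by
  simp [hSeminorm, seminormAux]

theorem hSeminorm_of_lt_one (K : Set E3) {s : ℝ} (h0 : 0 < s) (h1 : s < 1) (f : E3 → ℝ) :
    hSeminorm K s f = gagliardo K s f := by
  have : ⌊s⌋₊ = 0 := Nat.floor_eq_zero.2 h1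
  simp [hSeminorm, this, seminormAux, h0.ne']

theorem sum_rpow_half_eLpNorm {α : Type*} [MeasurableSpace α] {μ : Measure α} {g : α → E3}
    (hg : AEStronglyMeasurable g μ) :
    (∑ i : Fin 3, eLpNorm (fun x => g x i) 2 μ ^ 2) ^ (1 / 2 : ℝ) = eLpNorm g 2 μ := by
  have hi : ∀ i, AEStronglyMeasurable (fun x => g x i) μ := fun i =>
    (EuclideanSpace.proj (𝕜 := ℝ) i).continuous.comp_aestronglyMeasurable hg
  rw [eLpNorm_two_eq g]
  simp only [eLpNorm_two_sq]
  rw [← lintegral_finsetSum' _ fun i _ => (hi i).enorm.pow_const 2]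
  congr 1
  refine lintegral_congr fun x => ?_
  have h : ∀ y : ℝ, ‖y‖ₑ ^ 2 = ENNReal.ofReal (y ^ 2) := fun y => by
    rw [← ofReal_norm, ← ENNReal.ofReal_pow (norm_nonneg _), Real.norm_eq_abs, sq_abs]
  simp only [h]
  rw [← ENNReal.ofReal_sum_of_nonneg fun i _ => sq_nonneg _, ← ofReal_norm,
    ← ENNReal.ofReal_pow (norm_nonneg _), EuclideanSpace.real_norm_sq_eq]

/-- The infimum in the definition of the first order seminorm is the norm of the weak gradient. -/
theorem hSeminorm_one_eq {K : Set E3} (hK : IsOpen K) {f : E3 → ℝ} {g : E3 → E3}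
    (h : HasWeakGradient K f g) : hSeminorm K 1 f = eLpNorm g 2 (volume.restrict K) := by
  have h1 : hSeminorm K 1 f = ⨅ (g : E3 → E3) (_ : HasWeakGradient K f g),
      eLpNorm g 2 (volume.restrict K) := by
    simp only [hSeminorm, Nat.floor_one, Nat.cast_one, sub_self, seminormAux, if_true]
    refine iInf_congr fun g => iInf_congr fun hg => ?_
    exact sum_rpow_half_eLpNorm hg.locallyIntegrable_grad.aestronglyMeasurable
  rw [h1]
  refine le_antisymm (iInf₂_le g h) (le_iInf₂ fun g' hg' => ?_)
  rw [eLpNorm_congr_ae (h.ae_unique hK hg')]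

/-! ### Planes in space and cones over planar sets -/

/-- The Euclidean plane. -/
abbrev E2 : Type := EuclideanSpace ℝ (Fin 2)

/-- A linear isometry of the plane onto the orthogonal complement of the unit vector `n`. -/
structure NormalFrame (n : E3) where
  /-- the isometry -/
  J : E2 →ₗᵢ[ℝ] E3
  norm_eq_one : ‖n‖ = 1
  inner_J : ∀ u, ⟪n, J u⟫ = 0
  exists_J : ∀ x, ⟪n, x⟫ = 0 → ∃ u, J u = x

theorem exists_normalFrame {n : E3} (hn : ‖n‖ = 1) : Nonempty (NormalFrame n) := by
  have hn0 : n ≠ 0 := by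
    rintro rfl
    simp at hn
  have : Fact (Module.finrank ℝ E3 = 2 + 1) := ⟨by simp⟩
  let e := (OrthonormalBasis.fromOrthogonalSpanSingleton (𝕜 := ℝ) 2 hn0).repr.symm
  refine ⟨⟨(Submodule.subtypeₗᵢ _).comp e.toLinearIsometry, hn, fun u => ?_, fun x hx => ?_⟩⟩
  · exact Submodule.mem_orthogonal_singleton_iff_inner_right.1 (e u).2
  · refine ⟨e.symm ⟨x, Submodule.mem_orthogonal_singleton_iff_inner_right.2 hx⟩, ?_⟩
    simp

namespace NormalFrame

variable {n : E3} (L : NormalFrame n)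

theorem inner_self_normal (L : NormalFrame n) : ⟪n, n⟫ = 1 := by
  rw [real_inner_self_eq_norm_sq, L.norm_eq_one, one_pow]

theorem norm_sq_add (u : E2) (z : ℝ) : ‖L.J u + z • n‖ ^ 2 = ‖u‖ ^ 2 + z ^ 2 := by
  rw [norm_add_sq_real, inner_smul_right, real_inner_comm, L.inner_J, norm_smul, L.norm_eq_one,
    L.J.norm_map]
  simp

/-- The coordinates given by a point of the plane and the height are measure preserving. -/
theorem measurePreserving : MeasurePreserving (fun p : E2 × ℝ => L.J p.1 + p.2 • n) volume volume := by
  let f : WithLp 2 (E2 × ℝ) →ₗᵢ[ℝ] E3 :=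
    { toFun := fun p => L.J p.fst + p.snd • n
      map_add' := fun p q => by simp only [WithLp.add_fst, WithLp.add_snd, map_add, add_smul]; abel
      map_smul' := fun c p => by simp [smul_smul]
      norm_map' := fun p => by
        have h1 := L.norm_sq_add p.fst p.snd
        have h2 := WithLp.prod_norm_sq_eq_of_L2 p
        rw [Real.norm_eq_abs, sq_abs, ← h1] at h2
        exact ((sq_eq_sq₀ (norm_nonneg _) (norm_nonneg _)).1 h2).symm }
  have hfin : Module.finrank ℝ (WithLp 2 (E2 × ℝ)) = Module.finrank ℝ E3 := by
    rw [(WithLp.linearEquiv 2 ℝ (E2 × ℝ)).finrank_eq]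
    simp
  have h1 := (f.toLinearIsometryEquiv hfin).measurePreserving
  exact h1.comp (WithLp.volume_preserving_toLp E2 ℝ)

theorem lintegral_eq {G : E3 → ℝ≥0∞} (hG : Measurable G) (x₀ : E3) :
    ∫⁻ x, G x = ∫⁻ z : ℝ, ∫⁻ u : E2, G (x₀ + (L.J u + z • n)) := by
  have h := L.measurePreserving.lintegral_comp (f := fun x => G (x₀ + x)) (by fun_prop)
  rw [lintegral_add_left_eq_self] at h
  rw [← h, Measure.volume_eq_prod, lintegral_prod_symm _ ?_]
  have := L.J.continuous.measurable
  fun_prop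

variable (x₀ : E3) (d : ℝ) (Ω : Set E2)

/-- The parametrization of the plane `⟪n, x - x₀⟫ = d`. -/
def pt (u : E2) : E3 := x₀ + (L.J u + d • n)

/-- The point dividing the segment from the apex `x₀` to `pt u` in the ratio `r`. -/
def conePt (u : E2) (r : ℝ) : E3 := x₀ + r • (L.J u + d • n)

/-- The (open) cone with apex `x₀` over the planar set `pt '' Ω`. -/
def cone : Set E3 := {x | ∃ u ∈ Ω, ∃ r ∈ Ioo (0 : ℝ) 1, x = L.conePt x₀ d u r}

variable {x₀ d Ω}

theorem isometry_pt : Isometry (L.pt x₀ d) := by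
  refine Isometry.of_dist_eq fun u v => ?_
  simp [pt, L.J.dist_map]

theorem continuous_conePt : Continuous fun p : E2 × ℝ => L.conePt x₀ d p.1 p.2 := by
  have := L.J.continuous
  unfold conePt
  fun_prop

theorem mem_cone_iff (hd : 0 < d) {u : E2} {r : ℝ} (hr : r ∈ Ioo (0 : ℝ) 1) :
    L.conePt x₀ d u r ∈ L.cone x₀ d Ω ↔ u ∈ Ω := by
  refine ⟨fun ⟨u', hu', r', hr', h⟩ => ?_, fun hu => ⟨u, hu, r, hr, rfl⟩⟩
  simp only [conePt, add_right_inj] at h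
  have h1 := congrArg (fun y => ⟪n, y⟫) h
  simp only [inner_smul_right, inner_add_right, L.inner_J, L.inner_self_normal, zero_add,
    mul_one] at h1
  have hrr : r = r' := mul_right_cancel₀ hd.ne' h1
  subst hrr
  have h2 := smul_right_injective E3 hr.1.ne' h
  simp only [add_left_inj] at h2
  rwa [L.J.injective h2]

theorem inner_conePt_sub (u : E2) (r : ℝ) : ⟪n, L.conePt x₀ d u r - x₀⟫ = r * d := by
  simp only [conePt, add_sub_cancel_left, inner_smul_right, inner_add_right, L.inner_J,
    L.inner_self_normal, zero_add, mul_one]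

theorem exists_inner_eq_of_mem_cone {x : E3} (hx : x ∈ L.cone x₀ d Ω) :
    ∃ r ∈ Ioo (0 : ℝ) 1, ⟪n, x - x₀⟫ = r * d := by
  obtain ⟨u, -, r, hr, rfl⟩ := hx
  exact ⟨r, hr, L.inner_conePt_sub u r⟩

/-- The open cone over a relatively open planar set is open. -/
theorem isOpen_cone (hd : 0 < d) (hΩ : IsOpen Ω) : IsOpen (L.cone x₀ d Ω) := by
  -- the inverse of the parametrization, with the adjoint of `J` as first component
  let A : E3 →L[ℝ] E2 := ContinuousLinearMap.adjoint L.J.toContinuousLinearMap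
  have hA : ∀ u, A (L.J u) = u := fun u => by
    refine ext_inner_right ℝ fun v => ?_
    rw [ContinuousLinearMap.adjoint_inner_left]
    exact L.J.inner_map_map u v
  have hAn : A n = 0 := by
    refine ext_inner_right ℝ fun v => ?_
    rw [ContinuousLinearMap.adjoint_inner_left, inner_zero_left]
    exact L.inner_J v
  have heq : L.cone x₀ d Ω = {x | ⟪n, x - x₀⟫ / d ∈ Ioo (0 : ℝ) 1} ∩
      {x | (⟪n, x - x₀⟫ / d)⁻¹ • A (x - x₀) ∈ Ω} := by
    ext x
    constructor
    · rintro ⟨u, hu, r, hr, rfl⟩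
      have h1 : ⟪n, L.conePt x₀ d u r - x₀⟫ / d = r := by
        rw [L.inner_conePt_sub, mul_div_cancel_right₀ _ hd.ne']
      refine ⟨by rw [mem_ofPred_eq, h1]; exact hr, ?_⟩
      rw [mem_ofPred_eq, h1, conePt, add_sub_cancel_left, map_smul, map_add, hA, map_smul, hAn,
        smul_zero, add_zero, smul_smul, inv_mul_cancel₀ hr.1.ne', one_smul]
      exact hu
    · rintro ⟨hr, hu⟩
      set r := ⟪n, x - x₀⟫ / d with hrd
      have hr' : ⟪n, x - x₀⟫ = r * d := by rw [hrd, div_mul_cancel₀ _ hd.ne']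
      refine ⟨_, hu, r, hr, ?_⟩
      obtain ⟨w, hw⟩ := L.exists_J (x - x₀ - (r * d) • n) (by
        rw [inner_sub_right, hr', inner_smul_right, L.inner_self_normal, mul_one, sub_self])
      have hx : x - x₀ = L.J w + (r * d) • n := by rw [hw]; abel
      have hw' : A (x - x₀) = w := by
        rw [hx, map_add, hA, map_smul, hAn, smul_zero, add_zero]
      rw [← hrd, hw', conePt, map_smul, smul_add, smul_smul, mul_inv_cancel₀ (hr.1.ne' : r ≠ 0),
        one_smul, smul_smul, ← hx]
      abel
  have hcont : Continuous fun x : E3 => ⟪n, x - x₀⟫ / d := by fun_prop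
  have hcont2 : ContinuousOn (fun x : E3 => (⟪n, x - x₀⟫ / d)⁻¹ • A (x - x₀))
      {x | ⟪n, x - x₀⟫ / d ∈ Ioo (0 : ℝ) 1} := by
    refine ContinuousOn.smul (hcont.continuousOn.inv₀ fun x hx => hx.1.ne') ?_
    fun_prop
  rw [heq]
  exact hcont2.isOpen_inter_preimage (isOpen_Ioo.preimage hcont) hΩ

/-- Integration over a cone: heights and homothetic copies of the base. -/
theorem lintegral_cone (hd : 0 < d) (hΩ : IsOpen Ω) {G : E3 → ℝ≥0∞} (hG : Measurable G) :
    ∫⁻ x in L.cone x₀ d Ω, G x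
      = ∫⁻ u in Ω, ∫⁻ r in Ioo (0 : ℝ) 1, ENNReal.ofReal (d * r ^ 2) * G (L.conePt x₀ d u r) := by
  have hTm := (L.isOpen_cone (x₀ := x₀) hd hΩ).measurableSet
  have hJ := L.J.continuous.measurable
  rw [← lintegral_indicator hTm, L.lintegral_eq (hG.indicator hTm) x₀]
  set T := L.cone x₀ d Ω
  have hTG := hG.indicator hTm
  -- the heights, measured in multiples of `d`
  have h1 := lintegral_comp_smul_add (volume : Measure ℝ) hd.ne' 0
    (fun z => ∫⁻ u : E2, T.indicator G (x₀ + (L.J u + z • n)))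
  simp only [add_zero, Module.finrank_self, pow_one, smul_eq_mul] at h1
  have h2 : ∫⁻ z : ℝ, ∫⁻ u : E2, T.indicator G (x₀ + (L.J u + z • n))
      = ∫⁻ r : ℝ, ENNReal.ofReal d * ∫⁻ u : E2, T.indicator G (x₀ + (L.J u + (d * r) • n)) := by
    rw [lintegral_const_mul' _ _ ENNReal.ofReal_ne_top, h1, ← mul_assoc, abs_inv, abs_of_pos hd,
      ENNReal.ofReal_inv_of_pos hd, ENNReal.mul_inv_cancel (by simpa using hd)
      ENNReal.ofReal_ne_top, one_mul]
  rw [h2]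
  have h3 : ∀ r : ℝ, ENNReal.ofReal d * ∫⁻ u : E2, T.indicator G (x₀ + (L.J u + (d * r) • n))
      = (Ioo (0 : ℝ) 1).indicator (fun r => ∫⁻ u in Ω, ENNReal.ofReal (d * r ^ 2) *
          G (L.conePt x₀ d u r)) r := by
    intro r
    by_cases hr : r ∈ Ioo (0 : ℝ) 1
    · rw [indicator_of_mem hr, lintegral_const_mul' _ _ ENNReal.ofReal_ne_top,
        ENNReal.ofReal_mul hd.le, mul_assoc]
      -- at height `d * r`, the section of the cone is the homothetic copy `r • Ω` of the base
      congr 1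
      have h4 := lintegral_comp_smul_add (volume : Measure E2) hr.1.ne' 0
        (fun u => T.indicator G (x₀ + (L.J u + (d * r) • n)))
      simp only [add_zero, finrank_euclideanSpace, Fintype.card_fin] at h4
      have h5 : ∀ u, T.indicator G (x₀ + (L.J (r • u) + (d * r) • n))
          = Ω.indicator (fun u => G (L.conePt x₀ d u r)) u := by
        intro u
        have h6 : x₀ + (L.J (r • u) + (d * r) • n) = L.conePt x₀ d u r := by
          rw [conePt, map_smul, smul_add, smul_smul, mul_comm d r]
        rw [h6]
        by_cases hu : u ∈ Ω
        · rw [indicator_of_mem hu, indicator_of_mem ((L.mem_cone_iff hd hr).2 hu)]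
        · rw [indicator_of_notMem hu, indicator_of_notMem (mt (L.mem_cone_iff hd hr).1 hu)]
      simp only [h5] at h4
      rw [lintegral_indicator hΩ.measurableSet] at h4
      have hr2 : 0 < r ^ 2 := pow_pos hr.1 2
      rw [h4, ← mul_assoc, abs_inv, abs_of_pos hr2, ENNReal.ofReal_inv_of_pos hr2,
        ENNReal.mul_inv_cancel (by simpa using hr.1.ne') ENNReal.ofReal_ne_top, one_mul]
    · rw [indicator_of_notMem hr]
      have h6 : ∀ u, T.indicator G (x₀ + (L.J u + (d * r) • n)) = 0 := by
        intro u
        refine indicator_of_notMem (fun hmem => hr ?_) _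
        obtain ⟨r', hr', h7⟩ := L.exists_inner_eq_of_mem_cone hmem
        rw [add_sub_cancel_left, inner_add_right, L.inner_J, inner_smul_right,
          L.inner_self_normal, zero_add, mul_one, mul_comm] at h7
        rwa [mul_right_cancel₀ hd.ne' h7]
      simp [h6]
  simp only [h3]
  rw [lintegral_indicator measurableSet_Ioo, lintegral_lintegral_swap]
  have : Measurable fun p : ℝ × E2 => L.conePt x₀ d p.2 p.1 :=
    (L.continuous_conePt.comp continuous_swap).measurable
  exact Measurable.aemeasurable (by
    simp only [Function.uncurry_def]
    fun_prop)

/-- The measure on base and ratio whose image is the volume of the cone. -/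
def coneMeasure (d : ℝ) (Ω : Set E2) : Measure (E2 × ℝ) :=
  ((volume.restrict Ω).prod (volume.restrict (Ioo 0 1))).withDensity
    fun p => ENNReal.ofReal (d * p.2 ^ 2)

theorem map_coneMeasure (hd : 0 < d) (hΩ : IsOpen Ω) :
    (coneMeasure d Ω).map (fun p => L.conePt x₀ d p.1 p.2) = volume.restrict (L.cone x₀ d Ω) := by
  have hm : Measurable fun p : E2 × ℝ => L.conePt x₀ d p.1 p.2 := L.continuous_conePt.measurable
  refine Measure.ext_of_lintegral _ fun G hG => ?_
  rw [lintegral_map hG hm, L.lintegral_cone hd hΩ hG, coneMeasure,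
    lintegral_withDensity_eq_lintegral_mul _ (by fun_prop) (by fun_prop), lintegral_prod]
  · rfl
  · exact Measurable.aemeasurable (by fun_prop)

theorem integrable_cone (hd : 0 < d) (hΩ : IsOpen Ω) {G : E3 → ℝ}
    (hG : IntegrableOn G (L.cone x₀ d Ω)) :
    Integrable (fun p : E2 × ℝ => d * p.2 ^ 2 * G (L.conePt x₀ d p.1 p.2))
      ((volume.restrict Ω).prod (volume.restrict (Ioo 0 1))) := by
  have hm : Measurable fun p : E2 × ℝ => L.conePt x₀ d p.1 p.2 := L.continuous_conePt.measurable
  rw [IntegrableOn, ← L.map_coneMeasure hd hΩ] at hG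
  have h := hG.comp_measurable hm
  rw [coneMeasure, integrable_withDensity_iff_integrable_smul' (by fun_prop)
    (Eventually.of_forall fun _ => by simp)] at h
  refine h.congr (Eventually.of_forall fun p => ?_)
  simp only [Function.comp_apply, smul_eq_mul]
  rw [ENNReal.toReal_ofReal (by positivity)]

theorem integral_cone (hd : 0 < d) (hΩ : IsOpen Ω) {G : E3 → ℝ}
    (hG : IntegrableOn G (L.cone x₀ d Ω)) :
    ∫ x in L.cone x₀ d Ω, G x
      = ∫ u in Ω, ∫ r in Ioo (0 : ℝ) 1, d * r ^ 2 * G (L.conePt x₀ d u r) := by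
  have hm : Measurable fun p : E2 × ℝ => L.conePt x₀ d p.1 p.2 := L.continuous_conePt.measurable
  have hi := L.integrable_cone hd hΩ hG
  rw [IntegrableOn, ← L.map_coneMeasure hd hΩ] at hG
  rw [← L.map_coneMeasure hd hΩ, integral_map hm.aemeasurable hG.1, coneMeasure,
    integral_withDensity_eq_integral_toReal_smul (by fun_prop)
    (Eventually.of_forall fun _ => by simp)]
  rw [integral_prod _ ?_]
  · refine integral_congr_ae (Eventually.of_forall fun u =>
      integral_congr_ae (Eventually.of_forall fun r => ?_))
    simp only [smul_eq_mul]
    rw [ENNReal.toReal_ofReal (by positivity)]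
  · refine hi.congr (Eventually.of_forall fun p => ?_)
    simp only [smul_eq_mul]
    rw [ENNReal.toReal_ofReal (by positivity)]

end NormalFrame

/-! ### The gauge of a star-shaped domain -/

/-- The gauge of `K` seen from `x₀`. -/
def gaugeAt (K : Set E3) (x₀ x : E3) : ℝ := gauge ((fun y => x₀ + y) ⁻¹' K) (x - x₀)

namespace IsStarBall

variable {K : Set E3} {x₀ : E3} {r : ℝ}

theorem shift_mem_nhds (hK : IsStarBall K x₀ r) : (fun y => x₀ + y) ⁻¹' K ∈ 𝓝 (0 : E3) := by
  have : Continuous fun y : E3 => x₀ + y := by fun_prop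
  exact this.continuousAt.preimage_mem_nhds (hK.isOpen.mem_nhds (by simpa using hK.center_mem))

theorem gaugeAt_lt_one (hK : IsStarBall K x₀ r) {x : E3} (hx : x ∈ K) : gaugeAt K x₀ x < 1 :=
  gauge_lt_one_of_mem_of_isOpen (hK.isOpen.preimage (by fun_prop)) (by simpa using hx)

theorem one_le_gaugeAt (hK : IsStarBall K x₀ r) {x : E3} (hx : x ∉ K) : 1 ≤ gaugeAt K x₀ x := by
  refine one_le_gauge_of_notMem ?_ (absorbent_nhds_zero hK.shift_mem_nhds _) (by simpa using hx)
  intro y hy a b ha hb hab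
  have h := hK.star x₀ (Metric.mem_ball_self hK.r_pos) hy ha hb hab
  have h2 : a • x₀ + b • (x₀ + y) = x₀ + (a • 0 + b • y) := by
    rw [smul_add, ← add_assoc, ← add_smul, hab, one_smul, smul_zero, zero_add]
  rwa [h2] at h

theorem gaugeAt_lt_one_iff (hK : IsStarBall K x₀ r) {x : E3} : gaugeAt K x₀ x < 1 ↔ x ∈ K :=
  ⟨fun h => by_contra fun hx => (hK.one_le_gaugeAt hx).not_gt h, hK.gaugeAt_lt_one⟩

theorem gaugeAt_add_smul (K : Set E3) (x₀ y : E3) {a : ℝ} (ha : 0 ≤ a) :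
    gaugeAt K x₀ (x₀ + a • y) = a * gaugeAt K x₀ (x₀ + y) := by
  simp only [gaugeAt, add_sub_cancel_left]
  rw [gauge_smul_of_nonneg ha, smul_eq_mul]

/-- Star-shapedness with respect to a ball of radius `r` makes the gauge `1 / r`-Lipschitz. -/
theorem gaugeAt_add_le (hK : IsStarBall K x₀ r) (x z : E3) :
    gaugeAt K x₀ (x + z) ≤ gaugeAt K x₀ x + ‖z‖ / r := by
  have hr := hK.r_pos
  refine le_of_forall_pos_lt_add fun ε hε => ?_
  obtain ⟨a, ha, ha', y, hy, hxy⟩ := exists_lt_of_gauge_lt (absorbent_nhds_zero hK.shift_mem_nhds)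
    (show gauge _ (x - x₀) < gaugeAt K x₀ x + ε / 2 from lt_add_of_pos_right _ (half_pos hε))
  have hxy' : a • y = x - x₀ := hxy
  set b := ‖z‖ / r + ε / 4 with hb
  have hb0 : 0 < b := by positivity
  have hzb : x₀ + b⁻¹ • z ∈ Metric.ball x₀ r := by
    rw [Metric.mem_ball, dist_eq_norm, add_sub_cancel_left, norm_smul, norm_inv,
      Real.norm_of_nonneg hb0.le, inv_mul_lt_iff₀ hb0, hb, add_mul, div_mul_cancel₀ _ hr.ne']
    have : 0 < ε / 4 * r := by positivity
    linarith
  have hmem := hK.star _ hzb hy (a := b / (a + b)) (b := a / (a + b)) (by positivity) (by positivity)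
    (by field_simp; ring)
  have : gaugeAt K x₀ (x + z) ≤ a + b := by
    refine gauge_le_of_mem (by positivity) ?_
    refine ⟨(a + b)⁻¹ • (x + z - x₀), ?_, ?_⟩
    · rw [mem_preimage]
      convert hmem using 1
      have h1 : x + z - x₀ = a • y + z := by rw [hxy']; abel
      have h2 : x₀ = (b / (a + b)) • x₀ + (a / (a + b)) • x₀ := by
        rw [← add_smul, ← add_div, add_comm b a, div_self (by positivity), one_smul]
      rw [h1]
      conv_lhs => rw [h2]
      simp only [smul_add, smul_smul]
      have h3 : b / (a + b) * b⁻¹ = (a + b)⁻¹ := by field_simp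
      have h4 : (a + b)⁻¹ * a = a / (a + b) := by field_simp
      rw [h3, h4]
      abel
    · simp only
      rw [smul_smul, mul_inv_cancel₀ (by positivity), one_smul]
  linarith

theorem lipschitzWith_gaugeAt (hK : IsStarBall K x₀ r) :
    LipschitzWith (Real.toNNReal (1 / r)) (gaugeAt K x₀) := by
  have hr := hK.r_pos
  refine LipschitzWith.of_le_add_mul _ fun x y => ?_
  rw [Real.coe_toNNReal _ (by positivity)]
  have := hK.gaugeAt_add_le y (x - y)
  rw [add_sub_cancel, ← dist_eq_norm] at this
  rwa [one_div_mul_eq_div]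

theorem gaugeAt_eq_one (hK : IsStarBall K x₀ r) {x : E3} (hx : x ∈ frontier K) :
    gaugeAt K x₀ x = 1 := by
  rw [hK.isOpen.frontier_eq] at hx
  refine le_antisymm ?_ (hK.one_le_gaugeAt hx.2)
  exact closure_minimal (fun y hy => (hK.gaugeAt_lt_one hy).le)
    (isClosed_le hK.lipschitzWith_gaugeAt.continuous continuous_const) hx.1

theorem gaugeAt_pos (hK : IsStarBall K x₀ r) {x : E3} (hx : x ≠ x₀) : 0 < gaugeAt K x₀ x := by
  refine (gauge_pos (absorbent_nhds_zero hK.shift_mem_nhds) ?_).2 (sub_ne_zero.2 hx)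
  rw [NormedSpace.isVonNBounded_iff]
  obtain ⟨R, hR⟩ := hK.isBounded.subset_closedBall x₀
  refine (Metric.isBounded_closedBall (x := (0 : E3)) (r := R)).subset fun y hy => ?_
  simpa [dist_eq_norm] using hR hy

/-- The point where the ray from `x₀` through `x` leaves the domain. -/
theorem radial_mem_frontier (hK : IsStarBall K x₀ r) {x : E3} (hx : x ≠ x₀) :
    x₀ + (gaugeAt K x₀ x)⁻¹ • (x - x₀) ∈ frontier K := by
  have hp := hK.gaugeAt_pos hx
  set y := (gaugeAt K x₀ x)⁻¹ • (x - x₀) with hy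
  have h1 : gaugeAt K x₀ (x₀ + y) = 1 := by
    rw [hy, gaugeAt_add_smul _ _ _ (inv_nonneg.2 hp.le), add_sub_cancel, inv_mul_cancel₀ hp.ne']
  rw [hK.isOpen.frontier_eq]
  refine ⟨?_, fun hmem => (hK.gaugeAt_lt_one hmem).ne h1⟩
  have hlim : Tendsto (fun t : ℝ => x₀ + t • y) (𝓝[<] 1) (𝓝 (x₀ + y)) := by
    have : Continuous fun t : ℝ => x₀ + t • y := by fun_prop
    simpa using (this.tendsto 1).mono_left nhdsWithin_le_nhds
  refine mem_closure_of_tendsto hlim ?_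
  have h0 : ∀ᶠ t : ℝ in 𝓝[<] 1, 0 < t :=
    nhdsWithin_le_nhds (lt_mem_nhds (by norm_num))
  filter_upwards [self_mem_nhdsWithin, h0] with t ht ht0
  rw [← hK.gaugeAt_lt_one_iff, gaugeAt_add_smul _ _ _ ht0.le, h1, mul_one]
  exact ht

end IsStarBall

/-! ### Star-shaped polyhedral elements -/

namespace PolyhedralElement

variable (P : PolyhedralElement) {x₀ : E3} {r : ℝ}

/-- The signed distance from `x₀` to the plane of a face. -/
def height (x₀ : E3) (i : Fin P.numFaces) : ℝ := P.offset i - ⟪P.normal i, x₀⟫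

/-- An orthonormal frame adapted to a face. -/
def frame (i : Fin P.numFaces) : NormalFrame (P.normal i) :=
  Classical.choice (exists_normalFrame (P.norm_normal i))

/-- The parametrization of the plane of a face. -/
def facePt (x₀ : E3) (i : Fin P.numFaces) : E2 → E3 := (P.frame i).pt x₀ (P.height x₀ i)

/-- The face, in plane coordinates. -/
def base (x₀ : E3) (i : Fin P.numFaces) : Set E2 := P.facePt x₀ i ⁻¹' P.face i

/-- The cone over a face. -/
def faceCone (x₀ : E3) (i : Fin P.numFaces) : Set E3 :=
  (P.frame i).cone x₀ (P.height x₀ i) (P.base x₀ i)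

variable {P}

theorem face_subset_plane (i : Fin P.numFaces) : P.face i ⊆ P.plane i := by
  obtain ⟨U, -, hU⟩ := P.face_relOpen i
  rw [hU]
  exact inter_subset_right

theorem face_subset_frontier (i : Fin P.numFaces) : P.face i ⊆ frontier P.K := by
  rw [P.frontier_eq]
  exact subset_closure.trans (subset_iUnion (fun i => closure (P.face i)) i)

theorem isometry_facePt (i : Fin P.numFaces) : Isometry (P.facePt x₀ i) :=
  (P.frame i).isometry_pt

theorem facePt_mem_plane (i : Fin P.numFaces) (u : E2) : P.facePt x₀ i u ∈ P.plane i := by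
  have h := (P.frame i).inner_J u
  simp only [plane, mem_ofPred_eq, facePt, NormalFrame.pt, inner_add_right, inner_smul_right, h,
    (P.frame i).inner_self_normal, height]
  ring

theorem range_facePt (i : Fin P.numFaces) : range (P.facePt x₀ i) = P.plane i := by
  refine Subset.antisymm (range_subset_iff.2 (facePt_mem_plane i)) fun x hx => ?_
  obtain ⟨u, hu⟩ := (P.frame i).exists_J (x - x₀ - P.height x₀ i • P.normal i) (by
    rw [inner_sub_right, inner_sub_right, inner_smul_right, (P.frame i).inner_self_normal,
      show ⟪P.normal i, x⟫ = P.offset i from hx, height]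
    ring)
  refine ⟨u, ?_⟩
  rw [facePt, NormalFrame.pt, hu]
  abel

theorem isOpen_base (i : Fin P.numFaces) : IsOpen (P.base x₀ i) := by
  obtain ⟨U, hU, h⟩ := P.face_relOpen i
  have : P.base x₀ i = P.facePt x₀ i ⁻¹' U := by
    ext u
    simp only [base, mem_preimage, h]
    exact ⟨fun h => h.1, fun h => ⟨h, facePt_mem_plane i u⟩⟩
  rw [this]
  exact hU.preimage (isometry_facePt i).continuous

theorem isBounded_face (i : Fin P.numFaces) : Bornology.IsBounded (P.face i) :=
  P.isBounded.closure.subset ((face_subset_frontier i).trans frontier_subset_closure)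

theorem isBounded_base (i : Fin P.numFaces) : Bornology.IsBounded (P.base x₀ i) := by
  rw [Metric.isBounded_iff]
  obtain ⟨C, hC⟩ := Metric.isBounded_iff.1 (isBounded_face i)
  exact ⟨C, fun u hu v hv => by
    rw [← (isometry_facePt (x₀ := x₀) i).dist_eq]
    exact hC hu hv⟩

theorem volume_base_lt_top (i : Fin P.numFaces) : volume (P.base x₀ i) < ⊤ :=
  (isBounded_base i).measure_lt_top

/-- Surface integrals in plane coordinates. -/
theorem faceIntegral_eq (x₀ : E3) (i : Fin P.numFaces) (f : E3 → ℝ) :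
    P.faceIntegral i f = ∫ u in P.base x₀ i, f (P.facePt x₀ i u) := by
  have hiso := isometry_facePt (x₀ := x₀) i
  have h := hiso.map_euclideanHausdorffMeasure (d := 2)
  rw [EuclideanSpace.euclideanHausdorffMeasure_eq_volume, range_facePt] at h
  have hemb : MeasurableEmbedding (P.facePt x₀ i) := hiso.isClosedEmbedding.measurableEmbedding
  have hpl : MeasurableSet (P.plane i) := by
    rw [← range_facePt (x₀ := x₀) i]
    exact hiso.isClosedEmbedding.isClosed_range.measurableSet
  have hF : MeasurableSet (P.face i) := by
    obtain ⟨U, hU, h'⟩ := P.face_relOpen i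
    rw [h']
    exact hU.measurableSet.inter hpl
  rw [faceIntegral, base, ← hemb.setIntegral_map, h, Measure.restrict_restrict hF,
    inter_eq_left.2 (face_subset_plane i)]

/-- The ball lies on the inner side of each face. -/
theorem le_height (hP : IsStarBall P.K x₀ r) (i : Fin P.numFaces) : r ≤ P.height x₀ i := by
  obtain ⟨x, hx⟩ := P.face_nonempty i
  have hxn : ⟪P.normal i, x⟫ = P.offset i := face_subset_plane i hx
  have hnn : ⟪P.normal i, P.normal i⟫ = 1 := (P.frame i).inner_self_normal
  -- no point of the ball can be strictly beyond the plane
  have key : ∀ y ∈ Metric.ball x₀ r, ⟪P.normal i, y⟫ ≤ P.offset i := by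
    intro y hy
    by_contra! hlt
    set a := ⟪P.normal i, y⟫ - P.offset i with ha
    have ha0 : 0 < a := by rw [ha]; linarith
    obtain ⟨δ, hδ, hout⟩ := P.outward i x hx
    obtain ⟨U, hU, hFU⟩ := P.face_relOpen i
    have hxU : x ∈ U := by rw [hFU] at hx; exact hx.1
    -- the point of the plane from which `x + t n` is seen when looking from `y`
    let q : ℝ → E3 := fun t => (1 - t / a)⁻¹ • (x + t • P.normal i - (t / a) • y)
    have hq : ContinuousAt q 0 := by
      have : ContinuousAt (fun t : ℝ => (1 - t / a)⁻¹) 0 :=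
        ContinuousAt.inv₀ (by fun_prop) (by simp)
      exact this.smul (by fun_prop)
    have hq0 : q 0 = x := by simp [q]
    have hev : ∀ᶠ t in 𝓝[>] (0 : ℝ), q t ∈ U := by
      refine nhdsWithin_le_nhds (hq.eventually ?_)
      rw [hq0]
      exact hU.mem_nhds hxU
    have hev2 : ∀ᶠ t in 𝓝[>] (0 : ℝ), t ∈ Ioo 0 (min δ a) :=
      Ioo_mem_nhdsGT (lt_min hδ ha0)
    obtain ⟨t, htU, ht⟩ := (hev.and hev2).exists
    have hta : t / a < 1 := (div_lt_one ha0).2 (ht.2.trans_le (min_le_right _ _))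
    have hta0 : 0 < t / a := div_pos ht.1 ha0
    have h1 : (1 - t / a) ≠ 0 := by linarith
    have hplane : ⟪P.normal i, q t⟫ = P.offset i := by
      simp only [q]
      rw [inner_smul_right, inner_sub_right, inner_add_right, inner_smul_right, inner_smul_right,
        hnn, hxn, inv_mul_eq_div, div_eq_iff h1]
      have : ⟪P.normal i, y⟫ = a + P.offset i := by rw [ha]; ring
      rw [this]
      field_simp
      ring
    have hqF : q t ∈ P.face i := by
      rw [hFU]
      exact ⟨htU, hplane⟩
    have hmem := hP.combo_mem (frontier_subset_closure (face_subset_frontier i hqF)) hy hta0 hta.le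
    have h2 : (1 - t / a) • q t + (t / a) • y = x + t • P.normal i := by
      simp only [q]
      rw [smul_smul, mul_inv_cancel₀ h1, one_smul]
      abel
    rw [h2] at hmem
    exact (hout t ⟨ht.1, ht.2.trans_le (min_le_left _ _)⟩).2 (subset_closure hmem)
  refine le_of_forall_lt fun s hs => ?_
  rcases lt_or_ge s 0 with hs0 | hs0
  · have := key x₀ (Metric.mem_ball_self hP.r_pos)
    rw [height]
    linarith
  · obtain ⟨s', hs', hs''⟩ := exists_between hs
    have := key (x₀ + s' • P.normal i) (by
      rw [Metric.mem_ball, dist_eq_norm, add_sub_cancel_left, norm_smul, P.norm_normal, mul_one,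
        Real.norm_of_nonneg (hs0.trans hs'.le)]
      exact hs'')
    rw [inner_add_right, inner_smul_right, hnn, mul_one] at this
    rw [height]
    linarith

theorem height_pos (hP : IsStarBall P.K x₀ r) (i : Fin P.numFaces) : 0 < P.height x₀ i :=
  hP.r_pos.trans_le (le_height hP i)

theorem isOpen_faceCone (hP : IsStarBall P.K x₀ r) (i : Fin P.numFaces) :
    IsOpen (P.faceCone x₀ i) :=
  (P.frame i).isOpen_cone (height_pos hP i) (isOpen_base i)

theorem conePt_eq (i : Fin P.numFaces) (u : E2) (t : ℝ) :
    (P.frame i).conePt x₀ (P.height x₀ i) u t = x₀ + t • (P.facePt x₀ i u - x₀) := by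
  simp [NormalFrame.conePt, facePt, NormalFrame.pt]

theorem gaugeAt_conePt (hP : IsStarBall P.K x₀ r) {i : Fin P.numFaces} {u : E2}
    (hu : u ∈ P.base x₀ i) {t : ℝ} (ht : 0 ≤ t) :
    gaugeAt P.K x₀ ((P.frame i).conePt x₀ (P.height x₀ i) u t) = t := by
  rw [conePt_eq, IsStarBall.gaugeAt_add_smul _ _ _ ht, add_sub_cancel,
    hP.gaugeAt_eq_one (face_subset_frontier i hu), mul_one]

theorem faceCone_subset (hP : IsStarBall P.K x₀ r) (i : Fin P.numFaces) :
    P.faceCone x₀ i ⊆ P.K := by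
  rintro x ⟨u, hu, t, ht, rfl⟩
  rw [← hP.gaugeAt_lt_one_iff, gaugeAt_conePt hP hu ht.1.le]
  exact ht.2

/-- On the cone over a face the gauge is linear. -/
theorem gaugeAt_eq_of_mem_faceCone (hP : IsStarBall P.K x₀ r) {i : Fin P.numFaces} {x : E3}
    (hx : x ∈ P.faceCone x₀ i) :
    gaugeAt P.K x₀ x = ⟪P.normal i, x - x₀⟫ / P.height x₀ i := by
  obtain ⟨u, hu, t, ht, rfl⟩ := hx
  rw [gaugeAt_conePt hP hu ht.1.le, (P.frame i).inner_conePt_sub,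
    mul_div_cancel_right₀ _ (height_pos hP i).ne']

theorem disjoint_faceCone (hP : IsStarBall P.K x₀ r) {i j : Fin P.numFaces} (hij : i ≠ j) :
    Disjoint (P.faceCone x₀ i) (P.faceCone x₀ j) := by
  rw [Set.disjoint_left]
  rintro x ⟨u, hu, t, ht, rfl⟩ ⟨v, hv, s, hs, h⟩
  have hts : t = s := by
    rw [← gaugeAt_conePt hP hu ht.1.le, h, gaugeAt_conePt hP hv hs.1.le]
  subst hts
  rw [conePt_eq, conePt_eq, add_right_inj] at h
  have h2 := smul_right_injective E3 ht.1.ne' h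
  simp only [sub_left_inj] at h2
  refine (Set.disjoint_left.1 (P.face_disjoint i j hij)) hu ?_
  rw [h2]
  exact hv

/-- Up to a null set, the element is the disjoint union of the cones over its faces: the cones over
the edges are contained in planes. -/
theorem ae_eq_iUnion_faceCone (hP : IsStarBall P.K x₀ r) :
    P.K =ᵐ[volume] ⋃ i, P.faceCone x₀ i := by
  -- the affine subspace spanned by `x₀` and an edge, of dimension at most two
  let S : ∀ i, Fin (P.numEdges i) → AffineSubspace ℝ E3 := fun i e =>
    AffineSubspace.mk' x₀ (Submodule.span ℝ {P.edgeA i e - x₀, P.edgeB i e - x₀})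
  have hS : ∀ i e, volume (S i e : Set E3) = 0 := by
    intro i e
    refine Measure.addHaar_affineSubspace _ _ fun htop => ?_
    have hdir : (S i e).direction = ⊤ := by rw [htop, AffineSubspace.direction_top]
    rw [AffineSubspace.direction_mk'] at hdir
    have h1 : Module.finrank ℝ (Submodule.span ℝ {P.edgeA i e - x₀, P.edgeB i e - x₀}) ≤ 2 := by
      have := finrank_span_finset_le_card (R := ℝ) ({P.edgeA i e - x₀, P.edgeB i e - x₀} : Finset E3)
      simp only [Finset.coe_insert, Finset.coe_singleton] at this
      exact this.trans Finset.card_le_two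
    rw [hdir, finrank_top] at h1
    simp at h1
  have hnull : volume (({x₀} : Set E3) ∪ ⋃ i, ⋃ e, (S i e : Set E3)) = 0 := by
    refine measure_union_null (measure_singleton _) ?_
    exact measure_iUnion_null fun i => measure_iUnion_null fun e => hS i e
  refine eventuallyEq_set.2 ?_
  filter_upwards [measure_eq_zero_iff_ae_notMem.1 hnull] with x hx
  simp only [mem_union, mem_singleton_iff, mem_iUnion, not_or, not_exists] at hx
  obtain ⟨hx0, hxS⟩ := hx
  refine ⟨fun hxK => ?_, fun h => ?_⟩
  · -- the radial projection of `x` to the boundary lies in a face or on one of its edges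
    have hfr := hP.radial_mem_frontier hx0
    have hp := hP.gaugeAt_pos hx0
    set p := gaugeAt P.K x₀ x
    rw [P.frontier_eq, mem_iUnion] at hfr
    obtain ⟨i, hi⟩ := hfr
    have hxeq : x = x₀ + p • (x₀ + p⁻¹ • (x - x₀) - x₀) := by
      rw [add_sub_cancel_left, smul_smul, mul_inv_cancel₀ hp.ne', one_smul, add_sub_cancel]
    by_cases hF : x₀ + p⁻¹ • (x - x₀) ∈ P.face i
    · rw [mem_iUnion]
      obtain ⟨u, hu⟩ : x₀ + p⁻¹ • (x - x₀) ∈ range (P.facePt x₀ i) := by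
        rw [range_facePt]
        exact face_subset_plane i hF
      refine ⟨i, u, by rw [base, mem_preimage, hu]; exact hF, p, ⟨hp, hP.gaugeAt_lt_one hxK⟩, ?_⟩
      rw [conePt_eq, hu]
      exact hxeq
    · exfalso
      have hb : x₀ + p⁻¹ • (x - x₀) ∈ closure (P.face i) \ P.face i := ⟨hi, hF⟩
      rw [P.face_boundary, mem_iUnion] at hb
      obtain ⟨e, a, b, -, -, hab, hseg⟩ := hb
      refine hxS i e ?_
      rw [SetLike.mem_coe, AffineSubspace.mem_mk', vsub_eq_sub]
      have h2 : x - x₀ = p • (a • (P.edgeA i e - x₀) + b • (P.edgeB i e - x₀)) := by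
        have h3 : a • (P.edgeA i e - x₀) + b • (P.edgeB i e - x₀) = p⁻¹ • (x - x₀) := by
          rw [smul_sub, smul_sub, sub_add_sub_comm, ← add_smul, hab, one_smul, hseg,
            add_sub_cancel_left]
        rw [h3, smul_smul, mul_inv_cancel₀ hp.ne', one_smul]
      rw [h2]
      refine Submodule.smul_mem _ _ (Submodule.add_mem _ (Submodule.smul_mem _ _ ?_)
        (Submodule.smul_mem _ _ ?_)) <;> apply Submodule.subset_span <;> simp
  · obtain ⟨i, hi⟩ := mem_iUnion.1 h
    exact faceCone_subset hP i hi

theorem lintegral_eq_sum_faceCone (hP : IsStarBall P.K x₀ r) (G : E3 → ℝ≥0∞) :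
    ∫⁻ x in P.K, G x = ∑ i, ∫⁻ x in P.faceCone x₀ i, G x := by
  rw [setLIntegral_congr (ae_eq_iUnion_faceCone hP), lintegral_iUnion
    (fun i => (isOpen_faceCone hP i).measurableSet) fun i j hij => disjoint_faceCone hP hij,
    tsum_fintype]

theorem integral_eq_sum_faceCone (hP : IsStarBall P.K x₀ r) {G : E3 → ℝ} (hG : IntegrableOn G P.K) :
    ∫ x in P.K, G x = ∑ i, ∫ x in P.faceCone x₀ i, G x := by
  rw [setIntegral_congr_set (ae_eq_iUnion_faceCone hP), integral_iUnion_fintype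
    (fun i => (isOpen_faceCone hP i).measurableSet) (fun i j hij => disjoint_faceCone hP hij)
    fun i => hG.mono_set (faceCone_subset hP i)]

end PolyhedralElement

/-! ### Traces and the divergence theorem -/

theorem IsStarBall.integrableOn_of_continuous {K : Set E3} {x₀ : E3} {r : ℝ}
    (hK : IsStarBall K x₀ r) {F : Type*} [NormedAddCommGroup F] {f : E3 → F} (hf : Continuous f) :
    IntegrableOn f K :=
  (hf.continuousOn.integrableOn_compact hK.isCompact_closure).mono_set subset_closure

/-- The fundamental theorem of calculus along a ray, with a weight. -/
theorem integral_radial {g : E3 → ℝ} (hg : ContDiff ℝ 1 g) {w w' : ℝ → ℝ}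
    (hw : ∀ t, HasDerivAt w (w' t) t) (hw' : Continuous w') (x₀ y : E3) :
    ∫ t in Ioo (0 : ℝ) 1, (w' t * g (x₀ + t • y) + w t * fderiv ℝ g (x₀ + t • y) y)
      = w 1 * g (x₀ + y) - w 0 * g x₀ := by
  have hgd : Differentiable ℝ g := hg.differentiable (by norm_num)
  have hgc := hg.continuous
  have hgc' : Continuous (fderiv ℝ g) := hg.continuous_fderiv (by norm_num)
  have hwc : Continuous w := continuous_iff_continuousAt.2 fun t => (hw t).continuousAt
  have hd : ∀ t, HasDerivAt (fun t => w t * g (x₀ + t • y))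
      (w' t * g (x₀ + t • y) + w t * fderiv ℝ g (x₀ + t • y) y) t := by
    intro t
    have h1 : HasDerivAt (fun t : ℝ => x₀ + t • y) y t := by
      simpa using ((hasDerivAt_id t).smul_const y).const_add x₀
    exact (hw t).mul ((hgd (x₀ + t • y)).hasFDerivAt.comp_hasDerivAt t h1)
  have hcont : Continuous fun t => w' t * g (x₀ + t • y) + w t * fderiv ℝ g (x₀ + t • y) y := by
    have : Continuous fun t : ℝ => fderiv ℝ g (x₀ + t • y) y :=
      (hgc'.comp (by fun_prop)).clm_apply continuous_const
    fun_prop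
  rw [← integral_Ioc_eq_integral_Ioo, ← intervalIntegral.integral_of_le zero_le_one,
    intervalIntegral.integral_eq_sub_of_hasDerivAt (fun t _ => hd t)
      (hcont.intervalIntegrable _ _)]
  simp

/-- The operator `φ ↦ div ((x - x₀) φ)`. -/
def eulerOp (x₀ : E3) (φ : E3 → ℝ) (x : E3) : ℝ := 3 * φ x + fderiv ℝ φ x (x - x₀)

theorem continuous_eulerOp (x₀ : E3) {φ : E3 → ℝ} (hφ : ContDiff ℝ 1 φ) :
    Continuous (eulerOp x₀ φ) := by
  have h1 := hφ.continuous
  have h2 : Continuous fun x => fderiv ℝ φ x (x - x₀) :=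
    (hφ.continuous_fderiv (by norm_num)).clm_apply (by fun_prop)
  unfold eulerOp
  fun_prop

theorem contDiff_eulerOp (x₀ : E3) {φ : E3 → ℝ} (hφ : ContDiff ℝ 2 φ) :
    ContDiff ℝ 1 (eulerOp x₀ φ) := by
  have h1 : ContDiff ℝ 1 (fderiv ℝ φ) := hφ.fderiv_right (by norm_num)
  have h2 : ContDiff ℝ 1 fun x => fderiv ℝ φ x (x - x₀) := h1.clm_apply (by fun_prop)
  have h3 : ContDiff ℝ 1 φ := hφ.of_le (by norm_num)
  exact (contDiff_const.mul h3).add h2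

/-- The derivatives of `eulerOp φ`, by the symmetry of second derivatives. -/
theorem fderiv_eulerOp (x₀ : E3) {φ : E3 → ℝ} (hφ : ContDiff ℝ 2 φ) (x v : E3) :
    fderiv ℝ (eulerOp x₀ φ) x v
      = 4 * fderiv ℝ φ x v + fderiv ℝ (fun y => fderiv ℝ φ y v) x (x - x₀) := by
  have h1 : ContDiff ℝ 1 (fderiv ℝ φ) := hφ.fderiv_right (by norm_num)
  have h1d := (h1.differentiable (by norm_num) x).hasFDerivAt
  have h2 : HasFDerivAt φ (fderiv ℝ φ x) x :=
    ((hφ.differentiable (by norm_num)) x).hasFDerivAt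
  have h3 : HasFDerivAt (fun y : E3 => y - x₀) (ContinuousLinearMap.id ℝ E3) x :=
    (hasFDerivAt_id x).sub_const x₀
  have h4 := (h2.const_mul 3).add (h1d.clm_apply h3)
  have h5 : fderiv ℝ (eulerOp x₀ φ) x = _ := h4.fderiv
  have h6 := h1d.clm_apply (hasFDerivAt_const v x)
  have h7 : fderiv ℝ (fun y => fderiv ℝ φ y v) x = _ := h6.fderiv
  have hsymm := (hφ.contDiffAt (x := x)).isSymmSndFDerivAt (by simp)
  rw [h5, h7]
  simp only [add_apply, smul_apply, smul_eq_mul,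
    ContinuousLinearMap.comp_apply, ContinuousLinearMap.id_apply, ContinuousLinearMap.flip_apply,
    zero_apply, map_zero]
  rw [hsymm.eq v (x - x₀)]
  ring

namespace PolyhedralElement

variable {P : PolyhedralElement} {x₀ : E3} {r : ℝ}

theorem facePt_mem_face {i : Fin P.numFaces} {u : E2} (hu : u ∈ P.base x₀ i) :
    P.facePt x₀ i u ∈ P.face i := hu

/-- The trace formula: a surface integral over a face is a volume integral over its cone. -/
theorem height_mul_faceIntegral (hP : IsStarBall P.K x₀ r) {φ : E3 → ℝ} (hφ : ContDiff ℝ 1 φ)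
    (i : Fin P.numFaces) :
    P.height x₀ i * P.faceIntegral i φ = ∫ x in P.faceCone x₀ i, eulerOp x₀ φ x := by
  have hc := continuous_eulerOp x₀ hφ
  rw [faceCone, NormalFrame.integral_cone _ (height_pos hP i) (isOpen_base i)
    ((hP.integrableOn_of_continuous hc).mono_set (faceCone_subset hP i)), faceIntegral_eq x₀,
    ← integral_const_mul]
  refine integral_congr_ae (Eventually.of_forall fun u => ?_)
  have h := integral_radial hφ (w := fun t => t ^ 3) (w' := fun t => 3 * t ^ 2)
    (fun t => by simpa using hasDerivAt_pow 3 t) (by fun_prop) x₀ (P.facePt x₀ i u - x₀)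
  simp only [one_pow, one_mul, add_sub_cancel, ne_eq, OfNat.ofNat_ne_zero, not_false_eq_true,
    zero_pow, zero_mul, sub_zero] at h
  beta_reduce
  rw [← h, ← integral_const_mul]
  refine integral_congr_ae (Eventually.of_forall fun t => ?_)
  simp only [conePt_eq, eulerOp, add_sub_cancel_left, map_smul, smul_eq_mul]
  ring

/-- The trace inequality behind the trace formula. -/
theorem height_mul_lintegral_face_le (hP : IsStarBall P.K x₀ r) {φ : E3 → ℝ} (hφ : ContDiff ℝ 1 φ)
    (i : Fin P.numFaces) :
    ENNReal.ofReal (P.height x₀ i) * ∫⁻ u in P.base x₀ i, ‖φ (P.facePt x₀ i u)‖ₑ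
      ≤ ∫⁻ x in P.faceCone x₀ i, ‖eulerOp x₀ φ x‖ₑ := by
  have hc := continuous_eulerOp x₀ hφ
  have hd := height_pos hP i
  rw [faceCone, NormalFrame.lintegral_cone _ hd (isOpen_base i) hc.enorm.measurable,
    ← lintegral_const_mul' _ _ ENNReal.ofReal_ne_top]
  refine lintegral_mono fun u => ?_
  have h := integral_radial hφ (w := fun t => t ^ 3) (w' := fun t => 3 * t ^ 2)
    (fun t => by simpa using hasDerivAt_pow 3 t) (by fun_prop) x₀ (P.facePt x₀ i u - x₀)
  simp only [one_pow, one_mul, add_sub_cancel, ne_eq, OfNat.ofNat_ne_zero, not_false_eq_true,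
    zero_pow, zero_mul, sub_zero] at h
  rw [← h]
  calc _ ≤ ENNReal.ofReal (P.height x₀ i) * ∫⁻ t in Ioo (0 : ℝ) 1,
        ‖3 * t ^ 2 * φ (x₀ + t • (P.facePt x₀ i u - x₀)) + t ^ 3 *
          fderiv ℝ φ (x₀ + t • (P.facePt x₀ i u - x₀)) (P.facePt x₀ i u - x₀)‖ₑ := by
        gcongr
        exact enorm_integral_le_lintegral_enorm _
    _ = _ := by
        rw [← lintegral_const_mul' _ _ ENNReal.ofReal_ne_top]
        refine lintegral_congr fun t => ?_
        have ht2 : ENNReal.ofReal (t ^ 2) = ‖t ^ 2‖ₑ := (Real.enorm_of_nonneg (sq_nonneg t)).symm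
        rw [ENNReal.ofReal_mul hd.le, ht2, mul_assoc (ENNReal.ofReal _), ← enorm_mul]
        simp only [conePt_eq, eulerOp, add_sub_cancel_left, map_smul, smul_eq_mul]
        congr 2
        ring

/-- Integration by parts against the truncated gauge `max 0 (1 - gauge)`, which is linear on each
cone. -/
theorem integral_one_sub_gauge_mul_fderiv (hP : IsStarBall P.K x₀ r) {f : E3 → ℝ}
    (hf : ContDiff ℝ 1 f) (hfc : HasCompactSupport f) (v : E3) :
    ∫ x in P.K, fderiv ℝ f x v * (1 - gaugeAt P.K x₀ x)
      = ∑ i, ⟪P.normal i, v⟫ / P.height x₀ i * ∫ x in P.faceCone x₀ i, f x := by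
  have hKm := P.isOpen.measurableSet
  set q : E3 → ℝ := fun x => max 0 (1 - gaugeAt P.K x₀ x) with hq
  have hlip : LipschitzWith (Real.toNNReal (1 / r)) q := by
    have h1 : LipschitzWith (Real.toNNReal (1 / r)) fun x => 1 - gaugeAt P.K x₀ x := by
      have := (LipschitzWith.const (1 : ℝ)).sub hP.lipschitzWith_gaugeAt
      simpa using this
    exact h1.const_max 0
  have hqK : ∀ x ∈ P.K, q x = 1 - gaugeAt P.K x₀ x := fun x hx =>
    max_eq_right (by linarith [hP.gaugeAt_lt_one hx])
  have hq0 : ∀ x, x ∉ P.K → q x = 0 := fun x hx =>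
    max_eq_left (by linarith [hP.one_le_gaugeAt hx])
  have hqc : HasCompactSupport q :=
    HasCompactSupport.intro hP.isCompact_closure fun x hx => hq0 x fun h => hx (subset_closure h)
  obtain ⟨C, hC⟩ := hf.lipschitzWith_of_hasCompactSupport hfc (by norm_num)
  -- integration by parts for Lipschitz functions, with `q` vanishing outside of `K`
  have hibp := LipschitzWith.integral_lineDeriv_mul_eq (μ := (volume : Measure E3)) hC hlip hqc v
  have hlhs : ∫ x, lineDeriv ℝ f x v * q x
      = ∫ x in P.K, fderiv ℝ f x v * (1 - gaugeAt P.K x₀ x) := by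
    rw [← setIntegral_eq_integral_of_forall_compl_eq_zero (s := P.K) fun x hx => by
      rw [hq0 x hx, mul_zero]]
    refine setIntegral_congr_fun hKm fun x hx => ?_
    rw [hqK x hx, (hf.differentiable (by norm_num) x).lineDeriv_eq_fderiv]
  have hcone : ∀ i, ∀ x ∈ P.faceCone x₀ i,
      lineDeriv ℝ q x (-v) = ⟪P.normal i, v⟫ / P.height x₀ i := by
    intro i x hx
    have hev : q =ᶠ[𝓝 x] fun y => 1 - ⟪P.normal i, y - x₀⟫ / P.height x₀ i := by
      filter_upwards [(isOpen_faceCone hP i).mem_nhds hx] with y hy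
      rw [hqK y (faceCone_subset hP i hy), gaugeAt_eq_of_mem_faceCone hP hy]
    rw [Filter.EventuallyEq.lineDeriv_eq hev]
    have h1 : HasFDerivAt (fun y : E3 => 1 - ⟪P.normal i, y - x₀⟫ / P.height x₀ i)
        (-((P.height x₀ i)⁻¹ • innerSL ℝ (P.normal i))) x := by
      have h2 : HasFDerivAt (fun y : E3 => ⟪P.normal i, y - x₀⟫) (innerSL ℝ (P.normal i)) x :=
        (innerSL ℝ (P.normal i)).hasFDerivAt.comp x ((hasFDerivAt_id x).sub_const x₀)
      have h3 := (h2.const_mul (P.height x₀ i)⁻¹).const_sub 1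
      refine h3.congr_of_eventuallyEq (Eventually.of_forall fun y => ?_)
      simp only [div_eq_inv_mul]
    rw [h1.differentiableAt.lineDeriv_eq_fderiv, h1.fderiv]
    simp [div_eq_inv_mul]
  rw [← hlhs, hibp, ← setIntegral_eq_integral_of_forall_compl_eq_zero (s := P.K) fun x hx => ?_]
  · rw [setIntegral_congr_set (ae_eq_iUnion_faceCone hP)]
    have heq : ∀ i, ∫ x in P.faceCone x₀ i, lineDeriv ℝ q x (-v) * f x
        = ⟪P.normal i, v⟫ / P.height x₀ i * ∫ x in P.faceCone x₀ i, f x := fun i => by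
      rw [← integral_const_mul]
      refine setIntegral_congr_fun (isOpen_faceCone hP i).measurableSet fun x hx => ?_
      rw [hcone i x hx]
    rw [integral_iUnion_fintype (fun i => (isOpen_faceCone hP i).measurableSet)
      (fun i j hij => disjoint_faceCone hP hij) fun i => ?_]
    · simp only [heq]
    · refine (((hP.integrableOn_of_continuous hf.continuous).mono_set
        (faceCone_subset hP i)).const_mul (⟪P.normal i, v⟫ / P.height x₀ i)).congr ?_
      filter_upwards [ae_restrict_mem (isOpen_faceCone hP i).measurableSet] with x hx
      rw [hcone i x hx]
  · -- outside of `K` the function `q ≥ 0` attains its minimum `0`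
    have hmin : IsLocalMin (fun t : ℝ => q (x + t • (-v))) 0 := by
      refine Eventually.of_forall fun t => ?_
      simp only [zero_smul, add_zero]
      rw [hq0 x hx]
      exact le_max_left _ _
    rw [lineDeriv, hmin.deriv_eq_zero, zero_mul]

/-- The volume integral of a function is recovered from its Euler operator, weighted by
`1 - gauge`: radially, `4 t² (1 - t) g + t³ (1 - t) g' = t² g + (t³ (1 - t) g)'`. -/
theorem integral_one_sub_gauge_mul_euler (hP : IsStarBall P.K x₀ r) {g : E3 → ℝ}
    (hg : ContDiff ℝ 1 g) :
    ∫ x in P.K, (4 * g x + fderiv ℝ g x (x - x₀)) * (1 - gaugeAt P.K x₀ x) = ∫ x in P.K, g x := by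
  have hgauge := hP.lipschitzWith_gaugeAt.continuous
  have hgd : Continuous fun x => fderiv ℝ g x (x - x₀) :=
    (hg.continuous_fderiv (by norm_num)).clm_apply (by fun_prop)
  have hgc := hg.continuous
  have h1 : Continuous fun x => (4 * g x + fderiv ℝ g x (x - x₀)) * (1 - gaugeAt P.K x₀ x) := by
    fun_prop
  have hi1 := hP.integrableOn_of_continuous h1
  have hi2 := hP.integrableOn_of_continuous hgc
  rw [integral_eq_sum_faceCone hP hi1, integral_eq_sum_faceCone hP hi2]
  refine Finset.sum_congr rfl fun i _ => ?_
  have hd := height_pos hP i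
  rw [faceCone, NormalFrame.integral_cone _ hd (isOpen_base i) (hi1.mono_set (faceCone_subset hP i)),
    NormalFrame.integral_cone _ hd (isOpen_base i) (hi2.mono_set (faceCone_subset hP i))]
  refine setIntegral_congr_fun (isOpen_base i).measurableSet fun u hu => ?_
  set y := P.facePt x₀ i u - x₀ with hy
  have h := integral_radial hg (w := fun t => t ^ 3 * (1 - t)) (w' := fun t => 3 * t ^ 2 - 4 * t ^ 3)
    (fun t => by
      have := (hasDerivAt_pow 3 t).mul ((hasDerivAt_id t).const_sub 1)
      refine this.congr_deriv ?_
      simp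
      ring) (by fun_prop) x₀ y
  simp only [one_pow, sub_self, mul_zero, zero_mul, ne_eq, OfNat.ofNat_ne_zero, not_false_eq_true,
    zero_pow] at h
  have hcont1 : Continuous fun t : ℝ => (3 * t ^ 2 - 4 * t ^ 3) * g (x₀ + t • y)
      + t ^ 3 * (1 - t) * fderiv ℝ g (x₀ + t • y) y := by
    have : Continuous fun t : ℝ => fderiv ℝ g (x₀ + t • y) y :=
      ((hg.continuous_fderiv (by norm_num)).comp (by fun_prop)).clm_apply continuous_const
    fun_prop
  have hcont2 : Continuous fun t : ℝ => t ^ 2 * g (x₀ + t • y) := by fun_prop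
  have hint : ∀ {f : ℝ → ℝ}, Continuous f → IntegrableOn f (Ioo (0 : ℝ) 1) := fun hf =>
    (hf.continuousOn.integrableOn_compact isCompact_Icc).mono_set Ioo_subset_Icc_self
  calc ∫ t in Ioo (0 : ℝ) 1, P.height x₀ i * t ^ 2 *
        ((4 * g ((P.frame i).conePt x₀ (P.height x₀ i) u t)
        + fderiv ℝ g ((P.frame i).conePt x₀ (P.height x₀ i) u t)
          ((P.frame i).conePt x₀ (P.height x₀ i) u t - x₀))
        * (1 - gaugeAt P.K x₀ ((P.frame i).conePt x₀ (P.height x₀ i) u t)))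
      = ∫ t in Ioo (0 : ℝ) 1, (P.height x₀ i * (((3 * t ^ 2 - 4 * t ^ 3) * g (x₀ + t • y)
          + t ^ 3 * (1 - t) * fderiv ℝ g (x₀ + t • y) y))
          + P.height x₀ i * (t ^ 2 * g (x₀ + t • y))) := by
        refine setIntegral_congr_fun measurableSet_Ioo fun t ht => ?_
        rw [gaugeAt_conePt hP hu ht.1.le, conePt_eq, ← hy, add_sub_cancel_left, map_smul,
          smul_eq_mul]
        ring
    _ = ∫ t in Ioo (0 : ℝ) 1, P.height x₀ i * (t ^ 2 * g (x₀ + t • y)) := by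
        rw [integral_add ((hint hcont1).const_mul _) ((hint hcont2).const_mul _),
          integral_const_mul, h]
        ring
    _ = _ := by
        refine setIntegral_congr_fun measurableSet_Ioo fun t ht => ?_
        rw [conePt_eq, ← hy]
        ring

/-- The divergence theorem for functions with compact support in the space: the two identities with
the gauge are combined for `eulerOp φ`, whose integrals over the cones are surface integrals. -/
theorem integral_fderiv_of_hasCompactSupport (hP : IsStarBall P.K x₀ r) {φ : E3 → ℝ}
    (hφ : ContDiff ℝ 2 φ) (hc : HasCompactSupport φ) (v : E3) :
    ∫ x in P.K, fderiv ℝ φ x v = ∑ i, ⟪P.normal i, v⟫ * P.faceIntegral i φ := by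
  have hφ1 : ContDiff ℝ 1 φ := hφ.of_le (by norm_num)
  have hg : ContDiff ℝ 1 fun y => fderiv ℝ φ y v :=
    (hφ.fderiv_right (m := 1) (by norm_num)).clm_apply contDiff_const
  have hec : HasCompactSupport (eulerOp x₀ φ) := by
    refine HasCompactSupport.intro hc fun x hx => ?_
    have h1 : φ x = 0 := image_eq_zero_of_notMem_tsupport hx
    have h2 : fderiv ℝ φ x = 0 := by
      by_contra h
      exact hx (support_fderiv_subset ℝ h)
    simp [eulerOp, h1, h2]
  have h1 := integral_one_sub_gauge_mul_fderiv hP (contDiff_eulerOp x₀ hφ) hec v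
  simp only [fderiv_eulerOp x₀ hφ] at h1
  rw [integral_one_sub_gauge_mul_euler hP hg] at h1
  rw [h1]
  refine Finset.sum_congr rfl fun i _ => ?_
  rw [← height_mul_faceIntegral hP hφ1]
  have := (height_pos hP i).ne'
  field_simp

/-- The cutoff is constant near every point of the closure, so that it changes neither derivatives
in `K` nor values on the faces. -/
theorem exists_cutoff (hP : IsStarBall P.K x₀ r) :
    ∃ χ : E3 → ℝ, ContDiff ℝ ∞ χ ∧ HasCompactSupport χ ∧ ∀ x ∈ closure P.K, χ =ᶠ[𝓝 x] 1 := by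
  obtain ⟨R, hR⟩ := hP.isBounded.closure.subset_closedBall x₀
  let b : ContDiffBump x₀ := ⟨|R| + 1, |R| + 2, by positivity, by linarith⟩
  refine ⟨b, b.contDiff, b.hasCompactSupport, fun x hx => ?_⟩
  refine b.eventuallyEq_one_of_mem_ball ?_
  have := hR hx
  rw [Metric.mem_closedBall] at this
  rw [Metric.mem_ball]
  exact this.trans_lt (by linarith [le_abs_self R])

/-- The divergence theorem on a star-shaped polyhedron, for each partial derivative. -/
theorem integral_fderiv (hP : IsStarBall P.K x₀ r) {φ : E3 → ℝ} (hφ : ContDiff ℝ 2 φ) (v : E3) :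
    ∫ x in P.K, fderiv ℝ φ x v = ∑ i, ⟪P.normal i, v⟫ * P.faceIntegral i φ := by
  obtain ⟨χ, hχ, hχc, hχ1⟩ := exists_cutoff hP
  have h := integral_fderiv_of_hasCompactSupport hP
    ((contDiff_infty.1 hχ 2).mul hφ) (hχc.mul_right (f' := φ)) v
  have h1 : ∀ x ∈ closure P.K, (fun x => χ x * φ x) =ᶠ[𝓝 x] φ := fun x hx => by
    filter_upwards [hχ1 x hx] with y hy
    rw [hy, Pi.one_apply, one_mul]
  have h2 : ∫ x in P.K, fderiv ℝ (fun x => χ x * φ x) x v = ∫ x in P.K, fderiv ℝ φ x v := by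
    refine setIntegral_congr_fun P.isOpen.measurableSet fun x hx => ?_
    rw [(h1 x (subset_closure hx)).fderiv_eq]
  have h3 : ∀ i, P.faceIntegral i (fun x => χ x * φ x) = P.faceIntegral i φ := fun i => by
    rw [faceIntegral_eq x₀, faceIntegral_eq x₀]
    refine setIntegral_congr_fun (isOpen_base i).measurableSet fun u hu => ?_
    exact (h1 _ (frontier_subset_closure (face_subset_frontier i hu))).eq_of_nhds
  rw [← h2]
  refine h.trans (Finset.sum_congr rfl fun i _ => ?_)
  rw [← h3]

theorem integrableOn_face (x₀ : E3) (i : Fin P.numFaces) {f : E3 → ℝ} (hf : Continuous f) :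
    IntegrableOn (fun u => f (P.facePt x₀ i u)) (P.base x₀ i) := by
  have hc : Continuous fun u => f (P.facePt x₀ i u) := hf.comp (isometry_facePt i).continuous
  exact (hc.continuousOn.integrableOn_compact (isBounded_base i).isCompact_closure).mono_set
    subset_closure

theorem faceIntegral_sum (x₀ : E3) (i : Fin P.numFaces) {ι : Type*} (s : Finset ι)
    {f : ι → E3 → ℝ} (hf : ∀ j ∈ s, Continuous (f j)) (a : ι → ℝ) :
    P.faceIntegral i (fun x => ∑ j ∈ s, a j * f j x) = ∑ j ∈ s, a j * P.faceIntegral i (f j) := by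
  simp only [faceIntegral_eq x₀]
  rw [integral_finsetSum]
  · simp only [integral_const_mul]
  · intro j hj
    exact (integrableOn_face x₀ i (hf j hj)).const_mul _

/-- The divergence theorem on a star-shaped polyhedron. -/
theorem integral_divergence (hP : IsStarBall P.K x₀ r) {Ψ : E3 → E3} (hΨ : ContDiff ℝ 2 Ψ) :
    ∫ x in P.K, divergence Ψ x = ∑ i, P.faceIntegral i (fun x => ⟪Ψ x, P.normal i⟫) := by
  have hΨj : ∀ j, ContDiff ℝ 2 fun x => Ψ x j := contDiff_euclidean.1 hΨ
  have hd : ∀ x, ∀ j, (fderiv ℝ Ψ x (EuclideanSpace.single j 1)) j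
      = fderiv ℝ (fun x => Ψ x j) x (EuclideanSpace.single j 1) := by
    intro x j
    have h1 : HasFDerivAt Ψ (fderiv ℝ Ψ x) x := (hΨ.differentiable (by simp) x).hasFDerivAt
    have h2 := (EuclideanSpace.proj (𝕜 := ℝ) j).hasFDerivAt.comp x h1
    have h3 : fderiv ℝ (fun y => Ψ y j) x = _ := h2.fderiv
    rw [h3]
    rfl
  simp only [divergence, hd]
  rw [integral_finsetSum]
  · simp only [integral_fderiv hP (hΨj _)]
    rw [Finset.sum_comm]
    refine Finset.sum_congr rfl fun i _ => ?_
    have h := faceIntegral_sum x₀ i Finset.univ (f := fun j x => Ψ x j)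
      (fun j _ => (hΨj j).continuous) (fun j => P.normal i j)
    have h2 : (fun x => ⟪Ψ x, P.normal i⟫) = fun x => ∑ j, P.normal i j * Ψ x j := by
      funext x
      rw [inner_eq_sum]
      exact Finset.sum_congr rfl fun j _ => mul_comm _ _
    rw [h2, h]
    refine Finset.sum_congr rfl fun j _ => ?_
    rw [EuclideanSpace.inner_single_right]
    simp
  · intro j _
    refine hP.integrableOn_of_continuous ?_
    exact ((hΨj j).continuous_fderiv (by norm_num)).clm_apply continuous_const

end PolyhedralElement

/-! ### Subadditivity of the Sobolev norms -/

/-- The triangle inequality for the Euclidean norm of a family of extended nonnegative numbers. -/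
theorem enorm_two_add_le {ι : Type*} (s : Finset ι) {a b c : ι → ℝ≥0∞}
    (h : ∀ i ∈ s, a i ≤ b i + c i) :
    (∑ i ∈ s, a i ^ 2) ^ (1 / 2 : ℝ)
      ≤ (∑ i ∈ s, b i ^ 2) ^ (1 / 2 : ℝ) + (∑ i ∈ s, c i ^ 2) ^ (1 / 2 : ℝ) := by
  have h1 := ENNReal.Lp_add_le s b c (p := 2) (by norm_num)
  simp only [ENNReal.rpow_two] at h1
  refine le_trans ?_ h1
  gcongr with i hi
  exact h i hi

theorem rpow_half_sum_mul {ι : Type*} (s : Finset ι) (c : ℝ≥0∞) (a : ι → ℝ≥0∞) :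
    (∑ i ∈ s, (c * a i) ^ 2) ^ (1 / 2 : ℝ) = c * (∑ i ∈ s, a i ^ 2) ^ (1 / 2 : ℝ) := by
  simp only [mul_pow]
  rw [← Finset.mul_sum, ENNReal.mul_rpow_of_nonneg _ _ (by norm_num), ← ENNReal.rpow_natCast,
    ← ENNReal.rpow_mul]
  simp

theorem eLpNorm_sub_const_mul_le {α : Type*} [MeasurableSpace α] {μ : Measure α} {f g : α → ℝ}
    (hf : AEStronglyMeasurable f μ) (hg : AEStronglyMeasurable g μ) (a : ℝ) :
    eLpNorm (fun x => f x - a * g x) 2 μ ≤ eLpNorm f 2 μ + ‖a‖ₑ * eLpNorm g 2 μ := by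
  have h := eLpNorm_sub_le hf (hg.const_smul a) (p := 2) (by norm_num)
  rw [eLpNorm_const_smul] at h
  exact h

theorem gagQuot_sub_const_mul (σ : ℝ) (f g : E3 → ℝ) (a : ℝ) (p : E3 × E3) :
    gagQuot σ (fun x => f x - a * g x) p = gagQuot σ f p - a * gagQuot σ g p := by
  simp only [gagQuot]
  ring

/-- The triangle inequality for the seminorms. For positive integer part, it is an inequality
between infima over weak gradients, which are infinite if there are none. -/
theorem seminormAux_sub_const_mul_le {K : Set E3} (σ : ℝ) (m : ℕ) {f g : E3 → ℝ}
    (hf : LocallyIntegrableOn f K volume) (hg : LocallyIntegrableOn g K volume) (a : ℝ) :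
    seminormAux K σ m (fun x => f x - a * g x)
      ≤ seminormAux K σ m f + ‖a‖ₑ * seminormAux K σ m g := by
  induction m generalizing f g with
  | zero =>
    have hfm := hf.aestronglyMeasurable
    have hgm := hg.aestronglyMeasurable
    by_cases h0 : σ = 0
    · simp only [seminormAux, h0, if_true]
      exact eLpNorm_sub_const_mul_le hfm hgm a
    · simp only [seminormAux, h0, if_false]
      have hfg : AEStronglyMeasurable (fun x => f x - a * g x) (volume.restrict K) :=
        hfm.sub (hgm.const_smul a)
      rw [gagliardo_eq_eLpNorm σ hfm, gagliardo_eq_eLpNorm σ hgm, gagliardo_eq_eLpNorm σ hfg]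
      have := eLpNorm_sub_const_mul_le (aestronglyMeasurable_gagQuot hfm σ)
        (aestronglyMeasurable_gagQuot hgm σ) a
      refine le_trans (le_of_eq ?_) this
      congr 1
      funext p
      exact gagQuot_sub_const_mul σ f g a p
  | succ m ih =>
    have key : ∀ u, HasWeakGradient K f u → ∀ v, HasWeakGradient K g v →
        seminormAux K σ (m + 1) (fun x => f x - a * g x)
          ≤ (∑ i : Fin 3, seminormAux K σ m (fun x => u x i) ^ 2) ^ (1 / 2 : ℝ)
            + ‖a‖ₑ * (∑ i : Fin 3, seminormAux K σ m (fun x => v x i) ^ 2) ^ (1 / 2 : ℝ) := by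
      intro u hu v hv
      rw [seminormAux]
      refine (iInf₂_le _ (hu.sub_const_mul a hv)).trans ?_
      rw [← rpow_half_sum_mul]
      refine enorm_two_add_le _ fun i _ => ?_
      exact ih (locallyIntegrableOn_apply hu.locallyIntegrable_grad i)
        (locallyIntegrableOn_apply hv.locallyIntegrable_grad i)
    rcases eq_or_ne a 0 with rfl | ha
    · simp
    -- without a weak gradient of `f` or `g`, the right-hand side is infinite
    by_cases hu : ∃ u, HasWeakGradient K f u
    swap
    · have : seminormAux K σ (m + 1) f = ⊤ := by
        rw [seminormAux]
        exact iInf₂_eq_top.2 fun u h => (hu ⟨u, h⟩).elim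
      simp [this]
    by_cases hv : ∃ v, HasWeakGradient K g v
    swap
    · have : seminormAux K σ (m + 1) g = ⊤ := by
        rw [seminormAux]
        exact iInf₂_eq_top.2 fun u h => (hv ⟨u, h⟩).elim
      rw [this, ENNReal.mul_top (by simpa using ha)]
      simp
    conv_rhs => rw [seminormAux, seminormAux]
    simp only [iInf_subtype']
    have : Nonempty { u // HasWeakGradient K f u } := ⟨⟨hu.choose, hu.choose_spec⟩⟩
    have : Nonempty { v // HasWeakGradient K g v } := ⟨⟨hv.choose, hv.choose_spec⟩⟩
    rw [ENNReal.mul_iInf_of_ne (by simpa using ha) (by simp), ENNReal.iInf_add]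
    refine le_iInf fun u => ?_
    rw [ENNReal.add_iInf]
    exact le_iInf fun v => key u u.2 v v.2

theorem hSeminorm_sub_const_mul_le {K : Set E3} (s : ℝ) {f g : E3 → ℝ}
    (hf : LocallyIntegrableOn f K volume) (hg : LocallyIntegrableOn g K volume) (a : ℝ) :
    hSeminorm K s (fun x => f x - a * g x) ≤ hSeminorm K s f + ‖a‖ₑ * hSeminorm K s g :=
  seminormAux_sub_const_mul_le _ _ hf hg a

theorem hNorm_sub_const_mul_le {K : Set E3} (s : ℝ) {f g : E3 → ℝ}
    (hf : LocallyIntegrableOn f K volume) (hg : LocallyIntegrableOn g K volume) (a : ℝ) :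
    hNorm K s (fun x => f x - a * g x) ≤ hNorm K s f + ‖a‖ₑ * hNorm K s g := by
  -- the last summand is adjoined to the sum as the index `none`
  have key : ∀ f, hNorm K s f = (∑ j ∈ (Finset.range ⌈s⌉₊).insertNone,
      (j.elim (hSeminorm K s f) fun j : ℕ => hSeminorm K j f) ^ 2) ^ (1 / 2 : ℝ) := fun f => by
    rw [Finset.sum_insertNone, add_comm]
    rfl
  rw [key, key, key, ← rpow_half_sum_mul]
  refine enorm_two_add_le _ fun j _ => ?_
  cases j <;> exact hSeminorm_sub_const_mul_le _ hf hg a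

/-- Approximation under finitely many functionals: an element that is a limit of elements of `M` is
also the limit of a sequence in `M` along which the given linear functionals converge. A bounded
functional does so on every such sequence, while the kernel of an unbounded one is still dense. -/
theorem exists_seq_tendsto_functionals {X : Type*} [AddCommGroup X] [Module ℝ X]
    {p : X → ℝ≥0∞} {Y : Submodule ℝ X} (hp0 : p 0 = 0)
    (hp : ∀ u ∈ Y, ∀ v ∈ Y, ∀ a : ℝ, p (u - a • v) ≤ p u + ‖a‖ₑ * p v) {x : X} (hx : x ∈ Y)
    {n : ℕ} (ℓ : Fin n → X →ₗ[ℝ] ℝ) {M : Submodule ℝ X} (hM : M ≤ Y)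
    (hxM : ∀ δ > 0, ∃ m ∈ M, p (x - m) ≤ δ) :
    ∃ m : ℕ → X, (∀ k, m k ∈ M) ∧ Tendsto (fun k => p (x - m k)) atTop (𝓝 0) ∧
      ∀ i, ∃ y, Tendsto (fun k => ℓ i (m k)) atTop (𝓝 y) := by
  induction n generalizing M with
  | zero =>
    have h : ∀ k : ℕ, ∃ m ∈ M, p (x - m) ≤ ((k : ℝ≥0∞) + 1)⁻¹ := fun k => hxM _ (by simp)
    choose m hm hm' using h
    refine ⟨m, hm, tendsto_of_tendsto_of_tendsto_of_le_of_le tendsto_const_nhds ?_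
      (fun _ => zero_le) hm', fun i => i.elim0⟩
    have := (tendsto_add_atTop_iff_nat 1).2 ENNReal.tendsto_inv_nat_nhds_zero
    simpa using this
  | succ n ih =>
    by_cases hb : ∃ δ > 0, ∀ m ∈ M, p m ≤ δ → ‖ℓ (Fin.last n) m‖ ≤ 1
    · -- a bounded functional maps the sequence to a Cauchy sequence
      obtain ⟨δ, hδ, hb⟩ := hb
      obtain ⟨m, hm, hlim, hy⟩ := ih (fun i => ℓ i.castSucc) hM hxM
      refine ⟨m, hm, hlim, fun i => ?_⟩
      refine Fin.lastCases ?_ (fun j => hy j) i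
      have hC : CauchySeq fun k => ℓ (Fin.last n) (m k) := by
        refine Metric.cauchySeq_iff'.2 fun e he => ?_
        -- a linear functional that is bounded on a ball is bounded on small balls accordingly
        have hpos : 0 < δ / ‖(e / 2)⁻¹‖ₑ / 2 :=
          ENNReal.half_pos (ENNReal.div_pos hδ.ne' (by simp)).ne'
        obtain ⟨N, hN⟩ := (ENNReal.tendsto_atTop_zero.1 hlim) _ hpos
        refine ⟨N, fun k hk => ?_⟩
        have h1 : p (m k - m N) ≤ δ / ‖(e / 2)⁻¹‖ₑ := by
          have h2 := hp (x - m N) (Y.sub_mem hx (hM (hm N))) (x - m k)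
            (Y.sub_mem hx (hM (hm k))) 1
          rw [one_smul, sub_sub_sub_cancel_left] at h2
          refine h2.trans ?_
          rw [enorm_one, one_mul, ← ENNReal.add_halves (δ / _)]
          exact add_le_add (hN N le_rfl) (hN k hk)
        have h3 : p ((e / 2)⁻¹ • (m k - m N)) ≤ δ := by
          have h4 := hp 0 Y.zero_mem (m k - m N) (Y.sub_mem (hM (hm k)) (hM (hm N))) (-(e / 2)⁻¹)
          rw [neg_smul, zero_sub, neg_neg, hp0, zero_add, enorm_neg] at h4
          exact h4.trans ((mul_le_mul_right h1 _).trans ENNReal.mul_div_le)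
        have h5 := hb _ (M.smul_mem _ (M.sub_mem (hm k) (hm N))) h3
        rw [map_smul, map_sub, norm_smul, norm_inv, Real.norm_of_nonneg (by positivity)] at h5
        rw [dist_eq_norm]
        have h6 : (e / 2)⁻¹ * ‖ℓ (Fin.last n) (m k) - ℓ (Fin.last n) (m N)‖ ≤ 1 := h5
        rw [inv_mul_le_iff₀ (by positivity)] at h6
        linarith
      exact cauchySeq_tendsto_of_complete hC
    · -- an unbounded functional takes a large value at a small element `z`, and a small multiple
      -- of `z` moves `m` into the kernel; the other functionals are treated on the kernel
      push Not at hb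
      have hker : ∀ δ > 0, ∃ m ∈ M ⊓ LinearMap.ker (ℓ (Fin.last n)), p (x - m) ≤ δ := by
        intro δ hδ
        obtain ⟨m, hm, hm'⟩ := hxM (δ / 2) (ENNReal.half_pos hδ.ne')
        set a := ℓ (Fin.last n) m with ha
        obtain ⟨z, hz, hz', hz1⟩ := hb (δ / 2 / (‖a‖ₑ + 1))
          (ENNReal.div_pos (ENNReal.half_pos hδ.ne').ne' (by simp))
        have hz0 : ℓ (Fin.last n) z ≠ 0 := fun h => by
          rw [h, norm_zero] at hz1
          linarith
        set b := a / ℓ (Fin.last n) z with hb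
        refine ⟨m - b • z, ⟨M.sub_mem hm (M.smul_mem _ hz), ?_⟩, ?_⟩
        · rw [SetLike.mem_coe, LinearMap.mem_ker, map_sub, map_smul, smul_eq_mul, ← ha, hb,
            div_mul_cancel₀ _ hz0, sub_self]
        · have h1 := hp (x - m) (Y.sub_mem hx (hM hm)) z (hM hz) (-b)
          have h2 : x - m - -b • z = x - (m - b • z) := by
            rw [neg_smul]
            abel
          rw [h2, enorm_neg] at h1
          refine h1.trans ?_
          rw [← ENNReal.add_halves δ]
          refine add_le_add hm' ?_
          have h3 : ‖b‖ₑ ≤ ‖a‖ₑ + 1 := by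
            refine le_trans ?_ le_self_add
            rw [← ofReal_norm, ← ofReal_norm]
            refine ENNReal.ofReal_le_ofReal ?_
            rw [hb, norm_div]
            exact div_le_self (norm_nonneg _) hz1.le
          exact (mul_le_mul' h3 hz').trans ENNReal.mul_div_le
      obtain ⟨m, hm, hlim, hy⟩ := ih (fun i => ℓ i.castSucc) (inf_le_left.trans hM) hker
      refine ⟨m, fun k => (hm k).1, hlim, fun i => ?_⟩
      refine Fin.lastCases ⟨0, ?_⟩ (fun j => hy j) i
      have : ∀ k, ℓ (Fin.last n) (m k) = 0 := fun k => (hm k).2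
      simp only [this]
      exact tendsto_const_nhds

/-! ### The Poincaré inequality -/

theorem lintegral_comp_smul_add_le {l : ℝ} (hl : l ≠ 0) (b : E3) {S T : Set E3}
    (hS : MeasurableSet S) (hT : MeasurableSet T) (hST : ∀ x ∈ S, l • x + b ∈ T)
    (G : E3 → ℝ≥0∞) :
    ∫⁻ x in S, G (l • x + b) ≤ ENNReal.ofReal |(l ^ 3)⁻¹| * ∫⁻ x in T, G x := by
  have h := lintegral_comp_smul_add volume hl b (T.indicator G)
  rw [finrank_euclideanSpace_fin] at h
  rw [← lintegral_indicator hT, ← h, ← lintegral_indicator hS]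
  refine lintegral_mono fun x => ?_
  by_cases hx : x ∈ S
  · rw [indicator_of_mem hx, indicator_of_mem (hST x hx)]
  · rw [indicator_of_notMem hx]
    exact zero_le

theorem enorm_gradient (f : E3 → ℝ) (x : E3) : ‖gradient f x‖ₑ = ‖fderiv ℝ f x‖ₑ := by
  rw [gradient, LinearIsometryEquiv.enorm_map]

/-- The fundamental theorem of calculus on a segment, combined with Jensen's inequality. -/
theorem enorm_sub_sq_le_lintegral {f : E3 → ℝ} (hf : ContDiff ℝ 1 f) (x y : E3) :
    ‖f x - f y‖ₑ ^ 2
      ≤ ‖x - y‖ₑ ^ 2 * ∫⁻ t in Ioo (0 : ℝ) 1, ‖gradient f ((1 - t) • x + t • y)‖ₑ ^ 2 := by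
  have h := integral_radial hf (w := fun _ => 1) (w' := fun _ => 0)
    (fun t => hasDerivAt_const t _) continuous_const x (y - x)
  simp only [zero_mul, one_mul, zero_add, add_sub_cancel] at h
  have hc : Continuous fun t : ℝ => fderiv ℝ f (x + t • (y - x)) (y - x) :=
    ((hf.continuous_fderiv (by norm_num)).comp (by fun_prop)).clm_apply continuous_const
  have : IsProbabilityMeasure ((volume : Measure ℝ).restrict (Ioo 0 1)) := ⟨by simp⟩
  rw [← enorm_neg, neg_sub, ← h]
  calc ‖∫ t in Ioo (0 : ℝ) 1, fderiv ℝ f (x + t • (y - x)) (y - x)‖ₑ ^ 2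
      ≤ (∫⁻ t in Ioo (0 : ℝ) 1, ‖fderiv ℝ f (x + t • (y - x)) (y - x)‖ₑ) ^ 2 := by
        gcongr
        exact enorm_integral_le_lintegral_enorm _
    _ ≤ ∫⁻ t in Ioo (0 : ℝ) 1, ‖fderiv ℝ f (x + t • (y - x)) (y - x)‖ₑ ^ 2 :=
        lintegral_sq_le hc.enorm.aemeasurable
    _ ≤ ∫⁻ t in Ioo (0 : ℝ) 1, ‖x - y‖ₑ ^ 2 * ‖gradient f ((1 - t) • x + t • y)‖ₑ ^ 2 := by
        refine lintegral_mono fun t => ?_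
        have h1 : (1 - t) • x + t • y = x + t • (y - x) := by
          rw [smul_sub, sub_smul, one_smul]
          abel
        beta_reduce
        rw [h1, enorm_gradient, ← mul_pow, mul_comm, ← enorm_neg (x - y), neg_sub]
        gcongr
        exact ContinuousLinearMap.le_opENorm _ _
    _ = _ := by
        rw [lintegral_const_mul' _ _ (by simp)]

/-- A Poincaré inequality for differences on a domain that is star-shaped with respect to a ball.
Along the segment from `x` to `y`, integration over the point that is further away from the current
point costs at most the factor `8 = 2³`. -/
theorem IsStarBall.lintegral_lintegral_enorm_sub_sq_le {K : Set E3} {x₀ : E3} {r h : ℝ}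
    (hK : IsStarBall K x₀ r) (hh : ∀ x ∈ K, ∀ y ∈ K, dist x y ≤ h) {f : E3 → ℝ}
    (hf : ContDiff ℝ 1 f) :
    ∫⁻ x in K, ∫⁻ y in Metric.ball x₀ r, ‖f x - f y‖ₑ ^ 2
      ≤ ENNReal.ofReal (8 * h ^ 2) * volume K * ∫⁻ x in K, ‖gradient f x‖ₑ ^ 2 := by
  set B := Metric.ball x₀ r with hB
  set G : E3 → ℝ≥0∞ := fun x => ‖gradient f x‖ₑ ^ 2 with hG
  have hKm := hK.isOpen.measurableSet
  have hBm : MeasurableSet B := Metric.isOpen_ball.measurableSet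
  have hGm : Measurable G := ((continuous_gradient hf).enorm.measurable).pow_const 2
  have hBK : B ⊆ K := fun y hy => hK.mem_of_mem_ball hy
  have hseg : ∀ x ∈ K, ∀ y ∈ B, ∀ t ∈ Ioo (0 : ℝ) 1, (1 - t) • x + t • y ∈ K :=
    fun x hx y hy t ht => hK.combo_mem (subset_closure hx) hy ht.1 ht.2.le
  have hm : Measurable fun q : (E3 × E3) × ℝ => G ((1 - q.2) • q.1.1 + q.2 • q.1.2) :=
    hGm.comp (by fun_prop)
  have h0 : 0 ≤ h := by
    have := hh x₀ hK.center_mem x₀ hK.center_mem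
    rwa [dist_self] at this
  -- the bound for a fixed position `t` on the segment
  have key : ∀ t ∈ Ioo (0 : ℝ) 1, ∫⁻ x in K, ∫⁻ y in B, G ((1 - t) • x + t • y)
      ≤ 8 * volume K * ∫⁻ x in K, G x := by
    intro t ht
    have h8 : ∀ l : ℝ, 1 / 2 ≤ l → ENNReal.ofReal |(l ^ 3)⁻¹| ≤ 8 := by
      intro l hl
      have hl3 : (1 / 8 : ℝ) ≤ l ^ 3 := by
        have := pow_le_pow_left₀ (by norm_num) hl 3
        norm_num at this ⊢
        exact this
      rw [abs_of_nonneg (by positivity)]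
      have : (l ^ 3)⁻¹ ≤ 8 := by
        rw [inv_le_comm₀ (by positivity) (by norm_num)]
        norm_num at hl3 ⊢
        exact hl3
      calc ENNReal.ofReal (l ^ 3)⁻¹ ≤ ENNReal.ofReal 8 := ENNReal.ofReal_le_ofReal this
        _ = 8 := by simp
    -- for `t ≤ 1 / 2` the integration is over `x` first, and otherwise over `y`, so that the ratio
    -- of the change of variables is at least `1 / 2`
    rcases le_total t (1 / 2) with h2 | h2
    · rw [lintegral_lintegral_swap (by
        refine Measurable.aemeasurable ?_
        exact hGm.comp (by fun_prop))]
      calc ∫⁻ y in B, ∫⁻ x in K, G ((1 - t) • x + t • y)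
          ≤ ∫⁻ y in B, 8 * ∫⁻ x in K, G x := by
            refine setLIntegral_mono' hBm fun y hy => ?_
            refine (lintegral_comp_smul_add_le (by linarith [ht.2]) _ hKm hKm
              (fun x hx => hseg x hx y hy t ht) G).trans ?_
            gcongr
            exact h8 _ (by linarith)
        _ = 8 * volume B * ∫⁻ x in K, G x := by
            rw [setLIntegral_const]
            ring
        _ ≤ _ := by gcongr
    · calc ∫⁻ x in K, ∫⁻ y in B, G ((1 - t) • x + t • y)
          ≤ ∫⁻ x in K, 8 * ∫⁻ x in K, G x := by
            refine setLIntegral_mono' hKm fun x hx => ?_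
            simp only [add_comm ((1 - t) • x)]
            refine (lintegral_comp_smul_add_le ht.1.ne' _ hBm hKm
              (fun y hy => by rw [add_comm]; exact hseg x hx y hy t ht) G).trans ?_
            gcongr
            exact h8 _ (by linarith)
        _ = _ := by
            rw [setLIntegral_const]
            ring
  calc ∫⁻ x in K, ∫⁻ y in B, ‖f x - f y‖ₑ ^ 2
      ≤ ∫⁻ x in K, ∫⁻ y in B, ENNReal.ofReal (h ^ 2) *
          ∫⁻ t in Ioo (0 : ℝ) 1, G ((1 - t) • x + t • y) := by
        refine setLIntegral_mono' hKm fun x hx => setLIntegral_mono' hBm fun y hy => ?_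
        refine (enorm_sub_sq_le_lintegral hf x y).trans ?_
        gcongr
        rw [← edist_eq_enorm_sub, edist_dist, ← ENNReal.ofReal_pow dist_nonneg]
        gcongr
        exact hh x hx y (hBK hy)
    _ = ENNReal.ofReal (h ^ 2) * ∫⁻ x in K, ∫⁻ y in B,
          ∫⁻ t in Ioo (0 : ℝ) 1, G ((1 - t) • x + t • y) := by
        simp only [lintegral_const_mul' _ _ ENNReal.ofReal_ne_top]
    _ = ENNReal.ofReal (h ^ 2) * ∫⁻ t in Ioo (0 : ℝ) 1, ∫⁻ x in K, ∫⁻ y in B,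
          G ((1 - t) • x + t • y) := by
        congr 1
        have h1 : ∀ x, ∫⁻ y in B, ∫⁻ t in Ioo (0 : ℝ) 1, G ((1 - t) • x + t • y)
            = ∫⁻ t in Ioo (0 : ℝ) 1, ∫⁻ y in B, G ((1 - t) • x + t • y) := fun x =>
          lintegral_lintegral_swap (by
            refine Measurable.aemeasurable ?_
            exact hGm.comp (by fun_prop))
        simp only [h1]
        refine lintegral_lintegral_swap (Measurable.aemeasurable ?_)
        refine Measurable.lintegral_prod_right' (f := fun q : (E3 × ℝ) × E3 =>
          G ((1 - q.1.2) • q.1.1 + q.1.2 • q.2)) ?_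
        exact hGm.comp (by fun_prop)
    _ ≤ ENNReal.ofReal (h ^ 2) * ∫⁻ t in Ioo (0 : ℝ) 1, 8 * volume K * ∫⁻ x in K, G x := by
        gcongr 1
        exact setLIntegral_mono' measurableSet_Ioo key
    _ = _ := by
        rw [setLIntegral_const, ENNReal.ofReal_mul (by norm_num)]
        simp
        ring

/-- Jensen's inequality for the difference of a number and a mean value. -/
theorem enorm_sub_average_sq_le {B : Set E3} (hB0 : volume B ≠ 0) (hB1 : volume B ≠ ⊤)
    {f : E3 → ℝ} (hf : IntegrableOn f B) (a : ℝ) :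
    ‖a - ⨍ y in B, f y‖ₑ ^ 2 ≤ (volume B)⁻¹ * ∫⁻ y in B, ‖a - f y‖ₑ ^ 2 := by
  have hne : NeZero ((volume : Measure E3).restrict B) :=
    ⟨fun h => hB0 (by simpa using congrArg (fun μ : Measure E3 => μ univ) h)⟩
  have hfin : IsFiniteMeasure ((volume : Measure E3).restrict B) := ⟨by simpa using hB1.lt_top⟩
  set ν : Measure E3 := (volume.restrict B univ)⁻¹ • volume.restrict B with hν
  have hprob : IsProbabilityMeasure ν := by
    rw [hν]
    infer_instance
  have hfν : Integrable f ν := hf.smul_measure (by simpa using hB0)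
  have h1 : a - ⨍ y in B, f y = ∫ y, (a - f y) ∂ν := by
    rw [integral_sub (integrable_const a) hfν, integral_const]
    simp only [average, probReal_univ, one_smul]
    rfl
  have h2 : (volume B)⁻¹ * ∫⁻ y in B, ‖a - f y‖ₑ ^ 2 = ∫⁻ y, ‖a - f y‖ₑ ^ 2 ∂ν := by
    rw [hν, lintegral_smul_measure, Measure.restrict_apply_univ, smul_eq_mul]
  rw [h1, h2]
  calc ‖∫ y, (a - f y) ∂ν‖ₑ ^ 2 ≤ (∫⁻ y, ‖a - f y‖ₑ ∂ν) ^ 2 := by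
        gcongr
        exact enorm_integral_le_lintegral_enorm _
    _ ≤ _ := lintegral_sq_le ((integrable_const a).sub hfν).1.enorm

theorem eLpNorm_sub_average_sq_le {B K : Set E3} (hB0 : volume B ≠ 0) (hB1 : volume B ≠ ⊤)
    {f : E3 → ℝ} (hf : IntegrableOn f B) :
    eLpNorm (fun x => f x - ⨍ y in B, f y) 2 (volume.restrict K) ^ 2
      ≤ (volume B)⁻¹ * ∫⁻ x in K, ∫⁻ y in B, ‖f x - f y‖ₑ ^ 2 := by
  rw [eLpNorm_two_sq, ← lintegral_const_mul' _ _ (ENNReal.inv_ne_top.2 hB0)]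
  exact lintegral_mono fun x => enorm_sub_average_sq_le hB0 hB1 hf (f x)

/-- A difference over a distance of at most `t`, in terms of the integrand of the Gagliardo
seminorm. -/
theorem enorm_sub_sq_le_mul_div (φ : E3 → ℝ) {x y : E3} {t s : ℝ} (hs : 0 < s)
    (hxy : dist x y ≤ t) : ‖φ x - φ y‖ₑ ^ 2
      ≤ ENNReal.ofReal (t ^ (3 + 2 * s)) * (‖φ x - φ y‖ₑ ^ 2 / edist x y ^ (3 + 2 * s)) := by
  rcases eq_or_ne x y with rfl | hne
  · simp
  have h0 : edist x y ^ (3 + 2 * s) ≠ 0 := by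
    rw [Ne, ENNReal.rpow_eq_zero_iff]
    simp [hne, edist_ne_top]
  have h1 : edist x y ^ (3 + 2 * s) ≠ ⊤ :=
    ENNReal.rpow_ne_top_of_nonneg (by positivity) (edist_ne_top _ _)
  calc ‖φ x - φ y‖ₑ ^ 2 = edist x y ^ (3 + 2 * s) *
        (‖φ x - φ y‖ₑ ^ 2 / edist x y ^ (3 + 2 * s)) := (ENNReal.mul_div_cancel h0 h1).symm
    _ ≤ _ := by
      gcongr
      rw [edist_dist, ENNReal.ofReal_rpow_of_nonneg dist_nonneg (by positivity)]
      exact ENNReal.ofReal_le_ofReal (Real.rpow_le_rpow dist_nonneg hxy (by positivity))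

namespace IsStarBall

variable {K : Set E3} {x₀ : E3} {r h a : ℝ}

theorem ball_subset_self (hK : IsStarBall K x₀ r) : Metric.ball x₀ r ⊆ K :=
  fun _ hy => hK.mem_of_mem_ball hy

theorem volume_le (hK : IsStarBall K x₀ r) (hh : ∀ x ∈ K, ∀ y ∈ K, dist x y ≤ h) :
    volume K ≤ ENNReal.ofReal (5 * h ^ 3) := by
  have h0 : 0 ≤ h := by
    have := hh x₀ hK.center_mem x₀ hK.center_mem
    rwa [dist_self] at this
  have h1 : K ⊆ Metric.closedBall x₀ h := fun x hx => hh x hx x₀ hK.center_mem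
  refine (measure_mono h1).trans ?_
  rw [EuclideanSpace.volume_closedBall_fin_three, ← ENNReal.ofReal_pow h0,
    ← ENNReal.ofReal_mul (by positivity)]
  refine ENNReal.ofReal_le_ofReal ?_
  have : 0 ≤ h ^ 3 := by positivity
  nlinarith [Real.pi_lt_d2]

theorem le_volume_ball (ha : 0 < a) (hpos : 0 < h) (har : a * h ≤ r) :
    ENNReal.ofReal (4 * (a * h) ^ 3) ≤ volume (Metric.ball x₀ r) := by
  have h0 : 0 < a * h := by positivity
  rw [EuclideanSpace.volume_ball_fin_three, ← ENNReal.ofReal_pow (h0.le.trans har),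
    ← ENNReal.ofReal_mul (pow_nonneg (h0.le.trans har) _)]
  refine ENNReal.ofReal_le_ofReal ?_
  have h1 : (a * h) ^ 3 ≤ r ^ 3 := pow_le_pow_left₀ h0.le har 3
  have h2 : 0 < r ^ 3 := pow_pos (h0.trans_le har) 3
  nlinarith [Real.pi_gt_three]

theorem volume_ball_ne_zero (hK : IsStarBall K x₀ r) : volume (Metric.ball x₀ r) ≠ 0 :=
  (Metric.measure_ball_pos _ _ hK.r_pos).ne'

/-- The Poincaré inequality in `H¹(K)` for functions smooth up to the boundary. -/
theorem poincare_smooth (hK : IsStarBall K x₀ r) (hh : ∀ x ∈ K, ∀ y ∈ K, dist x y ≤ h)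
    (ha : 0 < a) (hpos : 0 < h) (har : a * h ≤ r) {f : E3 → ℝ} (hf : ContDiff ℝ 1 f) :
    eLpNorm (fun x => f x - ⨍ y in Metric.ball x₀ r, f y) 2 (volume.restrict K) ^ 2
      ≤ ENNReal.ofReal (10 / a ^ 3 * h ^ 2) * eLpNorm (gradient f) 2 (volume.restrict K) ^ 2 := by
  refine (eLpNorm_sub_average_sq_le hK.volume_ball_ne_zero measure_ball_lt_top.ne
    ((hK.integrableOn_of_continuous hf.continuous).mono_set hK.ball_subset_self)).trans ?_
  rw [eLpNorm_two_sq (gradient f)]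
  calc (volume (Metric.ball x₀ r))⁻¹ * ∫⁻ x in K, ∫⁻ y in Metric.ball x₀ r, ‖f x - f y‖ₑ ^ 2
      ≤ (ENNReal.ofReal (4 * (a * h) ^ 3))⁻¹ * (ENNReal.ofReal (8 * h ^ 2)
        * ENNReal.ofReal (5 * h ^ 3) * ∫⁻ x in K, ‖gradient f x‖ₑ ^ 2) := by
        gcongr
        · exact le_volume_ball ha hpos har
        · refine (hK.lintegral_lintegral_enorm_sub_sq_le hh hf).trans ?_
          gcongr
          exact hK.volume_le hh
    _ = _ := by
        rw [← ENNReal.ofReal_inv_of_pos (by positivity), ← ENNReal.ofReal_mul (by positivity),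
          ← mul_assoc, ← ENNReal.ofReal_mul (by positivity)]
        congr 2
        field_simp
        norm_num

/-- For `s < 1` the Poincaré inequality needs no smoothness: the distance of two points of `K` is
at most `h`, so that the kernel of the Gagliardo seminorm is bounded below. -/
theorem poincare_fractional (hK : IsStarBall K x₀ r) (hh : ∀ x ∈ K, ∀ y ∈ K, dist x y ≤ h)
    (ha : 0 < a) (hpos : 0 < h) (har : a * h ≤ r) {s : ℝ} (hs : 0 < s) {f : E3 → ℝ}
    (hf : IntegrableOn f K) :
    eLpNorm (fun x => f x - ⨍ y in Metric.ball x₀ r, f y) 2 (volume.restrict K) ^ 2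
      ≤ ENNReal.ofReal (10 / a ^ 3 * h ^ (2 * s)) * gagliardo K s f ^ 2 := by
  refine (eLpNorm_sub_average_sq_le hK.volume_ball_ne_zero measure_ball_lt_top.ne
    (hf.mono_set hK.ball_subset_self)).trans ?_
  have hKm := hK.isOpen.measurableSet
  have hg : gagliardo K s f ^ 2
      = ∫⁻ x in K, ∫⁻ y in K, ‖f x - f y‖ₑ ^ 2 / edist x y ^ (3 + 2 * s) := by
    rw [gagliardo, ← ENNReal.rpow_natCast, ← ENNReal.rpow_mul]
    simp
  rw [hg]
  calc (volume (Metric.ball x₀ r))⁻¹ * ∫⁻ x in K, ∫⁻ y in Metric.ball x₀ r, ‖f x - f y‖ₑ ^ 2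
      ≤ (ENNReal.ofReal (4 * (a * h) ^ 3))⁻¹ * (ENNReal.ofReal (h ^ (3 + 2 * s)) *
        ∫⁻ x in K, ∫⁻ y in K, ‖f x - f y‖ₑ ^ 2 / edist x y ^ (3 + 2 * s)) := by
        gcongr
        · exact le_volume_ball ha hpos har
        · rw [← lintegral_const_mul' _ _ ENNReal.ofReal_ne_top]
          refine setLIntegral_mono' hKm fun x hx => ?_
          rw [← lintegral_const_mul' _ _ ENNReal.ofReal_ne_top]
          refine (lintegral_mono_set hK.ball_subset_self).trans ?_
          exact setLIntegral_mono' hKm fun y hy => enorm_sub_sq_le_mul_div f hs (hh x hx y hy)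
    _ ≤ _ := by
        rw [← ENNReal.ofReal_inv_of_pos (by positivity), ← mul_assoc,
          ← ENNReal.ofReal_mul (by positivity)]
        gcongr ENNReal.ofReal ?_ * _
        rw [Real.rpow_add hpos]
        have h3 : h ^ (3 : ℝ) = h ^ 3 := by exact_mod_cast Real.rpow_natCast h 3
        have h4 : 0 < h ^ (2 * s) := Real.rpow_pos_of_pos hpos _
        rw [h3]
        have h5 : (4 * (a * h) ^ 3)⁻¹ * (h ^ 3 * h ^ (2 * s)) = 1 / 4 / a ^ 3 * h ^ (2 * s) := by
          field_simp
        rw [h5]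
        gcongr
        norm_num

theorem integrableOn_of_memLp (hK : IsStarBall K x₀ r) {F : Type*} [NormedAddCommGroup F]
    {f : E3 → F} (hf : MemLp f 2 (volume.restrict K)) : IntegrableOn f K := by
  have := hK.isFiniteMeasure
  exact hf.integrable (by norm_num)

theorem memLp_of_continuous (hK : IsStarBall K x₀ r) {F : Type*} [NormedAddCommGroup F]
    [SecondCountableTopologyEither E3 F] {f : E3 → F} (hf : Continuous f) :
    MemLp f 2 (volume.restrict K) := by
  have := hK.isFiniteMeasure
  refine MemLp.of_bound (C := sSup ((fun x => ‖f x‖) '' closure K)) hf.aestronglyMeasurable ?_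
  filter_upwards [ae_restrict_mem hK.isOpen.measurableSet] with x hx
  exact le_csSup (hK.isCompact_closure.image hf.norm).bddAbove ⟨x, subset_closure hx, rfl⟩

/-- Subtraction of the mean over the ball is bounded in `L²(K)`. The constant may depend on the
domain, as it is only used for a passage to the limit. -/
theorem eLpNorm_sub_average_le (hK : IsStarBall K x₀ r) {f : E3 → ℝ}
    (hf : MemLp f 2 (volume.restrict K)) :
    eLpNorm (fun x => f x - ⨍ y in Metric.ball x₀ r, f y) 2 (volume.restrict K)
      ≤ (1 + ((volume (Metric.ball x₀ r))⁻¹ * volume K) ^ (1 / 2 : ℝ))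
        * eLpNorm f 2 (volume.restrict K) := by
  have h1 := eLpNorm_sub_le hf.1 (aestronglyMeasurable_const (b := ⨍ y in Metric.ball x₀ r, f y))
    (p := 2) (by norm_num)
  refine h1.trans ?_
  rw [add_mul, one_mul]
  gcongr
  have h2 := enorm_sub_average_sq_le hK.volume_ball_ne_zero measure_ball_lt_top.ne
    ((hK.integrableOn_of_memLp hf).mono_set hK.ball_subset_self) 0
  simp only [zero_sub, enorm_neg] at h2
  rw [eLpNorm_two_eq, eLpNorm_two_eq, ← ENNReal.mul_rpow_of_nonneg _ _ (by norm_num)]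
  gcongr
  rw [setLIntegral_const, mul_assoc, mul_comm (volume K), ← mul_assoc]
  gcongr
  refine h2.trans ?_
  gcongr
  exact hK.ball_subset_self

/-- The **Poincaré inequality** in `H^s(K)`, with a constant that only depends on the ratio of `h`
and the radius of the ball. -/
theorem poincare (hK : IsStarBall K x₀ r) (hh : ∀ x ∈ K, ∀ y ∈ K, dist x y ≤ h)
    (ha : 0 < a) (hpos : 0 < h) (har : a * h ≤ r) {s : ℝ} (hs : 0 < s) (hs1 : s ≤ 1) {f : E3 → ℝ}
    (hf : MemHs K s f) :
    eLpNorm (fun x => f x - ⨍ y in Metric.ball x₀ r, f y) 2 (volume.restrict K)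
      ≤ ENNReal.ofReal (√(10 / a ^ 3) * h ^ s) * hSeminorm K s f := by
  have hsq : ∀ {t : ℝ} {A B : ℝ≥0∞}, A ^ 2 ≤ ENNReal.ofReal (10 / a ^ 3 * h ^ (2 * t)) * B ^ 2 →
      A ≤ ENNReal.ofReal (√(10 / a ^ 3) * h ^ t) * B := by
    intro t A B hAB
    have h1 : ENNReal.ofReal (10 / a ^ 3 * h ^ (2 * t))
        = ENNReal.ofReal (√(10 / a ^ 3) * h ^ t) ^ 2 := by
      rw [← ENNReal.ofReal_pow (by positivity), mul_pow, Real.sq_sqrt (by positivity),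
        mul_comm 2 t, Real.rpow_mul hpos.le]
      norm_num
    rw [h1, ← mul_pow] at hAB
    exact (ENNReal.pow_le_pow_left_iff (by norm_num)).1 hAB
  rcases hs1.lt_or_eq with h1 | rfl
  · rw [hSeminorm_of_lt_one K hs h1]
    exact hsq (hK.poincare_fractional hh ha hpos har hs (hK.integrableOn_of_memLp hf.1))
  -- for `s = 1` the smooth case is applied to smoothed functions
  obtain ⟨A⟩ := hK.exists_smoothingSeq
  set B := Metric.ball x₀ r with hB
  set C := ENNReal.ofReal (√(10 / a ^ 3) * h ^ (1 : ℝ)) with hC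
  set C' := 1 + ((volume (Metric.ball x₀ r))⁻¹ * volume K) ^ (1 / 2 : ℝ) with hC'
  have hfl := locallyIntegrableOn_of_memLp hK.isOpen hf.1
  have hfin : hSeminorm K 1 f < ⊤ := (hSeminorm_le_hNorm K 1 f).trans_lt hf.2
  have hsm : ∀ n, ContDiff ℝ 1 ((A.D n).op f) := fun n =>
    contDiff_infty.1 ((A.D n).contDiff_op hfl) 1
  have hopm : ∀ n, MemLp ((A.D n).op f) 2 (volume.restrict K) := fun n =>
    hK.memLp_of_continuous (hsm n).continuous
  have hbound : ∀ n, eLpNorm (fun x => f x - ⨍ y in B, f y) 2 (volume.restrict K)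
      ≤ C * (hSeminorm K 1 f + hSeminorm K 1 (fun x => f x - (A.D n).op f x))
        + C' * eLpNorm (fun x => f x - 1 * (A.D n).op f x) 2 (volume.restrict K) := by
    intro n
    set g := (A.D n).op f with hg
    have hgl : LocallyIntegrableOn g K volume := locallyIntegrableOn_of_memLp hK.isOpen (hopm n)
    have hfg : MemLp (fun x => f x - g x) 2 (volume.restrict K) := hf.1.sub (hopm n)
    have h1 : eLpNorm (fun x => g x - ⨍ y in B, g y) 2 (volume.restrict K)
        ≤ C * (hSeminorm K 1 f + hSeminorm K 1 (fun x => f x - g x)) := by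
      have h2 := hSeminorm_sub_const_mul_le 1 hfl (hfl.sub hgl) 1
      simp only [Pi.sub_apply, one_mul, sub_sub_cancel, enorm_one] at h2
      refine le_trans ?_ (mul_le_mul_right h2 C)
      rw [hSeminorm_one_eq hK.isOpen (hasWeakGradient_of_contDiff hK.isOpen (hsm n))]
      refine hsq ?_
      have := hK.poincare_smooth hh ha hpos har (hsm n)
      norm_num
      exact this
    have h3 := hK.eLpNorm_sub_average_le hfg
    have h4 : (fun x => f x - ⨍ y in B, f y) = (fun x => g x - ⨍ y in B, g y)
        + fun x => (f x - g x) - ⨍ y in B, (f y - g y) := by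
      have h5 : ⨍ y in B, (f y - g y) = (⨍ y in B, f y) - ⨍ y in B, g y := by
        rw [setAverage_eq, setAverage_eq, setAverage_eq,
          integral_sub ((hK.integrableOn_of_memLp hf.1).mono_set hK.ball_subset_self)
            ((hK.integrableOn_of_memLp (hopm n)).mono_set hK.ball_subset_self), smul_sub]
      funext x
      rw [Pi.add_apply, h5]
      ring
    rw [h4]
    refine (eLpNorm_add_le ((hopm n).1.sub aestronglyMeasurable_const)
      (hfg.1.sub aestronglyMeasurable_const) (by norm_num)).trans ?_
    simp only [one_mul]
    exact add_le_add h1 h3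
  have hC'top : C' ≠ ⊤ := by
    refine ENNReal.add_ne_top.2 ⟨ENNReal.one_ne_top, ENNReal.rpow_ne_top_of_nonneg (by norm_num) ?_⟩
    exact ENNReal.mul_ne_top (ENNReal.inv_ne_top.2 hK.volume_ball_ne_zero) hK.volume_lt_top.ne
  have hlim : Tendsto (fun n => C * (hSeminorm K 1 f + hSeminorm K 1 (fun x => f x - (A.D n).op f x))
        + C' * eLpNorm (fun x => f x - 1 * (A.D n).op f x) 2 (volume.restrict K)) atTop
      (𝓝 (C * (hSeminorm K 1 f + 0) + C' * 0)) := by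
    refine Tendsto.add ?_ ?_
    · refine ENNReal.Tendsto.const_mul (tendsto_const_nhds.add ?_) (Or.inr ENNReal.ofReal_ne_top)
      exact A.tendsto_hSeminorm hK.isOpen hfl hfin
    · exact ENNReal.Tendsto.const_mul (A.tendsto_eLpNorm hK.isOpen hf.1 tendsto_const_nhds)
        (Or.inr hC'top)
  have := ge_of_tendsto' hlim hbound
  simpa using this

end IsStarBall

/-! ### Trace inequalities -/

theorem lintegral_enorm_le_eLpNorm_two {α F : Type*} [MeasurableSpace α] [NormedAddCommGroup F]
    {μ : Measure α} {f : α → F} (hf : AEStronglyMeasurable f μ) :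
    ∫⁻ x, ‖f x‖ₑ ∂μ ≤ μ univ ^ (1 / 2 : ℝ) * eLpNorm f 2 μ := by
  have h := eLpNorm_le_eLpNorm_mul_rpow_measure_univ (p := 1) (q := 2) (by norm_num) hf
  rw [eLpNorm_one_eq_lintegral_enorm, mul_comm] at h
  refine h.trans (le_of_eq ?_)
  congr 2
  norm_num

theorem enorm_sub_integral_le {α : Type*} [MeasurableSpace α] {ν : Measure α}
    [IsProbabilityMeasure ν] {f : α → ℝ} (hf : Integrable f ν) (c : ℝ) :
    ‖c - ∫ y, f y ∂ν‖ₑ ≤ ∫⁻ y, ‖c - f y‖ₑ ∂ν := by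
  have h : c - ∫ y, f y ∂ν = ∫ y, (c - f y) ∂ν := by
    rw [integral_sub (integrable_const c) hf, integral_const]
    simp
  rw [h]
  exact enorm_integral_le_lintegral_enorm _

namespace PolyhedralElement

variable {P : PolyhedralElement} {x₀ : E3} {r h a : ℝ}

/-- The trace inequality in `W^{1,1}(K)`: the heights of the faces are at least `r`, and the cones
over the faces are disjoint. -/
theorem sum_lintegral_face_le (hP : IsStarBall P.K x₀ r) (hh : ∀ x ∈ P.K, ∀ y ∈ P.K, dist x y ≤ h)
    {φ : E3 → ℝ} (hφ : ContDiff ℝ 1 φ) :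
    ∑ i, ∫⁻ u in P.base x₀ i, ‖φ (P.facePt x₀ i u)‖ₑ
      ≤ ENNReal.ofReal r⁻¹ * ∫⁻ x in P.K, (3 * ‖φ x‖ₑ + ENNReal.ofReal h * ‖gradient φ x‖ₑ) := by
  have hr := hP.r_pos
  have h1 : ∀ i, ∫⁻ u in P.base x₀ i, ‖φ (P.facePt x₀ i u)‖ₑ
      ≤ ENNReal.ofReal r⁻¹ * ∫⁻ x in P.faceCone x₀ i, ‖eulerOp x₀ φ x‖ₑ := by
    intro i
    refine le_trans ?_ (mul_le_mul_right (height_mul_lintegral_face_le hP hφ i) _)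
    rw [← mul_assoc, ← ENNReal.ofReal_mul (by positivity)]
    refine le_mul_of_one_le_left zero_le ?_
    rw [ENNReal.one_le_ofReal, inv_mul_eq_div, one_le_div hr]
    exact le_height hP i
  refine (Finset.sum_le_sum fun i _ => h1 i).trans ?_
  rw [← Finset.mul_sum, ← lintegral_eq_sum_faceCone hP]
  gcongr ENNReal.ofReal r⁻¹ * ?_
  refine setLIntegral_mono' P.isOpen.measurableSet fun x hx => ?_
  rw [eulerOp]
  refine (enorm_add_le _ _).trans ?_
  gcongr
  · rw [enorm_mul]
    gcongr
    rw [Real.enorm_of_nonneg (by norm_num)]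
    simp
  · refine (ContinuousLinearMap.le_opENorm _ _).trans ?_
    rw [enorm_gradient, mul_comm]
    gcongr
    rw [← edist_eq_enorm_sub, edist_dist]
    exact ENNReal.ofReal_le_ofReal (hh x hx x₀ hP.center_mem)

/-- The square root of the volume is at most `3 h^(3/2)`. -/
theorem rpow_half_volume_le (hP : IsStarBall P.K x₀ r) (hh : ∀ x ∈ P.K, ∀ y ∈ P.K, dist x y ≤ h)
    (hpos : 0 < h) : volume P.K ^ (1 / 2 : ℝ) ≤ ENNReal.ofReal (3 * (h * √h)) := by
  refine (ENNReal.rpow_le_rpow (hP.volume_le hh) (by norm_num)).trans ?_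
  rw [ENNReal.ofReal_rpow_of_nonneg (by positivity) (by norm_num)]
  refine ENNReal.ofReal_le_ofReal ?_
  rw [← Real.sqrt_eq_rpow]
  refine Real.sqrt_le_iff.2 ⟨by positivity, ?_⟩
  rw [mul_pow, mul_pow, Real.sq_sqrt hpos.le]
  nlinarith [pow_pos hpos 3]

/-- The constant of the trace inequality in `H¹`. -/
def traceConst (a : ℝ) : ℝ := 3 * (3 * √(10 / a ^ 3) + 1) / a

theorem traceConst_pos (ha : 0 < a) : 0 < traceConst a := by
  unfold traceConst
  positivity

/-- The traces of `φ` minus its mean over the ball, in terms of the gradient. -/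
theorem sum_lintegral_face_sub_average_le (hP : IsStarBall P.K x₀ r)
    (hh : ∀ x ∈ P.K, ∀ y ∈ P.K, dist x y ≤ h) (ha : 0 < a) (hpos : 0 < h) (har : a * h ≤ r)
    {φ : E3 → ℝ} (hφ : ContDiff ℝ 1 φ) :
    ∑ i, ∫⁻ u in P.base x₀ i, ‖φ (P.facePt x₀ i u) - ⨍ y in Metric.ball x₀ r, φ y‖ₑ
      ≤ ENNReal.ofReal (traceConst a * (√h * h)) * eLpNorm (gradient φ) 2 (volume.restrict P.K) := by
  set c := ⨍ y in Metric.ball x₀ r, φ y with hc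
  set N := eLpNorm (gradient φ) 2 (volume.restrict P.K) with hN
  have hg : ∀ x, gradient (fun x => φ x - c) x = gradient φ x := fun x => by
    simp only [gradient, fderiv_sub_const]
  have h1 := sum_lintegral_face_le hP hh (hφ.sub (contDiff_const (c := c)))
  simp only [hg] at h1
  have hφc := hφ.continuous
  have hgc := continuous_gradient hφ
  have h2 : eLpNorm (fun x => φ x - c) 2 (volume.restrict P.K)
      ≤ ENNReal.ofReal (√(10 / a ^ 3) * h) * N := by
    have := hP.poincare_smooth hh ha hpos har hφ
    rw [← Real.sq_sqrt (show (0 : ℝ) ≤ 10 / a ^ 3 by positivity), ← mul_pow,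
      ENNReal.ofReal_pow (by positivity), ← mul_pow] at this
    exact (ENNReal.pow_le_pow_left_iff (by norm_num)).1 this
  have h3 : ∫⁻ x in P.K, ‖φ x - c‖ₑ ≤ ENNReal.ofReal (3 * (h * √h)) *
      (ENNReal.ofReal (√(10 / a ^ 3) * h) * N) := by
    refine (lintegral_enorm_le_eLpNorm_two (by fun_prop)).trans ?_
    rw [Measure.restrict_apply_univ]
    exact mul_le_mul' (rpow_half_volume_le hP hh hpos) h2
  have h4 : ∫⁻ x in P.K, ‖gradient φ x‖ₑ ≤ ENNReal.ofReal (3 * (h * √h)) * N := by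
    refine (lintegral_enorm_le_eLpNorm_two (by fun_prop)).trans ?_
    rw [Measure.restrict_apply_univ]
    exact mul_le_mul' (rpow_half_volume_le hP hh hpos) le_rfl
  refine h1.trans ?_
  rw [lintegral_add_left (by fun_prop), lintegral_const_mul' _ _ (by norm_num),
    lintegral_const_mul' _ _ ENNReal.ofReal_ne_top]
  calc ENNReal.ofReal r⁻¹ * ((3 * ∫⁻ x in P.K, ‖φ x - c‖ₑ)
        + ENNReal.ofReal h * ∫⁻ x in P.K, ‖gradient φ x‖ₑ)
      ≤ ENNReal.ofReal (a * h)⁻¹ * (ENNReal.ofReal 3 * (ENNReal.ofReal (3 * (h * √h)) *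
        (ENNReal.ofReal (√(10 / a ^ 3) * h) * N))
        + ENNReal.ofReal h * (ENNReal.ofReal (3 * (h * √h)) * N)) := by
        gcongr
        simp
    _ = _ := by
        rw [← mul_assoc (ENNReal.ofReal h), ← mul_assoc (ENNReal.ofReal (3 * (h * √h))),
          ← mul_assoc (ENNReal.ofReal 3), ← add_mul, ← mul_assoc,
          ← ENNReal.ofReal_mul (by positivity), ← ENNReal.ofReal_mul (by positivity),
          ← ENNReal.ofReal_mul (by positivity), ← ENNReal.ofReal_add (by positivity) (by positivity),
          ← ENNReal.ofReal_mul (by positivity), traceConst]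
        congr 2
        field_simp

/-- A point of the plane that is close to a given point of space lies in a small disc. -/
theorem volume_facePt_near_le (i : Fin P.numFaces) {c : ℝ} (hc : 0 < c) (hc2 : c ≤ 1 / 2)
    (hr : 0 < r) (b : E3) :
    volume {u | dist b ((1 - c) • P.facePt x₀ i u + c • x₀) < c * r}
      ≤ ENNReal.ofReal (52 * (c * r) ^ 2) := by
  set S := {u | dist b ((1 - c) • P.facePt x₀ i u + c • x₀) < c * r} with hS
  rcases S.eq_empty_or_nonempty with he | ⟨u₀, hu₀⟩
  · simp [he]
  have hsub : S ⊆ Metric.closedBall u₀ (4 * (c * r)) := by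
    intro u hu
    rw [Metric.mem_closedBall, ← (isometry_facePt (x₀ := x₀) i).dist_eq]
    have h1 : dist ((1 - c) • P.facePt x₀ i u + c • x₀) ((1 - c) • P.facePt x₀ i u₀ + c • x₀)
        < c * r + c * r := by
      refine (dist_triangle_left _ _ b).trans_lt ?_
      exact add_lt_add hu hu₀
    rw [dist_add_right, dist_smul₀, Real.norm_of_nonneg (by linarith)] at h1
    nlinarith [dist_nonneg (x := P.facePt x₀ i u) (y := P.facePt x₀ i u₀)]
  refine (measure_mono hsub).trans ?_
  rw [EuclideanSpace.volume_closedBall_fin_two, ← ENNReal.ofReal_pow (by positivity),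
    ← ENNReal.ofReal_mul (by positivity)]
  refine ENNReal.ofReal_le_ofReal ?_
  have : 0 < (c * r) ^ 2 := by positivity
  nlinarith [Real.pi_lt_d2]

/-- Averages over the balls that join a face to the central ball. -/
theorem lintegral_face_ball_le (hP : IsStarBall P.K x₀ r) (i : Fin P.numFaces) {c : ℝ} (hc : 0 < c)
    (hc2 : c ≤ 1 / 2) {Q : E3 → ℝ≥0∞} (hQ : Measurable Q) :
    ∫⁻ u in P.base x₀ i, ∫⁻ y in Metric.ball x₀ r, Q ((1 - c) • P.facePt x₀ i u + c • y)
      ≤ ENNReal.ofReal (52 * r ^ 2 / c) * ∫⁻ b in P.K, Q b := by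
  have hKm := P.isOpen.measurableSet
  have hbm := (isOpen_base (P := P) (x₀ := x₀) i).measurableSet
  have hpt : Continuous (P.facePt x₀ i) := (isometry_facePt i).continuous
  -- the pairs of a point of the face and a point of the contraction of the ball towards it; for a
  -- fixed second component they form a set of area at most `52 (c r)²`
  set S : Set (E2 × E3) := {p | dist p.2 ((1 - c) • P.facePt x₀ i p.1 + c • x₀) < c * r} with hS
  have hSm : MeasurableSet S :=
    (isOpen_lt (by fun_prop) continuous_const).measurableSet
  set J : E2 × E3 → ℝ≥0∞ := S.indicator fun p => Q p.2 with hJ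
  have hJm : Measurable J := (hQ.comp measurable_snd).indicator hSm
  have hc3 : ENNReal.ofReal |(c ^ 3)⁻¹| = ENNReal.ofReal (c ^ 3)⁻¹ := by
    rw [abs_of_pos (by positivity)]
  calc ∫⁻ u in P.base x₀ i, ∫⁻ y in Metric.ball x₀ r, Q ((1 - c) • P.facePt x₀ i u + c • y)
      ≤ ∫⁻ u in P.base x₀ i, ENNReal.ofReal (c ^ 3)⁻¹ * ∫⁻ b in P.K, J (u, b) := by
        refine setLIntegral_mono' hbm fun u hu => ?_
        have hx : P.facePt x₀ i u ∈ closure P.K :=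
          frontier_subset_closure (face_subset_frontier i (facePt_mem_face hu))
        have h1 : ∀ y ∈ Metric.ball x₀ r, c • y + (1 - c) • P.facePt x₀ i u
            ∈ P.K ∩ {b | (u, b) ∈ S} := by
          intro y hy
          rw [add_comm]
          refine ⟨hP.combo_mem hx hy hc (by linarith), ?_⟩
          simp only [hS, mem_ofPred_eq, dist_add_left, dist_smul₀, Real.norm_of_nonneg hc.le]
          exact mul_lt_mul_of_pos_left hy hc
        have h2 := lintegral_comp_smul_add_le hc.ne' ((1 - c) • P.facePt x₀ i u)
          Metric.isOpen_ball.measurableSet (hKm.inter (measurable_prodMk_left hSm)) h1 Q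
        simp only [add_comm (c • _)] at h2
        rw [hc3] at h2
        refine h2.trans ?_
        gcongr ENNReal.ofReal _ * ?_
        have hSu : MeasurableSet {b | (u, b) ∈ S} := measurable_prodMk_left hSm
        have h3 : ∫⁻ b in P.K ∩ {b | (u, b) ∈ S}, Q b = ∫⁻ b in P.K, J (u, b) := by
          rw [inter_comm, ← Measure.restrict_restrict hSu, ← lintegral_indicator hSu]
          rfl
        exact h3.le
    _ = ENNReal.ofReal (c ^ 3)⁻¹ * ∫⁻ b in P.K, ∫⁻ u in P.base x₀ i, J (u, b) := by
        rw [lintegral_const_mul' _ _ ENNReal.ofReal_ne_top, lintegral_lintegral_swap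
          (f := fun u b => J (u, b)) hJm.aemeasurable]
    _ ≤ ENNReal.ofReal (c ^ 3)⁻¹ * ∫⁻ b in P.K, ENNReal.ofReal (52 * (c * r) ^ 2) * Q b := by
        gcongr ENNReal.ofReal _ * ?_
        refine lintegral_mono fun b => ?_
        calc ∫⁻ u in P.base x₀ i, J (u, b) ≤ ∫⁻ u, J (u, b) := setLIntegral_le_lintegral _ _
          _ = ∫⁻ u, {u | (u, b) ∈ S}.indicator (fun _ => Q b) u := rfl
          _ = Q b * volume {u | (u, b) ∈ S} :=
            lintegral_indicator_const (measurable_prodMk_right hSm) _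
          _ ≤ _ := by
            rw [mul_comm]
            gcongr
            exact volume_facePt_near_le i hc hc2 hP.r_pos b
    _ = _ := by
        rw [lintegral_const_mul' _ _ ENNReal.ofReal_ne_top, ← mul_assoc,
          ← ENNReal.ofReal_mul (by positivity)]
        congr 2
        field_simp

end PolyhedralElement

theorem lintegral_le_rpow_half {α : Type*} [MeasurableSpace α] {μ : Measure α} {f : α → ℝ≥0∞}
    (hf : AEMeasurable f μ) :
    ∫⁻ x, f x ∂μ ≤ μ univ ^ (1 / 2 : ℝ) * (∫⁻ x, f x ^ 2 ∂μ) ^ (1 / 2 : ℝ) := by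
  have h := ENNReal.lintegral_mul_le_Lp_mul_Lq μ (Real.HolderConjugate.two_two) hf
    (aemeasurable_const (b := (1 : ℝ≥0∞)))
  simp only [Pi.mul_apply, mul_one, lintegral_const, ENNReal.rpow_two, one_pow, one_mul] at h
  rwa [mul_comm] at h

/-- The normalized restriction of the Lebesgue measure. -/
def uniformOn (B : Set E3) : Measure E3 := (volume.restrict B univ)⁻¹ • volume.restrict B

theorem lintegral_uniformOn {B : Set E3} (f : E3 → ℝ≥0∞) :
    ∫⁻ y, f y ∂(uniformOn B) = (volume B)⁻¹ * ∫⁻ y in B, f y := by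
  rw [uniformOn, lintegral_smul_measure, Measure.restrict_apply_univ, smul_eq_mul]

theorem isProbabilityMeasure_uniformOn {B : Set E3} (hB0 : volume B ≠ 0) (hB1 : volume B ≠ ⊤) :
    IsProbabilityMeasure (uniformOn B) := by
  have hne : NeZero ((volume : Measure E3).restrict B) :=
    ⟨fun h => hB0 (by simpa using congrArg (fun μ : Measure E3 => μ univ) h)⟩
  have hfin : IsFiniteMeasure ((volume : Measure E3).restrict B) := ⟨by simpa using hB1.lt_top⟩
  rw [uniformOn]
  infer_instance

theorem ae_uniformOn {B : Set E3} (hB : MeasurableSet B) : ∀ᵐ y ∂(uniformOn B), y ∈ B :=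
  (ae_restrict_mem hB).filter_mono (Measure.ae_smul_measure_le _)

/-- The integrand of the Gagliardo seminorm, after one integration. -/
def gagInner (K : Set E3) (s : ℝ) (φ : E3 → ℝ) (b : E3) : ℝ≥0∞ :=
  ∫⁻ x in K, ‖φ b - φ x‖ₑ ^ 2 / edist b x ^ (3 + 2 * s)

theorem measurable_gagInner (K : Set E3) (s : ℝ) {φ : E3 → ℝ} (hφ : Continuous φ) :
    Measurable (gagInner K s φ) := by
  refine Measurable.lintegral_prod_right' (f := fun p : E3 × E3 =>
    ‖φ p.1 - φ p.2‖ₑ ^ 2 / edist p.1 p.2 ^ (3 + 2 * s)) ?_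
  have h1 : Measurable fun p : E3 × E3 => ‖φ p.1 - φ p.2‖ₑ := by fun_prop
  have h2 : Measurable fun p : E3 × E3 => edist p.1 p.2 := by fun_prop
  exact (h1.pow_const 2).div (h2.pow_const _)

theorem lintegral_gagInner (K : Set E3) (s : ℝ) (φ : E3 → ℝ) :
    ∫⁻ b in K, gagInner K s φ b = gagliardo K s φ ^ 2 := by
  rw [gagliardo, ← ENNReal.rpow_natCast, ← ENNReal.rpow_mul]
  simp [gagInner]

namespace PolyhedralElement

variable {P : PolyhedralElement} {x₀ : E3} {r h a : ℝ}

theorem facePt_mem_closure {i : Fin P.numFaces} {u : E2} (hu : u ∈ P.base x₀ i) :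
    P.facePt x₀ i u ∈ closure P.K :=
  frontier_subset_closure (face_subset_frontier i (facePt_mem_face hu))

theorem _root_.FaceVEM.IsStarBall.dist_le_of_mem_closure {K : Set E3}
    (hh : ∀ x ∈ K, ∀ y ∈ K, dist x y ≤ h) {x y : E3} (hx : x ∈ closure K) (hy : y ∈ closure K) :
    dist x y ≤ h := by
  have h1 : ∀ x ∈ K, ∀ y ∈ closure K, dist x y ≤ h := fun x hx =>
    closure_minimal (fun y hy => hh x hx y hy)
      (isClosed_le (continuous_const.dist continuous_id) continuous_const)
  exact closure_minimal (fun x hx => h1 x hx y hy)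
    (isClosed_le (continuous_id.dist continuous_const) continuous_const) hx

theorem volume_base_le (hh : ∀ x ∈ P.K, ∀ y ∈ P.K, dist x y ≤ h) (i : Fin P.numFaces) :
    volume (P.base x₀ i) ≤ ENNReal.ofReal ((2 * h) ^ 2) := by
  rcases (P.base x₀ i).eq_empty_or_nonempty with he | ⟨u₀, hu₀⟩
  · simp [he]
  have h0 : 0 ≤ h := dist_nonneg.trans (IsStarBall.dist_le_of_mem_closure hh
    (facePt_mem_closure hu₀) (facePt_mem_closure hu₀))
  have hsub : P.base x₀ i ⊆ Metric.closedBall u₀ h := fun u hu => by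
    rw [Metric.mem_closedBall, ← (isometry_facePt (x₀ := x₀) i).dist_eq]
    exact IsStarBall.dist_le_of_mem_closure hh (facePt_mem_closure hu) (facePt_mem_closure hu₀)
  refine (measure_mono hsub).trans ?_
  rw [EuclideanSpace.volume_closedBall_fin_two, ← ENNReal.ofReal_pow h0,
    ← ENNReal.ofReal_mul (by positivity)]
  refine ENNReal.ofReal_le_ofReal ?_
  nlinarith [Real.pi_lt_d2, sq_nonneg h]

/-- The mean oscillation between the averages of `φ` over the contractions, with ratios `t` and
`t / 2`, of the central ball towards a point of a face. -/
def oscillation (P : PolyhedralElement) (x₀ : E3) (r : ℝ) (i : Fin P.numFaces) (φ : E3 → ℝ) (t : ℝ)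
    (u : E2) : ℝ≥0∞ :=
  ∫⁻ y', ∫⁻ y, ‖φ ((1 - t / 2) • P.facePt x₀ i u + (t / 2) • y')
    - φ ((1 - t) • P.facePt x₀ i u + t • y)‖ₑ
      ∂(uniformOn (Metric.ball x₀ r)) ∂(uniformOn (Metric.ball x₀ r))

/-- The averages are taken over points of `K` at mutual distance at most `t h`, so that differences
are bounded by the integrand of the Gagliardo seminorm times `(t h)^(3 + 2 s)`. The changes of
variables from the central ball cost `t⁻³` and, together with the integration over the face, `t⁻¹`.
-/
theorem lintegral_oscillation_sq_le (hP : IsStarBall P.K x₀ r)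
    (hh : ∀ x ∈ P.K, ∀ y ∈ P.K, dist x y ≤ h) (ha : 0 < a) (hpos : 0 < h) (har : a * h ≤ r)
    {s : ℝ} (hs : 0 < s) {φ : E3 → ℝ} (hφ : Continuous φ) (i : Fin P.numFaces) {t : ℝ} (ht : 0 < t)
    (ht1 : t ≤ 1) :
    ∫⁻ u in P.base x₀ i, P.oscillation x₀ r i φ t u ^ 2
      ≤ ENNReal.ofReal ((3 / a ^ 2 * (t * h) ^ (s - 1 / 2)) ^ 2) * gagliardo P.K s φ ^ 2 := by
  have hr := hP.r_pos
  have hbm := (isOpen_base (P := P) (x₀ := x₀) i).measurableSet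
  have hKm := P.isOpen.measurableSet
  set B := Metric.ball x₀ r with hB
  have hBm : MeasurableSet B := Metric.isOpen_ball.measurableSet
  have hprob := isProbabilityMeasure_uniformOn hP.volume_ball_ne_zero
    (measure_ball_lt_top (μ := (volume : Measure E3)) (x := x₀) (r := r)).ne
  have hV : (volume B)⁻¹ ≤ ENNReal.ofReal (4 * r ^ 3)⁻¹ := by
    rw [ENNReal.ofReal_inv_of_pos (by positivity)]
    gcongr
    have := IsStarBall.le_volume_ball (x₀ := x₀) (r := r) one_pos hr (by rw [one_mul])
    rwa [one_mul] at this
  have hpt : ∀ u ∈ P.base x₀ i, P.oscillation x₀ r i φ t u ^ 2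
      ≤ ENNReal.ofReal ((4 * r ^ 3)⁻¹ ^ 2 * (t * h) ^ (3 + 2 * s) * (t ^ 3)⁻¹) *
        ∫⁻ y' in B, gagInner P.K s φ ((1 - t / 2) • P.facePt x₀ i u + (t / 2) • y') := by
    intro u hu
    have hx := facePt_mem_closure hu
    set x := P.facePt x₀ i u with hxdef
    have hm1 : Measurable fun p : E3 × E3 =>
        ‖φ ((1 - t / 2) • x + (t / 2) • p.1) - φ ((1 - t) • x + t • p.2)‖ₑ := by fun_prop
    calc P.oscillation x₀ r i φ t u ^ 2
        ≤ ∫⁻ y', (∫⁻ y, ‖φ ((1 - t / 2) • x + (t / 2) • y') - φ ((1 - t) • x + t • y)‖ₑ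
            ∂(uniformOn B)) ^ 2 ∂(uniformOn B) :=
          lintegral_sq_le hm1.lintegral_prod_right'.aemeasurable
      _ ≤ ∫⁻ y', ∫⁻ y, ‖φ ((1 - t / 2) • x + (t / 2) • y') - φ ((1 - t) • x + t • y)‖ₑ ^ 2
            ∂(uniformOn B) ∂(uniformOn B) := by
          refine lintegral_mono fun y' => lintegral_sq_le ?_
          exact (hm1.comp measurable_prodMk_left).aemeasurable
      _ = (volume B)⁻¹ * ∫⁻ y' in B, (volume B)⁻¹ * ∫⁻ y in B,
            ‖φ ((1 - t / 2) • x + (t / 2) • y') - φ ((1 - t) • x + t • y)‖ₑ ^ 2 := by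
          simp only [lintegral_uniformOn]
      _ ≤ ENNReal.ofReal (4 * r ^ 3)⁻¹ * ∫⁻ y' in B, ENNReal.ofReal (4 * r ^ 3)⁻¹ *
            (ENNReal.ofReal ((t * h) ^ (3 + 2 * s)) * (ENNReal.ofReal (t ^ 3)⁻¹ *
            gagInner P.K s φ ((1 - t / 2) • x + (t / 2) • y'))) := by
          refine mul_le_mul' hV (setLIntegral_mono' hBm fun y' hy' => mul_le_mul' hV ?_)
          set b := (1 - t / 2) • x + (t / 2) • y' with hb
          have hbK : b ∈ P.K := hP.combo_mem hx hy' (by positivity) (by linarith)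
          have hseg : ∀ y ∈ B, (1 - t) • x + t • y ∈ P.K := fun y hy => hP.combo_mem hx hy ht ht1
          calc ∫⁻ y in B, ‖φ b - φ ((1 - t) • x + t • y)‖ₑ ^ 2
              ≤ ∫⁻ y in B, ENNReal.ofReal ((t * h) ^ (3 + 2 * s)) *
                  (‖φ b - φ ((1 - t) • x + t • y)‖ₑ ^ 2
                    / edist b ((1 - t) • x + t • y) ^ (3 + 2 * s)) := by
                refine setLIntegral_mono' hBm fun y hy => enorm_sub_sq_le_mul_div φ hs ?_
                have h1 : b - ((1 - t) • x + t • y) = (t / 2) • (x - y) + (t / 2) • (y' - y) := by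
                  rw [hb]
                  module
                rw [dist_eq_norm, h1]
                refine (norm_add_le _ _).trans ?_
                rw [norm_smul, norm_smul, Real.norm_of_nonneg (by positivity), ← dist_eq_norm,
                  ← dist_eq_norm]
                have h2 : dist x y ≤ h := IsStarBall.dist_le_of_mem_closure hh hx
                  (subset_closure (hP.ball_subset_self hy))
                have h3 : dist y' y ≤ h := hh _ (hP.ball_subset_self hy') _ (hP.ball_subset_self hy)
                nlinarith
            _ ≤ _ := by
                rw [lintegral_const_mul' _ _ ENNReal.ofReal_ne_top]
                gcongr ENNReal.ofReal _ * ?_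
                have h4 := lintegral_comp_smul_add_le ht.ne' ((1 - t) • x) hBm hKm
                  (fun y hy => by rw [add_comm]; exact hseg y hy)
                  (fun z => ‖φ b - φ z‖ₑ ^ 2 / edist b z ^ (3 + 2 * s))
                simp only [add_comm (t • _)] at h4
                rw [abs_of_pos (by positivity)] at h4
                exact h4
      _ = _ := by
          rw [lintegral_const_mul' _ _ ENNReal.ofReal_ne_top,
            lintegral_const_mul' _ _ ENNReal.ofReal_ne_top,
            lintegral_const_mul' _ _ ENNReal.ofReal_ne_top, ← mul_assoc, ← mul_assoc, ← mul_assoc,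
            ← ENNReal.ofReal_mul (by positivity), ← ENNReal.ofReal_mul (by positivity),
            ← ENNReal.ofReal_mul (by positivity), ← pow_two]
  refine (setLIntegral_mono' hbm hpt).trans ?_
  rw [lintegral_const_mul' _ _ ENNReal.ofReal_ne_top]
  refine (mul_le_mul_right (lintegral_face_ball_le hP i (c := t / 2) (by positivity) (by linarith)
    (measurable_gagInner P.K s hφ)) _).trans ?_
  rw [lintegral_gagInner, ← mul_assoc, ← ENNReal.ofReal_mul (by positivity)]
  gcongr ENNReal.ofReal ?_ * _
  have hth : 0 < t * h := by positivity
  have h1 : (t * h) ^ (3 + 2 * s) = ((t * h) ^ (s - 1 / 2)) ^ 2 * (t * h) ^ 4 := by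
    rw [← Real.rpow_natCast, ← Real.rpow_natCast, ← Real.rpow_mul hth.le, ← Real.rpow_add hth]
    congr 1
    push_cast
    ring
  set Z := (t * h) ^ (s - 1 / 2) with hZ
  have h2 : (4 * r ^ 3)⁻¹ ^ 2 * (t * h) ^ (3 + 2 * s) * (t ^ 3)⁻¹ * (52 * r ^ 2 / (t / 2))
      = 13 / 2 * Z ^ 2 * (h ^ 4 / r ^ 4) := by
    rw [h1]
    field_simp
    ring
  have h3 : h ^ 4 / r ^ 4 ≤ 1 / a ^ 4 := by
    rw [div_le_div_iff₀ (by positivity) (by positivity), one_mul, mul_comm, ← mul_pow]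
    exact pow_le_pow_left₀ (by positivity) har 4
  rw [h2]
  calc 13 / 2 * Z ^ 2 * (h ^ 4 / r ^ 4) ≤ 9 * Z ^ 2 * (1 / a ^ 4) := by
        gcongr
        norm_num
    _ = (3 / a ^ 2 * Z) ^ 2 := by
        field_simp
        ring

theorem measurable_oscillation (hP : IsStarBall P.K x₀ r) {φ : E3 → ℝ} (hφ : Continuous φ)
    (i : Fin P.numFaces) (t : ℝ) : Measurable (P.oscillation x₀ r i φ t) := by
  have hprob := isProbabilityMeasure_uniformOn hP.volume_ball_ne_zero
    (measure_ball_lt_top (μ := (volume : Measure E3)) (x := x₀) (r := r)).ne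
  have hpt : Continuous (P.facePt x₀ i) := (isometry_facePt i).continuous
  refine Measurable.lintegral_prod_right' (f := fun p : E2 × E3 => ∫⁻ y,
    ‖φ ((1 - t / 2) • P.facePt x₀ i p.1 + (t / 2) • p.2)
    - φ ((1 - t) • P.facePt x₀ i p.1 + t • y)‖ₑ ∂(uniformOn (Metric.ball x₀ r))) ?_
  refine Measurable.lintegral_prod_right' (f := fun p : (E2 × E3) × E3 =>
    ‖φ ((1 - t / 2) • P.facePt x₀ i p.1.1 + (t / 2) • p.1.2)
    - φ ((1 - t) • P.facePt x₀ i p.1.1 + t • p.2)‖ₑ) ?_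
  fun_prop

theorem lintegral_oscillation_le (hP : IsStarBall P.K x₀ r)
    (hh : ∀ x ∈ P.K, ∀ y ∈ P.K, dist x y ≤ h) (ha : 0 < a) (hpos : 0 < h) (har : a * h ≤ r)
    {s : ℝ} (hs : 0 < s) {φ : E3 → ℝ} (hφ : Continuous φ) (i : Fin P.numFaces) {t : ℝ} (ht : 0 < t)
    (ht1 : t ≤ 1) :
    ∫⁻ u in P.base x₀ i, P.oscillation x₀ r i φ t u
      ≤ ENNReal.ofReal (2 * h * (3 / a ^ 2 * (t * h) ^ (s - 1 / 2))) * gagliardo P.K s φ := by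
  refine (lintegral_le_rpow_half (measurable_oscillation hP hφ i t).aemeasurable).trans ?_
  have hhalf : ∀ A : ℝ≥0∞, (A ^ 2) ^ (1 / 2 : ℝ) = A := fun A => by
    rw [← ENNReal.rpow_natCast, ← ENNReal.rpow_mul]
    simp
  rw [ENNReal.ofReal_mul (by positivity), mul_assoc]
  refine mul_le_mul' ?_ ?_
  · rw [Measure.restrict_apply_univ, ← hhalf (ENNReal.ofReal (2 * h)),
      ← ENNReal.ofReal_pow (by positivity)]
    exact ENNReal.rpow_le_rpow (volume_base_le hh i) (by norm_num)
  · rw [← hhalf (_ * _), mul_pow, ← ENNReal.ofReal_pow (by positivity)]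
    exact ENNReal.rpow_le_rpow (lintegral_oscillation_sq_le hP hh ha hpos har hs hφ i ht ht1)
      (by norm_num)

/-- The constant of the trace inequality in `H^s`. -/
def fracTraceConst (a s : ℝ) : ℝ := 6 / a ^ 2 * (1 - (1 / 2) ^ (s - 1 / 2))⁻¹

/-- The trace inequality in `H^s`, for `1 / 2 < s < 1`. The value at a point of the face is the
limit of averages over balls of radii `2⁻ʲ r`; the differences of consecutive averages are
summable. -/
theorem lintegral_face_sub_average_le_gagliardo (hP : IsStarBall P.K x₀ r)
    (hh : ∀ x ∈ P.K, ∀ y ∈ P.K, dist x y ≤ h) (ha : 0 < a) (hpos : 0 < h) (har : a * h ≤ r)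
    {s : ℝ} (hs : 1 / 2 < s) {φ : E3 → ℝ} (hφ : Continuous φ) (i : Fin P.numFaces) :
    ∫⁻ u in P.base x₀ i, ‖φ (P.facePt x₀ i u) - ⨍ y in Metric.ball x₀ r, φ y‖ₑ
      ≤ ENNReal.ofReal (fracTraceConst a s * (√h * h ^ s)) * gagliardo P.K s φ := by
  have hbm := (isOpen_base (P := P) (x₀ := x₀) i).measurableSet
  set B := Metric.ball x₀ r with hB
  have hBm : MeasurableSet B := Metric.isOpen_ball.measurableSet
  have hprob := isProbabilityMeasure_uniformOn hP.volume_ball_ne_zero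
    (measure_ball_lt_top (μ := (volume : Measure E3)) (x := x₀) (r := r)).ne
  set ρ : ℝ := (1 / 2) ^ (s - 1 / 2) with hρ
  have hρ0 : 0 < ρ := by positivity
  have hρ1 : ρ < 1 := Real.rpow_lt_one (by norm_num) (by norm_num) (by linarith)
  obtain ⟨M, hM⟩ := hP.isCompact_closure.exists_bound_of_continuousOn hφ.continuousOn
  have hpt : ∀ u ∈ P.base x₀ i, ‖φ (P.facePt x₀ i u) - ⨍ y in B, φ y‖ₑ
      ≤ ∑' j : ℕ, P.oscillation x₀ r i φ ((1 / 2) ^ j) u := by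
    intro u hu
    have hx := facePt_mem_closure hu
    set x := P.facePt x₀ i u with hxdef
    -- the averages over the contractions of the central ball towards the point `x` of the face
    set A : ℕ → ℝ := fun j => ∫ y, φ ((1 - (1 / 2 : ℝ) ^ j) • x + ((1 / 2 : ℝ) ^ j) • y)
      ∂(uniformOn B) with hA
    have hbd : ∀ t : ℝ, 0 < t → t ≤ 1 → ∀ᵐ y ∂(uniformOn B), ‖φ ((1 - t) • x + t • y)‖ ≤ M := by
      intro t ht ht1
      filter_upwards [ae_uniformOn hBm] with y hy
      exact hM _ (subset_closure (hP.combo_mem hx hy ht ht1))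
    have hint : ∀ t : ℝ, 0 < t → t ≤ 1 →
        Integrable (fun y => φ ((1 - t) • x + t • y)) (uniformOn B) := fun t ht ht1 =>
      Integrable.of_bound (by fun_prop) M (hbd t ht ht1)
    have hpow : ∀ j : ℕ, 0 < (1 / 2 : ℝ) ^ j ∧ (1 / 2 : ℝ) ^ j ≤ 1 := fun j =>
      ⟨by positivity, pow_le_one₀ (by norm_num) (by norm_num)⟩
    have hstep : ∀ j, edist (A j) (A j.succ) ≤ P.oscillation x₀ r i φ ((1 / 2) ^ j) u := by
      intro j
      obtain ⟨ht, ht1⟩ := hpow j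
      set t : ℝ := (1 / 2) ^ j with htdef
      have hsucc : (1 / 2 : ℝ) ^ j.succ = t / 2 := by
        rw [pow_succ, htdef]
        ring
      simp only [hA, hsucc, ← htdef]
      rw [edist_eq_enorm_sub]
      refine (enorm_sub_integral_le (hint (t / 2) (by positivity) (by linarith)) _).trans ?_
      refine lintegral_mono fun y' => ?_
      rw [← enorm_neg, neg_sub]
      exact enorm_sub_integral_le (hint t ht ht1) _
    have hlim : Tendsto A atTop (𝓝 (φ x)) := by
      have h1 : φ x = ∫ _, φ x ∂(uniformOn B) := by simp
      rw [h1]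
      refine tendsto_integral_of_dominated_convergence (fun _ => M) (fun j => by fun_prop)
        (integrable_const M) (fun j => hbd _ (hpow j).1 (hpow j).2) ?_
      refine Eventually.of_forall fun y => ?_
      have h2 : Tendsto (fun j : ℕ => (1 / 2 : ℝ) ^ j) atTop (𝓝 0) :=
        tendsto_pow_atTop_nhds_zero_of_lt_one (by norm_num) (by norm_num)
      have h3 : Continuous fun t : ℝ => φ ((1 - t) • x + t • y) := by fun_prop
      have h4 := (h3.tendsto 0).comp h2
      simpa [Function.comp_def] using h4
    have h5 := edist_le_tsum_of_edist_le_of_tendsto₀ _ hstep hlim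
    have h6 : A 0 = ⨍ y in B, φ y := by
      simp only [hA, pow_zero, sub_self, zero_smul, one_smul, zero_add]
      rfl
    rwa [h6, edist_comm, edist_eq_enorm_sub] at h5
  refine (setLIntegral_mono' hbm hpt).trans ?_
  rw [lintegral_tsum fun j => (measurable_oscillation hP hφ i _).aemeasurable]
  -- a geometric series with ratio `ρ = 2 ^ (1 / 2 - s)`, which is less than `1` because `s > 1 / 2`
  have hterm : ∀ j : ℕ, ∫⁻ u in P.base x₀ i, P.oscillation x₀ r i φ ((1 / 2) ^ j) u
      ≤ ENNReal.ofReal (6 / a ^ 2 * (√h * h ^ s)) * gagliardo P.K s φ * ENNReal.ofReal ρ ^ j := by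
    intro j
    refine (lintegral_oscillation_le hP hh ha hpos har (s := s) (by linarith) hφ i
      (t := (1 / 2) ^ j) (by positivity) (pow_le_one₀ (by norm_num) (by norm_num))).trans
      (le_of_eq ?_)
    have h1 : ((1 / 2 : ℝ) ^ j * h) ^ (s - 1 / 2) = ρ ^ j * h ^ (s - 1 / 2) := by
      rw [Real.mul_rpow (by positivity) hpos.le, hρ, ← Real.rpow_natCast, ← Real.rpow_natCast,
        ← Real.rpow_mul (by norm_num), ← Real.rpow_mul (by norm_num), mul_comm (j : ℝ)]
    have h2 : h * h ^ (s - 1 / 2) = √h * h ^ s := by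
      rw [Real.sqrt_eq_rpow, ← Real.rpow_add hpos]
      nth_rewrite 1 [← Real.rpow_one h]
      rw [← Real.rpow_add hpos]
      congr 1
      ring
    have h3 : 2 * h * (3 / a ^ 2 * ((1 / 2 : ℝ) ^ j * h) ^ (s - 1 / 2))
        = 6 / a ^ 2 * (√h * h ^ s) * ρ ^ j := by
      rw [h1, ← h2]
      ring
    rw [h3, ENNReal.ofReal_mul (by positivity), ENNReal.ofReal_pow hρ0.le]
    ring
  refine (ENNReal.tsum_le_tsum hterm).trans ?_
  rw [ENNReal.tsum_mul_left, ENNReal.tsum_geometric]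
  have h1 : (1 - ENNReal.ofReal ρ)⁻¹ = ENNReal.ofReal (1 - ρ)⁻¹ := by
    rw [ENNReal.ofReal_inv_of_pos (by linarith), ENNReal.ofReal_sub _ hρ0.le, ENNReal.ofReal_one]
  have h2 : 0 < (1 - ρ)⁻¹ := inv_pos.2 (by linarith)
  rw [h1, mul_right_comm, ← ENNReal.ofReal_mul (by positivity), fracTraceConst, ← hρ]
  refine le_of_eq ?_
  congr 2
  ring

end PolyhedralElement

/-! ### Riesz representation on the closure of a range -/

/-- Riesz representation: a functional that is controlled by `‖T v‖` factors through the range of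
`T`, and is represented by an element of the closure of that range. -/
theorem exists_inner_eq_of_le {V H : Type*} [AddCommGroup V] [Module ℝ V] [NormedAddCommGroup H]
    [InnerProductSpace ℝ H] [CompleteSpace H] (T : V →ₗ[ℝ] H) (ℓ : V →ₗ[ℝ] ℝ) (C : ℝ)
    (hℓ : ∀ v, |ℓ v| ≤ C * ‖T v‖) :
    ∃ u ∈ (LinearMap.range T).topologicalClosure, ∀ v, ⟪u, T v⟫ = ℓ v := by
  obtain ⟨g, hg⟩ := T.rangeRestrict.exists_rightInverse_of_surjective T.range_rangeRestrict
  have hg' : ∀ y, T (g y) = y := fun y => congrArg Subtype.val (LinearMap.congr_fun hg y)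
  let f : LinearMap.range T →L[ℝ] ℝ := (ℓ.comp g).mkContinuous C fun y => by
    have h := hℓ (g y)
    rw [hg' y] at h
    exact h
  obtain ⟨F, hF, -⟩ := exists_extension_norm_eq (LinearMap.range T) f
  set u₀ := (InnerProductSpace.toDual ℝ H).symm F with hu₀
  have hu : ∀ v, ⟪u₀, T v⟫ = ℓ v := fun v => by
    rw [hu₀, InnerProductSpace.toDual_symm_apply]
    have h1 : F (T v) = ℓ (g ⟨T v, v, rfl⟩) := hF ⟨T v, v, rfl⟩
    have h2 := hℓ (g ⟨T v, v, rfl⟩ - v)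
    rw [map_sub T, hg', sub_self, norm_zero, mul_zero, map_sub] at h2
    rw [h1]
    exact sub_eq_zero.1 (abs_nonpos_iff.1 h2)
  have hcomplete : CompleteSpace (LinearMap.range T).topologicalClosure :=
    (Submodule.isClosed_topologicalClosure _).completeSpace_coe
  set G := (LinearMap.range T).topologicalClosure with hG
  refine ⟨G.starProjection u₀, G.starProjection_apply_mem u₀, fun v => ?_⟩
  have hv : T v ∈ G := Submodule.le_topologicalClosure _ ⟨v, rfl⟩
  rw [← hu v, Submodule.inner_starProjection_left_eq_right, Submodule.starProjection_eq_self_iff.2 hv]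

theorem inner_toLp {μ : Measure E3} {f g : E3 → E3} (hf : MemLp f 2 μ) (hg : MemLp g 2 μ) :
    ⟪hf.toLp f, hg.toLp g⟫ = ∫ x, ⟪f x, g x⟫ ∂μ := by
  rw [L2.inner_def]
  refine integral_congr_ae ?_
  filter_upwards [hf.coeFn_toLp, hg.coeFn_toLp] with x h1 h2
  rw [h1, h2]

/-! ### Gradients in `L²(K)` -/

/-- The functions that are smooth up to the boundary, extended to the space with compact support. -/
def testSpace : Submodule ℝ (E3 → ℝ) where
  carrier := {φ | ContDiff ℝ ∞ φ ∧ HasCompactSupport φ}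
  add_mem' h₁ h₂ := ⟨h₁.1.add h₂.1, h₁.2.add h₂.2⟩
  zero_mem' := ⟨contDiff_const, HasCompactSupport.zero⟩
  smul_mem' c _ h := ⟨h.1.const_smul c, h.2.smul_left (f := fun _ => c)⟩

theorem testSpace.contDiff (φ : testSpace) : ContDiff ℝ ∞ (φ : E3 → ℝ) := φ.2.1

theorem testSpace.contDiff_one (φ : testSpace) : ContDiff ℝ 1 (φ : E3 → ℝ) :=
  contDiff_infty.1 φ.2.1 1

namespace IsStarBall

variable {K : Set E3} {x₀ : E3} {r : ℝ}

/-- The gradient, as an element of `L²(K)`. -/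
def gradL (hK : IsStarBall K x₀ r) : testSpace →ₗ[ℝ] Lp E3 2 (volume.restrict K) where
  toFun φ := (hK.memLp_of_continuous (continuous_gradient (testSpace.contDiff_one φ))).toLp (gradient (φ : E3 → ℝ))
  map_add' φ χ := by
    rw [← MemLp.toLp_add]
    congr 1
    funext x
    simp only [gradient, Submodule.coe_add, Pi.add_apply]
    rw [fderiv_add ((testSpace.contDiff_one φ).differentiable (by norm_num) x)
      ((testSpace.contDiff_one χ).differentiable (by norm_num) x), map_add]
  map_smul' c φ := by
    rw [RingHom.id_apply, ← MemLp.toLp_const_smul]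
    congr 1
    funext x
    simp only [gradient, Submodule.coe_smul, Pi.smul_apply]
    rw [fderiv_const_smul ((testSpace.contDiff_one φ).differentiable (by norm_num) x), map_smulₛₗ]
    rfl

/-- The closure of the gradients in `L²(K)`. -/
def gradSpace (hK : IsStarBall K x₀ r) : Submodule ℝ (Lp E3 2 (volume.restrict K)) :=
  (LinearMap.range hK.gradL).topologicalClosure

instance (hK : IsStarBall K x₀ r) : CompleteSpace hK.gradSpace :=
  (Submodule.isClosed_topologicalClosure _).completeSpace_coe

theorem gradL_mem (hK : IsStarBall K x₀ r) (φ : testSpace) : hK.gradL φ ∈ hK.gradSpace :=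
  Submodule.le_topologicalClosure _ ⟨φ, rfl⟩

theorem inner_gradL (hK : IsStarBall K x₀ r) {ψ : E3 → E3} (hψ : MemLp ψ 2 (volume.restrict K))
    (φ : testSpace) : ⟪hψ.toLp ψ, hK.gradL φ⟫ = ∫ x in K, ⟪ψ x, gradient (φ : E3 → ℝ) x⟫ :=
  inner_toLp hψ (hK.memLp_of_continuous (continuous_gradient (testSpace.contDiff_one φ)))

theorem enorm_gradL (hK : IsStarBall K x₀ r) (φ : testSpace) :
    ENNReal.ofReal ‖hK.gradL φ‖ = eLpNorm (gradient (φ : E3 → ℝ)) 2 (volume.restrict K) := by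
  have h := hK.memLp_of_continuous (continuous_gradient (testSpace.contDiff_one φ))
  have : ‖hK.gradL φ‖ = (eLpNorm (gradient (φ : E3 → ℝ)) 2 (volume.restrict K)).toReal := Lp.norm_toLp _ h
  rw [this, ENNReal.ofReal_toReal h.2.ne]

end IsStarBall

/-! ### The weak curl -/

theorem HasWeakGradient.integral_fderiv_mul {K : Set E3} {f : E3 → ℝ} {g : E3 → E3}
    (h : HasWeakGradient K f g) {φ : E3 → ℝ} (hφ : IsTestFunction K φ) (i : Fin 3) :
    ∫ x in K, f x * fderiv ℝ φ x (EuclideanSpace.single i 1) = -∫ x in K, φ x * g x i := by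
  rw [← h.integral_fderiv hφ i]
  simp only [mul_comm]

theorem isTestFunction_fderiv {K : Set E3} {φ : E3 → ℝ} (hφ : IsTestFunction K φ) (v : E3) :
    IsTestFunction K (fun x => fderiv ℝ φ x v) where
  smooth := (hφ.smooth.fderiv_right (m := ∞) (by simp)).clm_apply contDiff_const
  compact := hφ.compact.fderiv_apply ℝ v
  support_subset := (tsupport_fderiv_apply_subset ℝ v).trans hφ.support_subset

/-- The field `∂ₖχ eⱼ - ∂ⱼχ eₖ`, which is the curl of `χ (eⱼ × eₖ)`. With `j = i + 1` and
`k = i + 2`, in `Fin 3`, this is the curl of `χ eᵢ`, and integrals against it are the components of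
the weak curl. -/
def curlField (χ : E3 → ℝ) (j k : Fin 3) (x : E3) : E3 :=
  fderiv ℝ χ x (EuclideanSpace.single k 1) • EuclideanSpace.single j 1
    - fderiv ℝ χ x (EuclideanSpace.single j 1) • EuclideanSpace.single k 1

theorem inner_curlField (χ : E3 → ℝ) (j k : Fin 3) (x v : E3) :
    ⟪v, curlField χ j k x⟫ = v j * fderiv ℝ χ x (EuclideanSpace.single k 1)
      - v k * fderiv ℝ χ x (EuclideanSpace.single j 1) := by
  rw [curlField, inner_sub_right, inner_smul_right, inner_smul_right,
    EuclideanSpace.inner_single_right, EuclideanSpace.inner_single_right]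
  simp [mul_comm]

theorem continuous_curlField {χ : E3 → ℝ} (hχ : ContDiff ℝ 1 χ) (j k : Fin 3) :
    Continuous (curlField χ j k) := by
  have h1 : ∀ v, Continuous fun x => fderiv ℝ χ x v := fun v =>
    (hχ.continuous_fderiv (by norm_num)).clm_apply continuous_const
  have h2 := h1 (EuclideanSpace.single k 1)
  have h3 := h1 (EuclideanSpace.single j 1)
  unfold curlField
  fun_prop

theorem cross_apply (u v : E3) (i : Fin 3) :
    cross u v i = u (i + 1) * v (i + 2) - u (i + 2) * v (i + 1) := by
  fin_cases i <;> simp [cross, crossProduct]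

theorem cross_gradient_apply (u : E3) (χ : E3 → ℝ) (x : E3) (i : Fin 3) :
    cross u (gradient χ x) i = ⟪u, curlField χ (i + 1) (i + 2) x⟫ := by
  rw [cross_apply, inner_curlField, gradient_apply_eq, gradient_apply_eq]

theorem IsTestFunction.integrableOn_inner_curlField {K : Set E3} {ψ : E3 → E3}
    (hψ : LocallyIntegrableOn ψ K volume) {χ : E3 → ℝ} (hχ : IsTestFunction K χ) (j k : Fin 3) :
    IntegrableOn (fun x => ⟪ψ x, curlField χ j k x⟫) K := by
  simp only [inner_curlField]
  have h : ∀ j k : Fin 3, IntegrableOn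
      (fun x => ψ x j * fderiv ℝ χ x (EuclideanSpace.single k 1)) K := fun j k => by
    have hk := isTestFunction_fderiv hχ (EuclideanSpace.single k 1)
    exact integrableOn_smul_of_tsupport_subset' (locallyIntegrableOn_apply hψ j)
      hk.smooth.continuous hk.compact hk.support_subset
  exact (h j k).sub (h k j)

/-- The components of the identity defining a constant weak curl. -/
theorem hasWeakCurl_const_iff {K : Set E3} (hK : IsOpen K) {ψ : E3 → E3}
    (hψ : LocallyIntegrableOn ψ K volume) (q : E3) :
    HasWeakCurl K ψ (fun _ => q) ↔ ∀ χ, IsTestFunction K χ → ∀ i,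
      ∫ x in K, ⟪ψ x, curlField χ (i + 1) (i + 2) x⟫ = q i * ∫ x in K, χ x := by
  have hq : LocallyIntegrableOn (fun _ : E3 => q) K volume :=
    continuousOn_const.locallyIntegrableOn hK.measurableSet
  have hint : ∀ χ, IsTestFunction K χ →
      IntegrableOn (fun x => cross (ψ x) (gradient χ x)) K := fun χ hχ =>
    Integrable.of_eval_piLp fun i => by
      simp only [cross_gradient_apply]
      exact hχ.integrableOn_inner_curlField hψ _ _
  have key : ∀ χ, IsTestFunction K χ →
      ((∫ x in K, χ x • q = ∫ x in K, cross (ψ x) (gradient χ x)) ↔ ∀ i,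
        ∫ x in K, ⟪ψ x, curlField χ (i + 1) (i + 2) x⟫ = q i * ∫ x in K, χ x) := by
    intro χ hχ
    have h1 : ∀ i, (∫ x in K, cross (ψ x) (gradient χ x)) i
        = ∫ x in K, ⟪ψ x, curlField χ (i + 1) (i + 2) x⟫ := fun i => by
      have := (EuclideanSpace.proj (𝕜 := ℝ) i).integral_comp_comm (hint χ hχ)
      simp only [PiLp.proj_apply, cross_gradient_apply] at this
      exact this.symm
    rw [integral_smul_const]
    constructor
    · intro h i
      rw [← h1, ← h, PiLp.smul_apply, smul_eq_mul, mul_comm]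
    · intro h
      ext i
      rw [h1, h, PiLp.smul_apply, smul_eq_mul, mul_comm]
  exact ⟨fun h χ hχ => (key χ hχ).1 (h.integral_eq χ hχ),
    fun h => ⟨hψ, hq, fun χ hχ => (key χ hχ).2 (h χ hχ)⟩⟩

/-- Gradients are curl free: second derivatives are symmetric. -/
theorem integral_inner_gradient_curlField {K : Set E3} (hK : IsOpen K) {φ χ : E3 → ℝ}
    (hφ : ContDiff ℝ 1 φ) (hχ : IsTestFunction K χ) (j k : Fin 3) :
    ∫ x in K, ⟪gradient φ x, curlField χ j k x⟫ = 0 := by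
  have hg := hasWeakGradient_of_contDiff hK hφ
  have hint : ∀ j k : Fin 3, IntegrableOn (fun x => gradient φ x j *
      fderiv ℝ χ x (EuclideanSpace.single k 1)) K := fun j k => by
    have hk := isTestFunction_fderiv hχ (EuclideanSpace.single k 1)
    exact integrableOn_smul_of_tsupport_subset'
      (locallyIntegrableOn_apply hg.locallyIntegrable_grad j)
      hk.smooth.continuous hk.compact hk.support_subset
  have h1 : ∀ j k : Fin 3, ∫ x in K, gradient φ x j * fderiv ℝ χ x (EuclideanSpace.single k 1)
      = -∫ x in K, fderiv ℝ (fderiv ℝ χ) x (EuclideanSpace.single j 1) (EuclideanSpace.single k 1)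
        * φ x := fun j k => by
    have h2 := hg.integral_fderiv (isTestFunction_fderiv hχ (EuclideanSpace.single k 1)) j
    rw [eq_neg_iff_add_eq_zero, add_comm, ← eq_neg_iff_add_eq_zero]
    simp only [mul_comm (gradient φ _ j)]
    rw [← h2]
    refine integral_congr_ae (Eventually.of_forall fun x => ?_)
    beta_reduce
    have h3 : HasFDerivAt (fderiv ℝ χ) (fderiv ℝ (fderiv ℝ χ) x) x :=
      ((((contDiff_infty.1 hχ.smooth 2).fderiv_right (m := 1) (by norm_num)).differentiable
        (by norm_num)) x).hasFDerivAt
    have h4 := h3.clm_apply (hasFDerivAt_const (EuclideanSpace.single k (1 : ℝ)) x)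
    rw [h4.fderiv]
    simp
  simp only [inner_curlField]
  rw [integral_sub (hint j k) (hint k j), h1, h1, sub_eq_zero]
  congr 1
  refine integral_congr_ae (Eventually.of_forall fun x => ?_)
  beta_reduce
  rw [((contDiff_infty.1 hχ.smooth 2).contDiffAt (x := x)).isSymmSndFDerivAt (by simp) |>.eq]

/-- The linear field with curl `q` that vanishes at `b`. -/
def rotField (b q : E3) (x : E3) : E3 := (1 / 2 : ℝ) • cross q (x - b)

theorem rotField_apply (b q x : E3) (i : Fin 3) : rotField b q x i
    = 1 / 2 * (q (i + 1) * (x (i + 2) - b (i + 2)) - q (i + 2) * (x (i + 1) - b (i + 1))) := by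
  simp [rotField, cross_apply]

theorem continuous_rotField (b q : E3) : Continuous (rotField b q) := by
  have h : rotField b q = fun x => WithLp.toLp 2 fun i => rotField b q x i := rfl
  rw [h]
  simp only [rotField_apply]
  fun_prop

theorem rotField_add (b q q' : E3) : rotField b (q + q') = rotField b q + rotField b q' := by
  funext x
  ext i
  simp only [Pi.add_apply, PiLp.add_apply, rotField_apply]
  ring

theorem rotField_smul (b : E3) (c : ℝ) (q : E3) : rotField b (c • q) = c • rotField b q := by
  funext x
  ext i
  simp only [Pi.smul_apply, PiLp.smul_apply, rotField_apply, smul_eq_mul]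
  ring

theorem inner_cross_eq (b q x v : E3) : ⟪v, cross (x - b) q⟫ = -2 * ⟪v, rotField b q x⟫ := by
  simp only [inner_eq_sum, rotField_apply, cross_apply, Finset.mul_sum]
  refine Finset.sum_congr rfl fun i _ => ?_
  simp only [PiLp.sub_apply]
  ring

theorem norm_cross_le (u v : E3) : ‖cross u v‖ ≤ ‖u‖ * ‖v‖ := by
  rw [← abs_of_nonneg (norm_nonneg (cross u v)), ← abs_of_nonneg (mul_nonneg (norm_nonneg u)
    (norm_nonneg v)), ← sq_le_sq, mul_pow, EuclideanSpace.norm_sq_eq, EuclideanSpace.norm_sq_eq,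
    EuclideanSpace.norm_sq_eq]
  simp only [Real.norm_eq_abs, sq_abs, cross_apply, Fin.sum_univ_three]
  have e1 : (1 : Fin 3) + 1 = 2 := rfl
  have e2 : (1 : Fin 3) + 2 = 0 := rfl
  have e3 : (2 : Fin 3) + 1 = 0 := rfl
  have e4 : (2 : Fin 3) + 2 = 1 := rfl
  simp only [zero_add, e1, e2, e3, e4]
  nlinarith [sq_nonneg (u 0 * v 0 + u 1 * v 1 + u 2 * v 2)]

theorem norm_rotField_le (b q x : E3) : ‖rotField b q x‖ ≤ ‖q‖ * ‖x - b‖ := by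
  rw [rotField, norm_smul]
  have h := norm_cross_le q (x - b)
  have h2 : ‖(1 / 2 : ℝ)‖ = 1 / 2 := by norm_num
  rw [h2]
  linarith [norm_nonneg (cross q (x - b))]

/-- The weak curl of `rotField b q` is `q`. -/
theorem integral_inner_rotField_curlField {K : Set E3} (hK : IsOpen K) (b q : E3) {χ : E3 → ℝ}
    (hχ : IsTestFunction K χ) (i : Fin 3) :
    ∫ x in K, ⟪rotField b q x, curlField χ (i + 1) (i + 2) x⟫ = q i * ∫ x in K, χ x := by
  have hproj : ∀ (m : Fin 3) (x : E3), HasFDerivAt (fun y : E3 => y m)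
      (EuclideanSpace.proj (𝕜 := ℝ) m) x := fun m x => (EuclideanSpace.proj (𝕜 := ℝ) m).hasFDerivAt
  have hg : ∀ l : Fin 3, HasWeakGradient K (fun x => rotField b q x l)
      (fun _ => (1 / 2 : ℝ) • (q (l + 1) • EuclideanSpace.single (l + 2) (1 : ℝ)
        - q (l + 2) • EuclideanSpace.single (l + 1) (1 : ℝ))) := by
    intro l
    refine hasWeakGradient_of_hasFDerivAt hK (fun x _ => ?_) continuousOn_const
    simp only [rotField_apply]
    refine HasFDerivAt.congr_fderiv
      ((((hproj (l + 2) x).sub_const (b (l + 2))).const_mul (q (l + 1))).sub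
        (((hproj (l + 1) x).sub_const (b (l + 1))).const_mul (q (l + 2))) |>.const_mul (1 / 2)) ?_
    refine ContinuousLinearMap.ext fun v => ?_
    rw [innerSL_apply_apply, real_inner_smul_left, inner_sub_left, real_inner_smul_left,
      real_inner_smul_left, EuclideanSpace.inner_single_left, EuclideanSpace.inner_single_left]
    simp
  have hint : ∀ j k : Fin 3, IntegrableOn (fun x => rotField b q x j *
      fderiv ℝ χ x (EuclideanSpace.single k 1)) K := fun j k => by
    have hk := isTestFunction_fderiv hχ (EuclideanSpace.single k 1)
    exact integrableOn_smul_of_tsupport_subset' (hg j).locallyIntegrable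
      hk.smooth.continuous hk.compact hk.support_subset
  simp only [inner_curlField]
  rw [integral_sub (hint _ _) (hint _ _), (hg _).integral_fderiv_mul hχ,
    (hg _).integral_fderiv_mul hχ, integral_mul_const, integral_mul_const]
  fin_cases i <;> simp <;> ring

/-! ### Curl free fields are gradients -/

theorem Smoothing.contDiff_opVec_of_memLp {K : Set E3} (D : Smoothing K) (hK : IsOpen K)
    {ψ : E3 → E3} (hψ : MemLp ψ 2 (volume.restrict K)) : ContDiff ℝ ∞ (D.opVec ψ) :=
  D.contDiff_opVec fun i => locallyIntegrableOn_apply (locallyIntegrableOn_of_memLp hK hψ) i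

theorem SmoothingSeq.tendsto_eLpNorm_vec {K : Set E3} (A : SmoothingSeq K) (hK : IsOpen K)
    {ψ : E3 → E3} (hψ : MemLp ψ 2 (volume.restrict K)) {κ : ℕ → ℝ} (hκ : Tendsto κ atTop (𝓝 1)) :
    Tendsto (fun n => eLpNorm (fun x => ψ x - κ n • (A.D n).opVec ψ x) 2 (volume.restrict K))
      atTop (𝓝 0) := by
  have hm : ∀ n, AEStronglyMeasurable (fun x => ψ x - κ n • (A.D n).opVec ψ x)
      (volume.restrict K) := fun n => by
    have h := ((A.D n).contDiff_opVec_of_memLp hK hψ).continuous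
    exact hψ.1.sub (h.const_smul (κ n)).aestronglyMeasurable
  simp only [← sum_rpow_half_eLpNorm (hm _)]
  have h1 : Tendsto (fun n => ∑ i : Fin 3, eLpNorm (fun x => (ψ x - κ n • (A.D n).opVec ψ x) i) 2
      (volume.restrict K) ^ 2) atTop (𝓝 (∑ i : Fin 3, (0 : ℝ≥0∞) ^ 2)) := by
    refine tendsto_finsetSum _ fun i _ => ((ENNReal.continuous_pow 2).tendsto 0).comp ?_
    exact A.tendsto_eLpNorm hK (hψ.eval_piLp i) hκ
  have h2 := ((ENNReal.continuous_rpow_const (y := (1 / 2 : ℝ))).tendsto _).comp h1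
  simpa [Function.comp_def] using h2

theorem mem_of_tendsto_eLpNorm {μ : Measure E3} {G : Submodule ℝ (Lp E3 2 μ)}
    (hG : IsClosed (G : Set (Lp E3 2 μ))) {ψ : E3 → E3} (hψ : MemLp ψ 2 μ) {Ψ : ℕ → E3 → E3}
    (hΨ : ∀ n, MemLp (Ψ n) 2 μ) (hΨG : ∀ n, (hΨ n).toLp (Ψ n) ∈ G)
    (h : Tendsto (fun n => eLpNorm (fun x => ψ x - Ψ n x) 2 μ) atTop (𝓝 0)) :
    hψ.toLp ψ ∈ G := by
  refine hG.mem_of_tendsto (b := atTop) (f := fun n => (hΨ n).toLp (Ψ n)) ?_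
    (Eventually.of_forall hΨG)
  rw [Lp.tendsto_Lp_iff_tendsto_eLpNorm'']
  refine h.congr fun n => ?_
  rw [← eLpNorm_neg]
  congr 1
  funext x
  simp

namespace IsStarBall

variable {K : Set E3} {x₀ : E3} {r : ℝ}

theorem isClosed_gradSpace (hK : IsStarBall K x₀ r) :
    IsClosed (hK.gradSpace : Set (Lp E3 2 (volume.restrict K))) :=
  Submodule.isClosed_topologicalClosure _

/-- Limits of gradients are curl free. -/
theorem integral_inner_curlField_of_mem_gradSpace (hK : IsStarBall K x₀ r) {ψ : E3 → E3}
    (hψ : MemLp ψ 2 (volume.restrict K)) (h : hψ.toLp ψ ∈ hK.gradSpace) {χ : E3 → ℝ}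
    (hχ : IsTestFunction K χ) (j k : Fin 3) : ∫ x in K, ⟪ψ x, curlField χ j k x⟫ = 0 := by
  have hc := hK.memLp_of_continuous (continuous_curlField hχ.contDiff_one j k)
  rw [← inner_toLp hψ hc]
  have hle : hK.gradSpace ≤ (ℝ ∙ hc.toLp _)ᗮ := by
    refine Submodule.topologicalClosure_minimal _ ?_ (Submodule.isClosed_orthogonal _)
    rintro _ ⟨φ, rfl⟩
    rw [Submodule.mem_orthogonal_singleton_iff_inner_left]
    exact (inner_toLp (hK.memLp_of_continuous
      (continuous_gradient (testSpace.contDiff_one φ))) hc).trans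
      (integral_inner_gradient_curlField hK.isOpen (testSpace.contDiff_one φ) hχ j k)
  exact Submodule.mem_orthogonal_singleton_iff_inner_left.1 (hle h)

/-- A continuous field with a differentiable potential is in the closure of the gradients: the
smoothed potentials are smooth up to the boundary. -/
theorem mem_gradSpace_of_hasFDerivAt (hK : IsStarBall K x₀ r) {φ : E3 → ℝ} {Ψ : E3 → E3}
    (hΨ : Continuous Ψ) (hφ : ∀ x ∈ K, HasFDerivAt φ (innerSL ℝ (Ψ x)) x) :
    (hK.memLp_of_continuous hΨ).toLp Ψ ∈ hK.gradSpace := by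
  have hg := hasWeakGradient_of_hasFDerivAt hK.isOpen hφ hΨ.continuousOn
  obtain ⟨A⟩ := hK.exists_smoothingSeq
  obtain ⟨R, hR⟩ := hK.isBounded.closure.subset_closedBall x₀
  let b : ContDiffBump x₀ := ⟨|R| + 1, |R| + 2, by positivity, by linarith⟩
  have hb : ∀ x ∈ K, (b : E3 → ℝ) =ᶠ[𝓝 x] 1 := fun x hx => by
    refine b.eventuallyEq_one_of_mem_ball ?_
    have := hR (subset_closure hx)
    rw [Metric.mem_closedBall] at this
    rw [Metric.mem_ball]
    exact this.trans_lt (by linarith [le_abs_self R])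
  let u : ℕ → testSpace := fun n => ⟨fun x => b x * (A.D n).op φ x,
    b.contDiff.mul ((A.D n).contDiff_op hg.locallyIntegrable), b.hasCompactSupport.mul_right⟩
  have hu : ∀ n, ∀ x ∈ K, gradient (u n : E3 → ℝ) x = (A.D n).l • (A.D n).opVec Ψ x := by
    intro n x hx
    rw [← (A.D n).gradient_op hK.isOpen hg hx]
    simp only [gradient]
    congr 1
    refine Filter.EventuallyEq.fderiv_eq ?_
    filter_upwards [hb x hx] with y hy
    simp [u, hy]
  refine mem_of_tendsto_eLpNorm hK.isClosed_gradSpace _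
    (Ψ := fun n => gradient (u n : E3 → ℝ))
    (fun n => hK.memLp_of_continuous (continuous_gradient (testSpace.contDiff_one (u n))))
    (fun n => hK.gradL_mem (u n)) ?_
  refine (A.tendsto_eLpNorm_vec hK.isOpen (hK.memLp_of_continuous hΨ) A.tendsto_l).congr
    fun n => eLpNorm_congr_ae ?_
  filter_upwards [ae_restrict_mem hK.isOpen.measurableSet] with x hx
  rw [hu n x hx]

/-- The **Poincaré lemma** on a star-shaped domain, along the segments from the center: each of them
has a convex neighbourhood in the domain. -/
theorem exists_potential (hK : IsStarBall K x₀ r) {Ψ : E3 → E3} (hΨ : ContDiff ℝ 1 Ψ)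
    (hsymm : ∀ x ∈ K, ∀ u v, ⟪fderiv ℝ Ψ x u, v⟫ = ⟪fderiv ℝ Ψ x v, u⟫) :
    ∃ φ : E3 → ℝ, ∀ x ∈ K, HasFDerivAt φ (innerSL ℝ (Ψ x)) x := by
  refine ⟨fun b => ∫ᶜ x in .segment x₀ b, innerSL ℝ (Ψ x), fun b hb => ?_⟩
  have hsub : segment ℝ x₀ b ⊆ K :=
    (hK.star x₀ (Metric.mem_ball_self hK.r_pos)).segment_subset hb
  have hcompact : IsCompact (segment ℝ x₀ b) := by
    rw [segment_eq_image]
    exact isCompact_Icc.image (by fun_prop)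
  obtain ⟨δ, hδ, hδK⟩ := hcompact.exists_thickening_subset_open hK.isOpen hsub
  set s := Metric.thickening δ (segment ℝ x₀ b) with hs
  have hsc : Convex ℝ s := (convex_segment x₀ b).thickening δ
  have hmem : ∀ y ∈ segment ℝ x₀ b, y ∈ s := fun y hy => Metric.self_subset_thickening hδ _ hy
  have hform : ∀ x, HasFDerivAt (fun x => innerSL ℝ (Ψ x)) ((innerSL ℝ).comp (fderiv ℝ Ψ x)) x :=
    fun x => (innerSL ℝ (E := E3)).hasFDerivAt.comp x (hΨ.differentiable (by norm_num) x).hasFDerivAt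
  have h := hsc.hasFDerivWithinAt_curveIntegral_segment_of_hasFDerivWithinAt_symmetric
    (fun x _ => (hform x).hasFDerivWithinAt)
    (fun a ha x _ y _ => hsymm a (hδK ha) x y) (hmem x₀ (left_mem_segment _ _ _))
    (hmem b (right_mem_segment _ _ _))
  exact h.hasFDerivAt (Metric.isOpen_thickening.mem_nhds (hmem b (right_mem_segment _ _ _)))

/-- Curl free fields in `L²(K)` are limits of gradients. -/
theorem mem_gradSpace_of_curl_eq_zero (hK : IsStarBall K x₀ r) {ψ : E3 → E3}
    (hψ : MemLp ψ 2 (volume.restrict K)) (h : ∀ χ, IsTestFunction K χ → ∀ i : Fin 3,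
      ∫ x in K, ⟪ψ x, curlField χ (i + 1) (i + 2) x⟫ = 0) :
    hψ.toLp ψ ∈ hK.gradSpace := by
  have hKm := hK.isOpen.measurableSet
  have hl := locallyIntegrableOn_of_memLp hK.isOpen hψ
  have h' : ∀ χ, IsTestFunction K χ → ∀ j k : Fin 3, ∫ x in K, ⟪ψ x, curlField χ j k x⟫ = 0 := by
    intro χ hχ j k
    have hdiag : ∀ j, ∫ x in K, ⟪ψ x, curlField χ j j x⟫ = 0 := fun j => by
      simp [curlField]
    have hneg : ∀ j k, ∫ x in K, ⟪ψ x, curlField χ j k x⟫ = 0 →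
        ∫ x in K, ⟪ψ x, curlField χ k j x⟫ = 0 := fun j k h => by
      have : ∀ x, ⟪ψ x, curlField χ k j x⟫ = -⟪ψ x, curlField χ j k x⟫ := fun x => by
        rw [inner_curlField, inner_curlField]
        ring
      simp only [this]
      rw [integral_neg, h, neg_zero]
    have h0 := h χ hχ 0
    have h1 := h χ hχ 1
    have h2 := h χ hχ 2
    fin_cases j <;> fin_cases k
    · exact hdiag 0
    · exact h2
    · exact hneg _ _ h1
    · exact hneg _ _ h2
    · exact hdiag 1
    · exact h0
    · exact h1
    · exact hneg _ _ h0
    · exact hdiag 2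
  obtain ⟨A⟩ := hK.exists_smoothingSeq
  have hsm : ∀ n, ContDiff ℝ 1 ((A.D n).opVec ψ) := fun n =>
    contDiff_infty.1 ((A.D n).contDiff_opVec_of_memLp hK.isOpen hψ) 1
  refine mem_of_tendsto_eLpNorm hK.isClosed_gradSpace hψ (Ψ := fun n => (A.D n).opVec ψ)
    (fun n => hK.memLp_of_continuous (hsm n).continuous) (fun n => ?_) ?_
  swap
  · simpa using A.tendsto_eLpNorm_vec hK.isOpen hψ tendsto_const_nhds
  have hcomp : ∀ x v (j : Fin 3), (fderiv ℝ ((A.D n).opVec ψ) x v) j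
      = fderiv ℝ ((A.D n).op fun y => ψ y j) x v := by
    intro x v j
    have h1 : HasFDerivAt ((A.D n).opVec ψ) (fderiv ℝ ((A.D n).opVec ψ) x) x :=
      ((hsm n).differentiable (by norm_num) x).hasFDerivAt
    have h2 := (EuclideanSpace.proj (𝕜 := ℝ) j).hasFDerivAt.comp x h1
    have h3 : fderiv ℝ ((A.D n).op fun y => ψ y j) x = _ := h2.fderiv
    rw [h3]
    rfl
  -- the smoothed field is curl free in the classical sense: the kernel is a test function
  have hsym : ∀ x ∈ K, ∀ j k : Fin 3,
      fderiv ℝ ((A.D n).op fun y => ψ y j) x (EuclideanSpace.single k 1)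
        = fderiv ℝ ((A.D n).op fun y => ψ y k) x (EuclideanSpace.single j 1) := by
    intro x hx j k
    have hχ := (A.D n).isTestFunction_kernel hx
    rw [(A.D n).fderiv_op hKm (locallyIntegrableOn_apply hl j) hx,
      (A.D n).fderiv_op hKm (locallyIntegrableOn_apply hl k) hx]
    congr 1
    have h1 := h' _ hχ j k
    simp only [inner_curlField] at h1
    have hint : ∀ j k : Fin 3, IntegrableOn (fun x' => ψ x' j *
        fderiv ℝ ((A.D n).kernel x) x' (EuclideanSpace.single k 1)) K := fun j k => by
      have hk := isTestFunction_fderiv hχ (EuclideanSpace.single k 1)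
      exact integrableOn_smul_of_tsupport_subset' (locallyIntegrableOn_apply hl j)
        hk.smooth.continuous hk.compact hk.support_subset
    rw [integral_sub (hint j k) (hint k j), sub_eq_zero] at h1
    simp only [mul_comm (fderiv ℝ ((A.D n).kernel x) _ _)]
    exact h1
  have hexp : ∀ x u v : E3, ⟪fderiv ℝ ((A.D n).opVec ψ) x u, v⟫ = ∑ j, ∑ k,
      u k * fderiv ℝ ((A.D n).op fun y => ψ y j) x (EuclideanSpace.single k 1) * v j := by
    intro x u v
    rw [inner_eq_sum]
    refine Finset.sum_congr rfl fun j _ => ?_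
    rw [hcomp, ← Finset.sum_mul]
    congr 1
    have hu : u = ∑ k : Fin 3, u k • EuclideanSpace.single k (1 : ℝ) := by
      ext j
      simp [Finset.sum_apply, Pi.single_apply]
    conv_lhs => rw [hu, map_sum]
    simp
  obtain ⟨φ, hφ⟩ := hK.exists_potential (hsm n) fun x hx u v => by
    rw [hexp, hexp, Finset.sum_comm]
    refine Finset.sum_congr rfl fun j _ => Finset.sum_congr rfl fun k _ => ?_
    rw [hsym x hx k j]
    ring
  exact hK.mem_gradSpace_of_hasFDerivAt (hsm n).continuous hφ

end IsStarBall

/-! ### Bounds for the boundary functional -/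

namespace PolyhedralElement

variable {P : PolyhedralElement} {x₀ : E3} {r h a : ℝ}

theorem enorm_faceIntegral_le (x₀ : E3) (i : Fin P.numFaces) (f : E3 → ℝ) :
    ‖P.faceIntegral i f‖ₑ ≤ ∫⁻ u in P.base x₀ i, ‖f (P.facePt x₀ i u)‖ₑ := by
  rw [faceIntegral_eq x₀]
  exact enorm_integral_le_lintegral_enorm _

theorem faceIntegral_sub_const (x₀ : E3) (i : Fin P.numFaces) {f : E3 → ℝ} (hf : Continuous f)
    (m : ℝ) : P.faceIntegral i (fun x => f x - m)
      = P.faceIntegral i f - m * P.faceIntegral i (fun _ => 1) := by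
  simp only [faceIntegral_eq x₀]
  rw [integral_sub (integrableOn_face x₀ i hf) (integrableOn_face x₀ i continuous_const),
    ← integral_const_mul]
  simp

/-- The area of the boundary is at most `3 |K| / r`. -/
theorem sum_enorm_faceIntegral_one_le (hP : IsStarBall P.K x₀ r)
    (hh : ∀ x ∈ P.K, ∀ y ∈ P.K, dist x y ≤ h) :
    ∑ i, ‖P.faceIntegral i (fun _ => 1)‖ₑ ≤ ENNReal.ofReal (3 / r) * volume P.K := by
  have h1 := sum_lintegral_face_le hP hh (contDiff_const (c := (1 : ℝ)))
  have hg : ∀ x : E3, gradient (fun _ : E3 => (1 : ℝ)) x = 0 := fun x => by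
    simp [gradient]
  simp only [hg, enorm_zero, mul_zero, add_zero, enorm_one, mul_one, setLIntegral_const] at h1
  refine (Finset.sum_le_sum fun i _ => enorm_faceIntegral_le x₀ i _).trans ?_
  simp only [enorm_one, setLIntegral_const]
  refine h1.trans (le_of_eq ?_)
  rw [← mul_assoc, div_eq_inv_mul, ENNReal.ofReal_mul (inv_nonneg.2 hP.r_pos.le)]
  simp

/-- The functional on the right-hand side of Green's formula is bounded by the gradient, as it
vanishes on constants. -/
theorem enorm_boundary_functional_le (hP : IsStarBall P.K x₀ r)
    (hh : ∀ x ∈ P.K, ∀ y ∈ P.K, dist x y ≤ h) (ha : 0 < a) (hpos : 0 < h) (har : a * h ≤ r)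
    {c : Fin P.numFaces → ℝ} {M d₀ : ℝ} (hM : 0 ≤ M) (hc : ∀ i, |c i| ≤ M)
    (hd : d₀ * volume.real P.K = ∑ i, c i * P.faceIntegral i (fun _ => 1)) {φ : E3 → ℝ}
    (hφ : ContDiff ℝ 1 φ) :
    ‖(∑ i, c i * P.faceIntegral i φ) - d₀ * ∫ x in P.K, φ x‖ₑ
      ≤ ENNReal.ofReal (2 * traceConst a * (√h * h) * M)
        * eLpNorm (gradient φ) 2 (volume.restrict P.K) := by
  have hr := hP.r_pos
  have hφc := hφ.continuous
  set m := ⨍ y in Metric.ball x₀ r, φ y with hm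
  set N := eLpNorm (gradient φ) 2 (volume.restrict P.K) with hN
  have hce : ∀ i, ‖c i‖ₑ ≤ ENNReal.ofReal M := fun i => by
    rw [← ofReal_norm]
    exact ENNReal.ofReal_le_ofReal (hc i)
  have hV0 : volume P.K ≠ 0 := hP.volume_pos.ne'
  have hVt : volume P.K ≠ ⊤ := hP.volume_lt_top.ne
  -- the area of the boundary is at most `3 |K| / r`
  have hd0 : ‖d₀‖ₑ ≤ ENNReal.ofReal (3 / r * M) := by
    have h1 : ‖d₀‖ₑ * volume P.K ≤ ENNReal.ofReal (3 / r * M) * volume P.K := by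
      calc ‖d₀‖ₑ * volume P.K = ‖d₀ * volume.real P.K‖ₑ := by
            rw [enorm_mul, Real.enorm_of_nonneg measureReal_nonneg, measureReal_def,
              ENNReal.ofReal_toReal hVt]
        _ ≤ ∑ i, ‖c i * P.faceIntegral i (fun _ => 1)‖ₑ := by
            rw [hd]
            exact enorm_sum_le _ _
        _ ≤ ∑ i, ENNReal.ofReal M * ‖P.faceIntegral i (fun _ => 1)‖ₑ := by
            refine Finset.sum_le_sum fun i _ => ?_
            rw [enorm_mul]
            gcongr
            exact hce i
        _ ≤ ENNReal.ofReal M * (ENNReal.ofReal (3 / r) * volume P.K) := by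
            rw [← Finset.mul_sum]
            gcongr
            exact sum_enorm_faceIntegral_one_le hP hh
        _ = _ := by
            rw [← mul_assoc, ← ENNReal.ofReal_mul hM, mul_comm M]
    exact (ENNReal.mul_le_mul_iff_left hV0 hVt).1 h1
  -- as the functional vanishes on constants, the mean value `m` can be subtracted from `φ`
  have hsplit : (∑ i, c i * P.faceIntegral i φ) - d₀ * ∫ x in P.K, φ x
      = (∑ i, c i * P.faceIntegral i (fun x => φ x - m)) - d₀ * ∫ x in P.K, (φ x - m) := by
    have h1 : ∫ x in P.K, (φ x - m) = (∫ x in P.K, φ x) - m * volume.real P.K := by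
      have := hP.isFiniteMeasure
      rw [integral_sub (hP.integrableOn_of_continuous hφc) (integrable_const m),
        setIntegral_const, smul_eq_mul, mul_comm]
    simp only [faceIntegral_sub_const x₀ _ hφc, mul_sub]
    rw [h1, Finset.sum_sub_distrib]
    have h2 : ∑ i, c i * (m * P.faceIntegral i (fun _ => 1)) = m * (d₀ * volume.real P.K) := by
      rw [hd, Finset.mul_sum]
      exact Finset.sum_congr rfl fun i _ => by ring
    rw [h2]
    ring
  have hface : ‖∑ i, c i * P.faceIntegral i (fun x => φ x - m)‖ₑ
      ≤ ENNReal.ofReal (M * (traceConst a * (√h * h))) * N := by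
    calc _ ≤ ∑ i, ENNReal.ofReal M * ∫⁻ u in P.base x₀ i, ‖φ (P.facePt x₀ i u) - m‖ₑ := by
          refine (enorm_sum_le _ _).trans (Finset.sum_le_sum fun i _ => ?_)
          rw [enorm_mul]
          exact mul_le_mul' (hce i) (enorm_faceIntegral_le x₀ i _)
      _ ≤ _ := by
          rw [← Finset.mul_sum, ENNReal.ofReal_mul hM, mul_assoc]
          exact mul_le_mul_right (sum_lintegral_face_sub_average_le hP hh ha hpos har hφ) _
  have hvol : ‖∫ x in P.K, (φ x - m)‖ₑ
      ≤ ENNReal.ofReal (3 * (h * √h) * (√(10 / a ^ 3) * h)) * N := by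
    have h2 : eLpNorm (fun x => φ x - m) 2 (volume.restrict P.K)
        ≤ ENNReal.ofReal (√(10 / a ^ 3) * h) * N := by
      have := hP.poincare_smooth hh ha hpos har hφ
      rw [← Real.sq_sqrt (show (0 : ℝ) ≤ 10 / a ^ 3 by positivity), ← mul_pow,
        ENNReal.ofReal_pow (by positivity), ← mul_pow] at this
      exact (ENNReal.pow_le_pow_left_iff (by norm_num)).1 this
    refine (enorm_integral_le_lintegral_enorm _).trans ?_
    refine (lintegral_enorm_le_eLpNorm_two (by fun_prop)).trans ?_
    rw [Measure.restrict_apply_univ, ENNReal.ofReal_mul (by positivity), mul_assoc]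
    exact mul_le_mul' (rpow_half_volume_le hP hh hpos) h2
  have htc := traceConst_pos ha
  calc _ ≤ ENNReal.ofReal (M * (traceConst a * (√h * h))) * N
        + ENNReal.ofReal (3 / r * M) *
          (ENNReal.ofReal (3 * (h * √h) * (√(10 / a ^ 3) * h)) * N) := by
        rw [hsplit]
        refine (enorm_sub_le (a := ∑ i, c i * P.faceIntegral i (fun x => φ x - m))).trans ?_
        rw [enorm_mul d₀]
        gcongr
    _ ≤ _ := by
        rw [← mul_assoc (ENNReal.ofReal (3 / r * M)), ← ENNReal.ofReal_mul (by positivity), ← add_mul,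
          ← ENNReal.ofReal_add (by positivity) (by positivity)]
        gcongr ENNReal.ofReal ?_ * _
        have h3 : 3 / r * M * (3 * (h * √h) * (√(10 / a ^ 3) * h))
            ≤ 3 / (a * h) * M * (3 * (h * √h) * (√(10 / a ^ 3) * h)) := by
          gcongr
        have h4 : 3 / (a * h) * M * (3 * (h * √h) * (√(10 / a ^ 3) * h))
            ≤ M * (traceConst a * (√h * h)) := by
          have h5 : 3 / (a * h) * M * (3 * (h * √h) * (√(10 / a ^ 3) * h))
              = M * (9 * √(10 / a ^ 3) / a * (√h * h)) := by
            field_simp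
            ring
          have h6 : 9 * √(10 / a ^ 3) / a ≤ traceConst a := by
            rw [traceConst]
            exact div_le_div_of_nonneg_right (by linarith) ha.le
          rw [h5]
          exact mul_le_mul_of_nonneg_left (mul_le_mul_of_nonneg_right h6 (by positivity)) hM
        linarith

end PolyhedralElement

/-! ### Existence in the face space -/

/-- Green's formula implies the identity of the weak divergence, since test functions vanish on the
faces. -/
theorem HasFaceNormalComponents.hasWeakDiv {P : PolyhedralElement} {ψ : E3 → E3} {d : E3 → ℝ}
    {c : Fin P.numFaces → ℝ} (h : HasFaceNormalComponents P ψ d c)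
    (hψ : LocallyIntegrableOn ψ P.K volume) (hd : LocallyIntegrableOn d P.K volume) :
    HasWeakDiv P.K ψ d := by
  refine ⟨hψ, hd, fun φ hφ => ?_⟩
  have h1 := h φ hφ.smooth hφ.compact
  have h2 : ∀ i, P.faceIntegral i (fun x => c i * φ x) = 0 := fun i => by
    rw [PolyhedralElement.faceIntegral]
    refine setIntegral_eq_zero_of_forall_eq_zero fun x hx => ?_
    have hx' : x ∉ P.K := by
      have := PolyhedralElement.face_subset_frontier i hx
      rw [P.isOpen.frontier_eq] at this
      exact this.2
    rw [image_eq_zero_of_notMem_tsupport fun h => hx' (hφ.support_subset h), mul_zero]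
  simp only [h2, Finset.sum_const_zero] at h1
  linarith

/-- A bump function in a ball of radius `r`, with derivatives of order `1 / r`. -/
theorem exists_bump : ∃ Λ : ℝ, 0 < Λ ∧ ∀ (K : Set E3) (x₀ : E3) (r : ℝ), IsStarBall K x₀ r →
    ∃ χ : E3 → ℝ, IsTestFunction K χ ∧ r ^ 3 / 16 ≤ ∫ x in K, χ x ∧
      ∀ x, ‖fderiv ℝ χ x‖ ≤ Λ / r := by
  let β : ContDiffBump (0 : E3) := ⟨1 / 4, 1 / 2, by norm_num, by norm_num⟩
  obtain ⟨C, hC⟩ := (β.contDiff (n := 1)).continuous_fderiv (by norm_num)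
    |>.bounded_above_of_compact_support (β.hasCompactSupport.fderiv (𝕜 := ℝ))
  refine ⟨|C| + 1, by positivity, fun K x₀ r hK => ?_⟩
  have hr := hK.r_pos
  -- a fixed bump function, scaled to the ball of radius `r / 2`
  set χ : E3 → ℝ := fun x => β (r⁻¹ • (x - x₀)) with hχ
  have hsupp : tsupport χ ⊆ Metric.closedBall x₀ (r / 2) := by
    refine closure_minimal (fun x hx => ?_) Metric.isClosed_closedBall
    have h1 : r⁻¹ • (x - x₀) ∈ Function.support (β : E3 → ℝ) := hx
    rw [β.support_eq, mem_ball_zero_iff, norm_smul, norm_inv, Real.norm_of_nonneg hr.le] at h1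
    rw [Metric.mem_closedBall, dist_eq_norm]
    have h2 : r⁻¹ * ‖x - x₀‖ < 1 / 2 := h1
    rw [inv_mul_lt_iff₀ hr] at h2
    linarith
  have hsm : ContDiff ℝ ∞ χ := β.contDiff.comp (by fun_prop)
  have hball : Metric.closedBall x₀ (r / 2) ⊆ K := (Metric.closedBall_subset_ball
    (by linarith)).trans hK.ball_subset_self
  refine ⟨χ, ⟨hsm, (isCompact_closedBall x₀ (r / 2)).of_isClosed_subset
    (isClosed_tsupport _) hsupp, hsupp.trans hball⟩, ?_, fun x => ?_⟩
  · have hint : IntegrableOn χ K := hK.integrableOn_of_continuous hsm.continuous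
    have hsub : Metric.ball x₀ (r / 4) ⊆ K :=
      (Metric.ball_subset_ball (by linarith)).trans hK.ball_subset_self
    have h1 : ENNReal.ofReal (r ^ 3 / 16) ≤ volume (Metric.ball x₀ (r / 4)) := by
      have := IsStarBall.le_volume_ball (x₀ := x₀) (r := r / 4) one_pos (h := r / 4)
        (by positivity) (by rw [one_mul])
      refine le_trans (ENNReal.ofReal_le_ofReal (le_of_eq ?_)) this
      ring
    calc r ^ 3 / 16 ≤ volume.real (Metric.ball x₀ (r / 4)) := by
          rw [measureReal_def, ← ENNReal.ofReal_le_iff_le_toReal measure_ball_lt_top.ne]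
          exact h1
      _ = ∫ x in Metric.ball x₀ (r / 4), (1 : ℝ) := by simp
      _ = ∫ x in Metric.ball x₀ (r / 4), χ x := by
          refine setIntegral_congr_fun Metric.isOpen_ball.measurableSet fun x hx => ?_
          refine (β.one_of_mem_closedBall ?_).symm
          rw [Metric.mem_ball, dist_eq_norm] at hx
          rw [mem_closedBall_zero_iff, norm_smul, norm_inv, Real.norm_of_nonneg hr.le]
          change r⁻¹ * ‖x - x₀‖ ≤ 1 / 4
          rw [inv_mul_le_iff₀ hr]
          linarith
      _ ≤ ∫ x in K, χ x :=
          setIntegral_mono_set hint (Eventually.of_forall fun x => β.nonneg) hsub.eventuallyLE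
  · have h1 : HasFDerivAt (fun x : E3 => r⁻¹ • (x - x₀)) (r⁻¹ • ContinuousLinearMap.id ℝ E3) x :=
      ((hasFDerivAt_id x).sub_const x₀).const_smul r⁻¹
    have h2 := ((β.contDiff (n := 1)).differentiable (by norm_num)
      (r⁻¹ • (x - x₀))).hasFDerivAt.comp x h1
    have h3 : fderiv ℝ χ x = _ := h2.fderiv
    rw [h3, ContinuousLinearMap.comp_smul, ContinuousLinearMap.comp_id, norm_smul, norm_inv,
      Real.norm_of_nonneg hr.le, inv_mul_eq_div]
    gcongr
    exact (hC _).trans (by linarith [le_abs_self C])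

namespace IsStarBall

variable {K : Set E3} {x₀ : E3} {r : ℝ}

/-- The field `rotField b q` in `L²(K)`, as a function of its curl `q`. -/
def rotL (hK : IsStarBall K x₀ r) (b : E3) : E3 →ₗ[ℝ] Lp E3 2 (volume.restrict K) where
  toFun q := (hK.memLp_of_continuous (continuous_rotField b q)).toLp (rotField b q)
  map_add' q q' := by
    rw [← MemLp.toLp_add]
    congr 1
    exact rotField_add b q q'
  map_smul' c q := by
    rw [RingHom.id_apply, ← MemLp.toLp_const_smul]
    congr 1
    exact rotField_smul b c q

/-- The component of `rotField b q` that is orthogonal to the gradients. -/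
def rotPerp (hK : IsStarBall K x₀ r) (b : E3) : E3 →ₗ[ℝ] Lp E3 2 (volume.restrict K) :=
  hK.rotL b - hK.gradSpace.starProjection.toLinearMap ∘ₗ hK.rotL b

theorem rotPerp_apply (hK : IsStarBall K x₀ r) (b q : E3) :
    hK.rotPerp b q = hK.rotL b q - hK.gradSpace.starProjection (hK.rotL b q) := rfl

theorem rotPerp_mem_orthogonal (hK : IsStarBall K x₀ r) (b q : E3) :
    hK.rotPerp b q ∈ hK.gradSpaceᗮ :=
  hK.gradSpace.sub_starProjection_mem_orthogonal _

/-- The class of `curlField χ (i + 1) (i + 2)` in `L²(K)`. -/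
def curlL (hK : IsStarBall K x₀ r) {χ : E3 → ℝ} (hχ : IsTestFunction K χ) (i : Fin 3) :
    Lp E3 2 (volume.restrict K) :=
  (hK.memLp_of_continuous (continuous_curlField hχ.contDiff_one (i + 1) (i + 2))).toLp _

theorem inner_curlL (hK : IsStarBall K x₀ r) {ψ : E3 → E3} (hψ : MemLp ψ 2 (volume.restrict K))
    {χ : E3 → ℝ} (hχ : IsTestFunction K χ) (i : Fin 3) :
    ⟪hψ.toLp ψ, hK.curlL hχ i⟫ = ∫ x in K, ⟪ψ x, curlField χ (i + 1) (i + 2) x⟫ :=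
  inner_toLp hψ (hK.memLp_of_continuous (continuous_curlField hχ.contDiff_one (i + 1) (i + 2)))

theorem inner_curlL_eq_zero (hK : IsStarBall K x₀ r) {u : Lp E3 2 (volume.restrict K)}
    (hu : u ∈ hK.gradSpace) {χ : E3 → ℝ} (hχ : IsTestFunction K χ) (i : Fin 3) :
    ⟪u, hK.curlL hχ i⟫ = 0 := by
  rw [← Lp.toLp_coeFn u (Lp.memLp u)] at hu ⊢
  rw [inner_curlL, hK.integral_inner_curlField_of_mem_gradSpace _ hu hχ]

theorem mem_gradSpace_of_inner_curlL (hK : IsStarBall K x₀ r) {u : Lp E3 2 (volume.restrict K)}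
    (h : ∀ χ, ∀ hχ : IsTestFunction K χ, ∀ i, ⟪u, hK.curlL hχ i⟫ = 0) : u ∈ hK.gradSpace := by
  rw [← Lp.toLp_coeFn u (Lp.memLp u)]
  refine hK.mem_gradSpace_of_curl_eq_zero _ fun χ hχ i => ?_
  have h1 := h χ hχ i
  rw [← Lp.toLp_coeFn u (Lp.memLp u), inner_curlL] at h1
  exact h1

theorem inner_rotL_curlL (hK : IsStarBall K x₀ r) (b q : E3) {χ : E3 → ℝ}
    (hχ : IsTestFunction K χ) (i : Fin 3) :
    ⟪hK.rotL b q, hK.curlL hχ i⟫ = q i * ∫ x in K, χ x :=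
  (hK.inner_curlL (hK.memLp_of_continuous (continuous_rotField b q)) hχ i).trans (integral_inner_rotField_curlField hK.isOpen b q hχ i)

theorem inner_rotPerp_curlL (hK : IsStarBall K x₀ r) (b q : E3) {χ : E3 → ℝ}
    (hχ : IsTestFunction K χ) (i : Fin 3) :
    ⟪hK.rotPerp b q, hK.curlL hχ i⟫ = q i * ∫ x in K, χ x := by
  rw [rotPerp_apply, inner_sub_left, inner_rotL_curlL,
    hK.inner_curlL_eq_zero (Submodule.starProjection_apply_mem _ _), sub_zero]

/-- A prescribed moment against the fields `rotField b q` is matched by a field that is orthogonal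
to the gradients and has a constant curl. The Gram matrix of the fields `rotPerp b q` is regular,
as their curl is `q`. -/
theorem exists_rotPerp (hK : IsStarBall K x₀ r) (b : E3) (u : Lp E3 2 (volume.restrict K)) :
    ∃ q, ∀ q', ⟪u + hK.rotPerp b q, hK.rotL b q'⟫ = 0 := by
  -- the matrix is injective, hence surjective, as its quadratic form is `‖rotPerp b q‖²`
  let A : E3 →ₗ[ℝ] E3 →ₗ[ℝ] ℝ := (innerₗ (Lp E3 2 (volume.restrict K))).compl₁₂ (hK.rotPerp b)
    (hK.rotL b)
  have hA : ∀ q q', A q q' = ⟪hK.rotPerp b q, hK.rotL b q'⟫ := fun _ _ => rfl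
  have hinj : Function.Injective A := by
    rw [← LinearMap.ker_eq_bot, LinearMap.ker_eq_bot']
    intro q hq
    have h1 : ⟪hK.rotPerp b q, hK.rotL b q⟫ = 0 := by
      rw [← hA, hq, LinearMap.zero_apply]
    have h2 : ⟪hK.rotPerp b q, hK.rotPerp b q⟫ = 0 := by
      nth_rewrite 2 [rotPerp_apply]
      rw [inner_sub_right, h1, Submodule.inner_left_of_mem_orthogonal
        (Submodule.starProjection_apply_mem _ _) (hK.rotPerp_mem_orthogonal b q), sub_zero]
    have h3 : hK.rotPerp b q = 0 := inner_self_eq_zero.1 h2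
    obtain ⟨Λ, -, hΛ⟩ := exists_bump
    obtain ⟨χ, hχ, hχ1, -⟩ := hΛ K x₀ r hK
    have hpos : 0 < ∫ x in K, χ x := lt_of_lt_of_le (by have := hK.r_pos; positivity) hχ1
    ext i
    have h4 := hK.inner_rotPerp_curlL b q hχ i
    rw [h3, inner_zero_left] at h4
    simpa [hpos.ne'] using h4.symm
  have hsurj : Function.Surjective A :=
    (LinearMap.injective_iff_surjective_of_finrank_eq_finrank
      (Subspace.dual_finrank_eq (K := ℝ) (V := E3)).symm).1 hinj
  obtain ⟨q, hq⟩ := hsurj (-(innerₗ (Lp E3 2 (volume.restrict K)) u).comp (hK.rotL b))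
  refine ⟨q, fun q' => ?_⟩
  have h1 := LinearMap.congr_fun hq q'
  rw [hA] at h1
  rw [inner_add_left, h1]
  simp

end IsStarBall

namespace PolyhedralElement

variable {P : PolyhedralElement} {x₀ : E3} {r h a : ℝ}

theorem faceIntegral_const_mul (i : Fin P.numFaces) (c : ℝ) (f : E3 → ℝ) :
    P.faceIntegral i (fun x => c * f x) = c * P.faceIntegral i f :=
  integral_const_mul _ _

/-- The functional on the right-hand side of Green's formula. -/
def boundaryFunctional (hP : IsStarBall P.K x₀ r) (c : Fin P.numFaces → ℝ) (d₀ : ℝ) :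
    testSpace →ₗ[ℝ] ℝ where
  toFun φ := (∑ i, c i * P.faceIntegral i φ) - d₀ * ∫ x in P.K, (φ : E3 → ℝ) x
  map_add' φ χ := by
    have h1 := fun i => integrableOn_face (P := P) x₀ i (testSpace.contDiff φ).continuous
    have h2 := fun i => integrableOn_face (P := P) x₀ i (testSpace.contDiff χ).continuous
    simp only [Submodule.coe_add, Pi.add_apply, faceIntegral_eq x₀]
    rw [integral_add (hP.integrableOn_of_continuous (testSpace.contDiff φ).continuous)
      (hP.integrableOn_of_continuous (testSpace.contDiff χ).continuous)]
    simp only [integral_add (h1 _) (h2 _), mul_add, Finset.sum_add_distrib]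
    ring
  map_smul' t φ := by
    simp only [Submodule.coe_smul, Pi.smul_apply, smul_eq_mul, faceIntegral_eq x₀,
      integral_const_mul, RingHom.id_apply, mul_sub, Finset.mul_sum]
    congr 1
    · exact Finset.sum_congr rfl fun i _ => by ring
    · ring

/-- Green's formula says that the field represents the boundary functional on the gradients. -/
theorem hasFaceNormalComponents_iff (hP : IsStarBall P.K x₀ r) {ψ : E3 → E3}
    (hψ : MemLp ψ 2 (volume.restrict P.K)) (c : Fin P.numFaces → ℝ) (d₀ : ℝ) :
    HasFaceNormalComponents P ψ (fun _ => d₀) c ↔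
      ∀ φ, ⟪hψ.toLp ψ, hP.gradL φ⟫ = boundaryFunctional hP c d₀ φ := by
  have key : ∀ φ : E3 → ℝ, (∫ x in P.K, ⟪ψ x, gradient φ x⟫) + (∫ x in P.K, φ x * d₀)
      = ∑ i, P.faceIntegral i (fun x => c i * φ x) ↔ ∫ x in P.K, ⟪ψ x, gradient φ x⟫
      = (∑ i, c i * P.faceIntegral i φ) - d₀ * ∫ x in P.K, φ x := fun φ => by
    simp only [faceIntegral_const_mul]
    rw [integral_mul_const, mul_comm _ d₀, eq_sub_iff_add_eq]
  constructor
  · intro h φ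
    rw [hP.inner_gradL hψ]
    exact (key φ).1 (h φ φ.2.1 φ.2.2)
  · intro h φ h1 h2
    refine (key φ).2 ?_
    have := h ⟨φ, h1, h2⟩
    rw [hP.inner_gradL hψ] at this
    exact this

theorem abs_boundaryFunctional_le (hP : IsStarBall P.K x₀ r)
    (hh : ∀ x ∈ P.K, ∀ y ∈ P.K, dist x y ≤ h) (ha : 0 < a) (hpos : 0 < h) (har : a * h ≤ r)
    {c : Fin P.numFaces → ℝ} {M d₀ : ℝ} (hM : 0 ≤ M) (hc : ∀ i, |c i| ≤ M)
    (hd : d₀ * volume.real P.K = ∑ i, c i * P.faceIntegral i (fun _ => 1)) (φ : testSpace) :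
    |boundaryFunctional hP c d₀ φ| ≤ 2 * traceConst a * (√h * h) * M * ‖hP.gradL φ‖ := by
  have htc := traceConst_pos ha
  have h1 := enorm_boundary_functional_le hP hh ha hpos har hM hc hd (testSpace.contDiff_one φ)
  rw [← hP.enorm_gradL, ← ENNReal.ofReal_mul (by positivity), ← ofReal_norm,
    ENNReal.ofReal_le_ofReal_iff (by positivity)] at h1
  exact h1

/-- Green's formula for the constant function `1`. -/
theorem mul_volume_eq_of_hasFaceNormalComponents (hP : IsStarBall P.K x₀ r) {ψ : E3 → E3}
    {c : Fin P.numFaces → ℝ} {d₀ : ℝ} (h : HasFaceNormalComponents P ψ (fun _ => d₀) c) :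
    d₀ * volume.real P.K = ∑ i, c i * P.faceIntegral i (fun _ => 1) := by
  obtain ⟨χ, hχ, hχc, hχ1⟩ := exists_cutoff hP
  have h1 := h χ hχ hχc
  have h2 : ∀ x ∈ P.K, gradient χ x = 0 := fun x hx => by
    rw [gradient, (hχ1 x (subset_closure hx)).fderiv_eq]
    simp
  have h3 : ∫ x in P.K, ⟪ψ x, gradient χ x⟫ = 0 :=
    setIntegral_eq_zero_of_forall_eq_zero fun x hx => by rw [h2 x hx, inner_zero_right]
  have h4 : ∫ x in P.K, χ x * d₀ = d₀ * volume.real P.K := by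
    have : ∫ x in P.K, χ x * d₀ = ∫ _ in P.K, d₀ :=
      setIntegral_congr_fun P.isOpen.measurableSet fun x hx => by
        simp [(hχ1 x (subset_closure hx)).eq_of_nhds]
    rw [this, setIntegral_const, smul_eq_mul, mul_comm]
  have h5 : ∀ i, P.faceIntegral i χ = P.faceIntegral i (fun _ => 1) := fun i => by
    rw [faceIntegral_eq x₀, faceIntegral_eq x₀]
    refine setIntegral_congr_fun (isOpen_base i).measurableSet fun u hu => ?_
    exact (hχ1 _ (facePt_mem_closure hu)).eq_of_nhds
  rw [h3, h4, zero_add] at h1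
  rw [h1]
  simp only [faceIntegral_const_mul, h5]

/-- Unisolvence, existence part: normal components on the faces can be prescribed in the face
space. -/
theorem exists_memFaceSpaceWith (hP : IsStarBall P.K x₀ r) (c : Fin P.numFaces → ℝ) :
    ∃ ψ, MemFaceSpaceWith P ψ c := by
  obtain ⟨h, hpos, hh⟩ : ∃ h > 0, ∀ x ∈ P.K, ∀ y ∈ P.K, dist x y ≤ h := by
    obtain ⟨C, hC⟩ := Metric.isBounded_iff.1 P.isBounded
    exact ⟨max C 1, by positivity, fun x hx y hy => (hC hx hy).trans (le_max_left _ _)⟩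
  have hr := hP.r_pos
  -- the only divergence that is compatible with Green's formula for constants
  set d₀ : ℝ := (∑ i, c i * P.faceIntegral i (fun _ => 1)) / volume.real P.K with hd₀
  have hV : volume.real P.K ≠ 0 :=
    (ENNReal.toReal_pos hP.volume_pos.ne' hP.volume_lt_top.ne).ne'
  have hd : d₀ * volume.real P.K = ∑ i, c i * P.faceIntegral i (fun _ => 1) :=
    div_mul_cancel₀ _ hV
  obtain ⟨u, hu, hu'⟩ := exists_inner_eq_of_le hP.gradL (boundaryFunctional hP c d₀) _
    (abs_boundaryFunctional_le hP hh (a := r / h) (by positivity) hpos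
      (div_mul_cancel₀ _ hpos.ne').le (M := ∑ i, |c i|)
      (Finset.sum_nonneg fun _ _ => abs_nonneg _)
      (fun i => Finset.single_le_sum (f := fun i => |c i|) (fun _ _ => abs_nonneg _)
        (Finset.mem_univ i)) hd)
  obtain ⟨q, hq⟩ := hP.exists_rotPerp P.barycenter u
  set U := u + hP.rotPerp P.barycenter q with hU
  have hmem : MemLp U 2 (volume.restrict P.K) := Lp.memLp U
  have hUe : hmem.toLp U = U := Lp.toLp_coeFn U hmem
  have hl := locallyIntegrableOn_of_memLp P.isOpen hmem
  have hnormal : HasFaceNormalComponents P U (fun _ => d₀) c := by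
    rw [hasFaceNormalComponents_iff hP hmem]
    intro φ
    rw [hUe, hU, inner_add_left, hu', Submodule.inner_left_of_mem_orthogonal (hP.gradL_mem φ)
      (hP.rotPerp_mem_orthogonal _ q), add_zero]
  refine ⟨U, hmem, ⟨d₀, hnormal.hasWeakDiv hl
    (continuousOn_const.locallyIntegrableOn P.isOpen.measurableSet), hnormal⟩, ⟨q, ?_⟩, ?_⟩
  · rw [hasWeakCurl_const_iff P.isOpen hl]
    intro χ hχ i
    rw [← hP.inner_curlL hmem hχ, hUe, hU, inner_add_left, hP.inner_curlL_eq_zero hu hχ, zero_add,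
      hP.inner_rotPerp_curlL]
  · intro q'
    simp only [inner_cross_eq]
    have h1 := hq q'
    rw [← hUe] at h1
    rw [integral_const_mul, ← inner_toLp hmem (hP.memLp_of_continuous (continuous_rotField _ q'))]
    exact mul_eq_zero_of_right _ h1

theorem dist_barycenter_le (hP : IsStarBall P.K x₀ r) (hh : ∀ x ∈ P.K, ∀ y ∈ P.K, dist x y ≤ h)
    {x : E3} (hx : x ∈ P.K) : ‖x - P.barycenter‖ ≤ h := by
  have hfin := hP.isFiniteMeasure
  have hne : NeZero ((volume : Measure E3).restrict P.K) :=
    ⟨fun h => hP.volume_pos.ne' (by simpa using congrArg (fun μ : Measure E3 => μ univ) h)⟩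
  have h1 := (convex_closedBall x h).average_mem (μ := volume.restrict P.K)
    (f := fun y => y) Metric.isClosed_closedBall ?_
    (hP.integrableOn_of_continuous continuous_id)
  · rw [Metric.mem_closedBall, dist_comm, dist_eq_norm] at h1
    exact h1
  · filter_upwards [ae_restrict_mem P.isOpen.measurableSet] with y hy
    exact hh y hy x hx

/-- A bounded field has an `L²` norm of at most the bound times `|K|^(1/2)`, and `|K| ≤ 9 h³`. -/
theorem norm_toLp_le_of_forall_norm_le (hP : IsStarBall P.K x₀ r)
    (hh : ∀ x ∈ P.K, ∀ y ∈ P.K, dist x y ≤ h) (hpos : 0 < h) {f : E3 → E3}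
    (hf : MemLp f 2 (volume.restrict P.K)) {C : ℝ} (hC : 0 ≤ C) (hfC : ∀ x ∈ P.K, ‖f x‖ ≤ C) :
    ‖hf.toLp f‖ ≤ C * (3 * (h * √h)) := by
  have h1 := eLpNorm_le_of_ae_bound (p := 2) (μ := volume.restrict P.K) (f := f) (C := C)
    ((ae_restrict_mem P.isOpen.measurableSet).mono hfC)
  have h2 := rpow_half_volume_le hP hh hpos
  rw [Lp.norm_toLp]
  refine ENNReal.toReal_le_of_le_ofReal (by positivity) (h1.trans ?_)
  rw [Measure.restrict_apply_univ, mul_comm, ENNReal.ofReal_mul hC]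
  refine mul_le_mul' le_rfl (le_trans (le_of_eq ?_) h2)
  norm_num

end PolyhedralElement

/-! ### Stability of the face space -/

theorem norm_curlField_le (χ : E3 → ℝ) (j k : Fin 3) (x : E3) :
    ‖curlField χ j k x‖ ≤ 2 * ‖fderiv ℝ χ x‖ := by
  have h : ∀ j k : Fin 3, ‖fderiv ℝ χ x (EuclideanSpace.single k 1) •
      (EuclideanSpace.single j 1 : E3)‖ ≤ ‖fderiv ℝ χ x‖ := fun j k => by
    rw [norm_smul, PiLp.norm_single, norm_one, mul_one]
    simpa using (fderiv ℝ χ x).le_opNorm (EuclideanSpace.single k 1)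
  have h1 := h j k
  have h2 := h k j
  rw [curlField]
  exact (norm_sub_le _ _).trans (by linarith)

theorem norm_le_three_mul {v : E3} {B : ℝ} (h : ∀ i, |v i| ≤ B) : ‖v‖ ≤ 3 * B := by
  have hB : 0 ≤ B := (abs_nonneg _).trans (h 0)
  rw [EuclideanSpace.norm_eq]
  refine Real.sqrt_le_iff.2 ⟨by positivity, ?_⟩
  calc ∑ i, ‖v i‖ ^ 2 ≤ ∑ _i : Fin 3, B ^ 2 := Finset.sum_le_sum fun i _ => by
        rw [Real.norm_eq_abs]
        exact pow_le_pow_left₀ (abs_nonneg _) (h i) 2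
    _ ≤ (3 * B) ^ 2 := by
        simp only [Finset.sum_const, Finset.card_univ, Fintype.card_fin, nsmul_eq_mul]
        push_cast
        nlinarith [sq_nonneg B]

namespace IsStarBall

variable {K : Set E3} {x₀ : E3} {r : ℝ}

/-- A bound on gradients extends to their closure. -/
theorem abs_inner_le_of_mem_gradSpace (hK : IsStarBall K x₀ r)
    {u : Lp E3 2 (volume.restrict K)} {S : ℝ} (h : ∀ φ, |⟪u, hK.gradL φ⟫| ≤ S * ‖hK.gradL φ‖)
    {g : Lp E3 2 (volume.restrict K)} (hg : g ∈ hK.gradSpace) : |⟪u, g⟫| ≤ S * ‖g‖ := by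
  have hcl : IsClosed {g : Lp E3 2 (volume.restrict K) | |⟪u, g⟫| ≤ S * ‖g‖} :=
    isClosed_le (by fun_prop) (by fun_prop)
  refine closure_minimal ?_ hcl hg
  rintro _ ⟨φ, rfl⟩
  exact h φ

/-- Control of a field in `L²(K)` with constant curl: the part orthogonal to the gradients is
controlled by the part in the gradients when the moments against the fields `rotField b q'` vanish.
Here `B` is the ratio of `‖rotField b q‖` and that of the part with curl `q`. -/
theorem norm_le_of_inner_rotL_eq_zero (hK : IsStarBall K x₀ r) (b : E3)
    {u : Lp E3 2 (volume.restrict K)} {S B : ℝ} (hS : 0 ≤ S) (hB : 0 ≤ B)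
    (h : ∀ φ, |⟪u, hK.gradL φ⟫| ≤ S * ‖hK.gradL φ‖) {q : E3}
    (hq : ∀ χ, ∀ hχ : IsTestFunction K χ, ∀ i, ⟪u, hK.curlL hχ i⟫ = q i * ∫ x in K, χ x)
    (hrot : ⟪u, hK.rotL b q⟫ = 0)
    (hBq : ∀ η : Lp E3 2 (volume.restrict K),
      (∀ χ, ∀ hχ : IsTestFunction K χ, ∀ i, ⟪η, hK.curlL hχ i⟫ = q i * ∫ x in K, χ x) →
      ‖hK.rotL b q‖ ≤ B * ‖η‖) : ‖u‖ ≤ S * (1 + B) := by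
  -- `u = w + η` with `w` in the closure of the gradients and `η` orthogonal to it
  set w := hK.gradSpace.starProjection u with hw
  have hwm : w ∈ hK.gradSpace := Submodule.starProjection_apply_mem _ _
  set η := u - w with hη
  have hηo : η ∈ hK.gradSpaceᗮ := hK.gradSpace.sub_starProjection_mem_orthogonal u
  have hηw : ∀ g ∈ hK.gradSpace, ⟪η, g⟫ = 0 := fun g hg =>
    Submodule.inner_left_of_mem_orthogonal hg hηo
  have hwS : ‖w‖ ≤ S := by
    have h1 := hK.abs_inner_le_of_mem_gradSpace h hwm
    have h2 : ⟪u, w⟫ = ‖w‖ * ‖w‖ := by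
      rw [← real_inner_self_eq_norm_mul_norm, ← sub_eq_zero, ← inner_sub_left]
      exact hηw w hwm
    rw [h2, abs_of_nonneg (by positivity)] at h1
    by_contra! hlt
    nlinarith [hS.trans_lt hlt]
  have hcurl : ∀ χ, ∀ hχ : IsTestFunction K χ, ∀ i,
      ⟪η, hK.curlL hχ i⟫ = q i * ∫ x in K, χ x := fun χ hχ i => by
    rw [hη, inner_sub_left, hq, hK.inner_curlL_eq_zero hwm, sub_zero]
  -- both fields have the curl `q`, so that `‖η‖² = ⟪η, rotField b q⟫ = -⟪w, rotField b q⟫`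
  have hdiff : η - hK.rotL b q ∈ hK.gradSpace :=
    hK.mem_gradSpace_of_inner_curlL fun χ hχ i => by
      rw [inner_sub_left, hcurl, hK.inner_rotL_curlL, sub_self]
  have hsq : ‖η‖ * ‖η‖ = -⟪w, hK.rotL b q⟫ := by
    have h1 := hηw _ hdiff
    rw [inner_sub_right, real_inner_self_eq_norm_mul_norm, sub_eq_zero] at h1
    rw [h1, hη, inner_sub_left, hrot, zero_sub]
  have hηS : ‖η‖ ≤ S * B := by
    have h1 : ‖η‖ * ‖η‖ ≤ S * B * ‖η‖ := by
      rw [hsq]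
      calc -⟪w, hK.rotL b q⟫ ≤ ‖w‖ * ‖hK.rotL b q‖ :=
            (neg_le_abs _).trans (abs_real_inner_le_norm _ _)
        _ ≤ S * (B * ‖η‖) := by
            gcongr
            exact hBq η hcurl
        _ = _ := by ring
    by_contra! hlt
    nlinarith [(mul_nonneg hS hB).trans_lt hlt]
  calc ‖u‖ = ‖w + η‖ := by rw [hη, add_sub_cancel]
    _ ≤ _ := (norm_add_le _ _).trans (by linarith)

end IsStarBall

namespace PolyhedralElement

/-- The `L²` norm of a field of the face space is controlled by its normal components, with a
constant that depends only on the ratio `a` of the radius of the ball and the diameter. -/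
theorem exists_stability_constant {a : ℝ} (ha : 0 < a) : ∃ C > 0,
    ∀ (P : PolyhedralElement) (x₀ : E3) (r h : ℝ), IsStarBall P.K x₀ r →
    (∀ x ∈ P.K, ∀ y ∈ P.K, dist x y ≤ h) → 0 < h → a * h ≤ r →
    ∀ (ψ : E3 → E3) (c : Fin P.numFaces → ℝ) (M : ℝ), MemFaceSpaceWith P ψ c → 0 ≤ M →
    (∀ i, |c i| ≤ M) →
    eLpNorm ψ 2 (volume.restrict P.K) ≤ ENNReal.ofReal (C * (√h * h) * M) := by
  obtain ⟨Λ, hΛ, hbump⟩ := exists_bump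
  have htc := traceConst_pos ha
  refine ⟨2 * traceConst a * (1 + 864 * Λ / a ^ 4), by positivity, ?_⟩
  intro P x₀ r h hP hh hpos har ψ c M hψ hM hc
  obtain ⟨d₀, -, hn⟩ := hψ.div_normal
  obtain ⟨q, hq⟩ := hψ.curl
  have hl := locallyIntegrableOn_of_memLp P.isOpen hψ.memLp
  rw [hasWeakCurl_const_iff P.isOpen hl] at hq
  have hd := mul_volume_eq_of_hasFaceNormalComponents hP hn
  rw [hasFaceNormalComponents_iff hP hψ.memLp] at hn
  obtain ⟨χ, hχ, hχ1, hχ2⟩ := hbump P.K x₀ r hP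
  have hr := hP.r_pos
  have hss : √h * √h = h := Real.mul_self_sqrt hpos.le
  have key := hP.norm_le_of_inner_rotL_eq_zero P.barycenter (u := hψ.memLp.toLp ψ)
    (S := 2 * traceConst a * (√h * h) * M) (B := 864 * Λ / a ^ 4) (by positivity) (by positivity)
    (fun φ => by
      rw [hn φ]
      exact abs_boundaryFunctional_le hP hh ha hpos har hM hc hd φ)
    (q := q) (fun χ hχ i => by rw [hP.inner_curlL, hq χ hχ i]) (by
      have h1 := hψ.enhancing q
      simp only [inner_cross_eq] at h1
      rw [integral_const_mul] at h1
      refine (inner_toLp hψ.memLp (hP.memLp_of_continuous (continuous_rotField _ q))).trans ?_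
      simpa using h1) (fun η hη => by
      have hcl : ∀ i, ‖hP.curlL hχ i‖ ≤ 2 * (Λ / r) * (3 * (h * √h)) := fun i =>
        norm_toLp_le_of_forall_norm_le hP hh hpos
          (hP.memLp_of_continuous (continuous_curlField hχ.contDiff_one (i + 1) (i + 2)))
          (by positivity)
          fun x _ => (norm_curlField_le χ _ _ x).trans (by linarith [hχ2 x])
      -- the components of the constant curl, tested with the bump function `χ`
      have hqi : ∀ i, |q i| ≤ 96 * Λ * (h * √h) / r ^ 4 * ‖η‖ := fun i => by
        have h1 : |q i| * (r ^ 3 / 16) ≤ ‖η‖ * (2 * (Λ / r) * (3 * (h * √h))) := by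
          calc |q i| * (r ^ 3 / 16) ≤ |q i| * |∫ x in P.K, χ x| := by
                gcongr
                exact hχ1.trans (le_abs_self _)
            _ = |⟪η, hP.curlL hχ i⟫| := by rw [hη χ hχ i, abs_mul]
            _ ≤ _ := (abs_real_inner_le_norm _ _).trans (by gcongr; exact hcl i)
        have h2 : ‖η‖ * (2 * (Λ / r) * (3 * (h * √h)))
            = 96 * Λ * (h * √h) / r ^ 4 * ‖η‖ * (r ^ 3 / 16) := by
          field_simp
          ring
        rw [h2] at h1
        exact le_of_mul_le_mul_right h1 (by positivity)
      have hqn := norm_le_three_mul hqi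
      have hR : ‖hP.rotL P.barycenter q‖ ≤ ‖q‖ * h * (3 * (h * √h)) :=
        norm_toLp_le_of_forall_norm_le hP hh hpos
          (hP.memLp_of_continuous (continuous_rotField P.barycenter q)) (by positivity)
          fun x hx => (norm_rotField_le _ q x).trans (by
            gcongr
            exact dist_barycenter_le hP hh hx)
      calc _ ≤ ‖q‖ * h * (3 * (h * √h)) := hR
        _ ≤ 3 * (96 * Λ * (h * √h) / r ^ 4 * ‖η‖) * h * (3 * (h * √h)) := by gcongr
        _ = 864 * Λ * h ^ 4 / r ^ 4 * ‖η‖ := by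
            have : (h * √h) * (h * √h) = h ^ 3 := by
              calc _ = h ^ 2 * (√h * √h) := by ring
                _ = _ := by rw [hss]; ring
            calc _ = 864 * Λ * h * ((h * √h) * (h * √h)) / r ^ 4 * ‖η‖ := by ring
              _ = _ := by rw [this]; ring
        _ ≤ 864 * Λ * h ^ 4 / (a * h) ^ 4 * ‖η‖ := by gcongr
        _ = _ := by
            field_simp)
  rw [Lp.norm_toLp] at key
  rw [← ENNReal.ofReal_toReal hψ.memLp.2.ne]
  refine ENNReal.ofReal_le_ofReal (key.trans (le_of_eq ?_))
  ring

end PolyhedralElement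

/-! ### Fluxes through the faces -/

theorem IsStarBall.tendsto_setIntegral {K : Set E3} {x₀ : E3} {r : ℝ} (hK : IsStarBall K x₀ r)
    {f : E3 → ℝ} (hf : MemLp f 2 (volume.restrict K)) {F : ℕ → E3 → ℝ}
    (hF : ∀ k, MemLp (F k) 2 (volume.restrict K))
    (h : Tendsto (fun k => eLpNorm (fun x => f x - F k x) 2 (volume.restrict K)) atTop (𝓝 0))
    {A : Set E3} (hA : A ⊆ K) :
    Tendsto (fun k => ∫ x in A, F k x) atTop (𝓝 (∫ x in A, f x)) := by
  refine tendsto_integral_of_L1 f ((hK.integrableOn_of_memLp hf).mono_set hA).1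
    (Eventually.of_forall fun k => (hK.integrableOn_of_memLp (hF k)).mono_set hA) ?_
  have h1 : Tendsto (fun k => volume K ^ (1 / 2 : ℝ) *
      eLpNorm (fun x => f x - F k x) 2 (volume.restrict K)) atTop (𝓝 0) := by
    simpa using ENNReal.Tendsto.const_mul h
      (Or.inr (ENNReal.rpow_ne_top_of_nonneg (by norm_num) hK.volume_lt_top.ne))
  refine tendsto_of_tendsto_of_tendsto_of_le_of_le tendsto_const_nhds h1 (fun _ => zero_le)
    fun k => ?_
  calc ∫⁻ x in A, ‖F k x - f x‖ₑ ≤ ∫⁻ x in K, ‖f x - F k x‖ₑ := by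
        simp only [enorm_sub_rev (F k _)]
        exact lintegral_mono_set hA
    _ ≤ _ := by
        have := lintegral_enorm_le_eLpNorm_two (hf.sub (hF k)).1
        rwa [Measure.restrict_apply_univ] at this

theorem seminormAux_const_zero {K : Set E3} (hK : IsOpen K) (σ : ℝ) (m : ℕ) :
    seminormAux K σ m (fun _ => 0) = 0 := by
  induction m with
  | zero =>
    simp only [seminormAux, gagliardo]
    split_ifs <;> simp
  | succ m ih =>
    have h := hasWeakGradient_of_contDiff hK (contDiff_const (c := (0 : ℝ)))
    have h0 : gradient (fun _ : E3 => (0 : ℝ)) = fun _ => 0 := by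
      funext x
      simp [gradient]
    rw [h0] at h
    refine le_antisymm ((iInf₂_le _ h).trans (le_of_eq ?_)) zero_le
    simp [ih]

theorem hNorm_const_zero {K : Set E3} (hK : IsOpen K) (s : ℝ) : hNorm K s (fun _ => 0) = 0 := by
  simp [hNorm, hSeminorm, seminormAux_const_zero hK]

/-- The space of smooth vector fields. -/
def smoothFields : Submodule ℝ (E3 → E3) where
  carrier := {Ψ | ContDiff ℝ ∞ Ψ}
  add_mem' h1 h2 := ContDiff.add (mem_ofPred.1 h1) (mem_ofPred.1 h2)
  zero_mem' := mem_ofPred.2 contDiff_const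
  smul_mem' _ _ h := mem_ofPred.2 (contDiff_const.smul (mem_ofPred.1 h))

theorem divergence_add {Ψ Φ : E3 → E3} (hΨ : Differentiable ℝ Ψ) (hΦ : Differentiable ℝ Φ) :
    divergence (Ψ + Φ) = divergence Ψ + divergence Φ := by
  funext x
  simp only [divergence, Pi.add_apply, fderiv_add (hΨ x) (hΦ x), add_apply,
    PiLp.add_apply, Finset.sum_add_distrib]

theorem divergence_const_smul {Ψ : E3 → E3} (hΨ : Differentiable ℝ Ψ) (c : ℝ) :
    divergence (c • Ψ) = c • divergence Ψ := by
  funext x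
  simp only [divergence, Pi.smul_apply, fderiv_const_smul (hΨ x), smul_apply,
    PiLp.smul_apply, smul_eq_mul, Finset.mul_sum]

theorem continuous_divergence {Ψ : E3 → E3} (hΨ : ContDiff ℝ ∞ Ψ) : Continuous (divergence Ψ) := by
  have h := hΨ.continuous_fderiv (by simp)
  unfold divergence
  fun_prop

/-- The pairs of a smooth vector field and its divergence. -/
def smoothPairs : Submodule ℝ ((E3 → E3) × (E3 → ℝ)) where
  carrier := {x | ContDiff ℝ ∞ x.1 ∧ x.2 = divergence x.1}
  add_mem' h1 h2 := ⟨h1.1.add h2.1, by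
    rw [Prod.snd_add, Prod.fst_add, h1.2, h2.2,
      divergence_add (h1.1.differentiable (by simp)) (h2.1.differentiable (by simp))]⟩
  zero_mem' := ⟨contDiff_const, by
    funext x
    simp [divergence]⟩
  smul_mem' c x h := ⟨h.1.const_smul c, by
    rw [Prod.smul_snd, Prod.smul_fst, h.2,
      divergence_const_smul (h.1.differentiable (by simp))]⟩

/-- The pairs of a vector field and a function that are locally integrable in `K`. -/
def integrablePairs (K : Set E3) : Submodule ℝ ((E3 → E3) × (E3 → ℝ)) where
  carrier := {x | (∀ i, LocallyIntegrableOn (fun y => x.1 y i) K volume) ∧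
    LocallyIntegrableOn x.2 K volume}
  add_mem' h1 h2 := ⟨fun i => (h1.1 i).add (h2.1 i), h1.2.add h2.2⟩
  zero_mem' := ⟨fun _ => locallyIntegrableOn_zero, locallyIntegrableOn_zero⟩
  smul_mem' c _ h := ⟨fun i => by
    intro y hy
    obtain ⟨u, hu, hi⟩ := h.1 i y hy
    exact ⟨u, hu, hi.const_mul c⟩, by
    intro y hy
    obtain ⟨u, hu, hi⟩ := h.2 y hy
    exact ⟨u, hu, hi.const_mul c⟩⟩

namespace PolyhedralElement

variable {P : PolyhedralElement} {x₀ : E3} {r h a : ℝ}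

theorem faceIntegral_inner_normal (i : Fin P.numFaces) {Ψ : E3 → E3} (hΨ : Continuous Ψ) :
    P.faceIntegral i (fun x => ⟪Ψ x, P.normal i⟫)
      = ∑ j, P.normal i j * P.faceIntegral i (fun x => Ψ x j) := by
  rw [← faceIntegral_sum 0 i Finset.univ (fun j _ => by fun_prop)]
  simp only [inner_eq_sum, mul_comm]

theorem faceIntegral_add (i : Fin P.numFaces) {f g : E3 → ℝ} (hf : Continuous f)
    (hg : Continuous g) : P.faceIntegral i (fun x => f x + g x)
      = P.faceIntegral i f + P.faceIntegral i g := by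
  simp only [faceIntegral_eq 0]
  exact integral_add (integrableOn_face 0 i hf) (integrableOn_face 0 i hg)

/-- The flux of a smooth field through a face. -/
def smoothFlux (P : PolyhedralElement) (i : Fin P.numFaces) : smoothFields →ₗ[ℝ] ℝ where
  toFun Ψ := P.faceIntegral i fun x => ⟪(Ψ : E3 → E3) x, P.normal i⟫
  map_add' Ψ Φ := by
    have h1 : Continuous (Ψ : E3 → E3) := ContDiff.continuous (n := ∞) Ψ.2
    have h2 : Continuous (Φ : E3 → E3) := ContDiff.continuous (n := ∞) Φ.2
    rw [← faceIntegral_add i (by fun_prop) (by fun_prop)]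
    simp only [Submodule.coe_add, Pi.add_apply, inner_add_left]
  map_smul' c Ψ := by
    rw [RingHom.id_apply, smul_eq_mul, ← faceIntegral_const_mul]
    simp only [Submodule.coe_smul, Pi.smul_apply, real_inner_smul_left]

/-- Every field of `[H^ε(K)]³` with square integrable divergence has fluxes, also for small `ε`:
the smoothing operators give smooth approximations, and among these the fluxes can be made to
converge. -/
theorem exists_hasFaceFluxes (hP : IsStarBall P.K x₀ r) {ε : ℝ} {ψ : E3 → E3} {d : E3 → ℝ}
    (hψ : MemHsVec P.K ε ψ) (hdiv : HasWeakDiv P.K ψ d) (hd : MemLp d 2 (volume.restrict P.K)) :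
    ∃ ℓ, HasFaceFluxes P ε ψ d ℓ := by
  obtain ⟨A⟩ := hP.exists_smoothingSeq
  -- the fluxes of smooth fields, extended to all fields by linear algebra, without any continuity
  have hext : ∀ i, ∃ g : (E3 → E3) →ₗ[ℝ] ℝ, g.comp smoothFields.subtype = P.smoothFlux i :=
    fun i => LinearMap.exists_extend _
  choose g hg using hext
  -- the norm of the density argument, for pairs of a field and its divergence
  let p : (E3 → E3) × (E3 → ℝ) → ℝ≥0∞ := fun x =>
    (∑ i, hNorm P.K ε fun y => x.1 y i) + eLpNorm x.2 2 (volume.restrict P.K)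
  have hM : smoothPairs ≤ integrablePairs P.K := by
    rintro x ⟨h1, h2⟩
    have h3 := h1.continuous
    have h4 := continuous_divergence h1
    refine ⟨fun i => ?_, ?_⟩
    · have : Continuous fun y => x.1 y i := by fun_prop
      exact this.locallyIntegrable.locallyIntegrableOn _
    · rw [h2]
      exact h4.locallyIntegrable.locallyIntegrableOn _
  have hp : ∀ u ∈ integrablePairs P.K, ∀ v ∈ integrablePairs P.K, ∀ t : ℝ,
      p (u - t • v) ≤ p u + ‖t‖ₑ * p v := by
    intro u hu v hv t
    have h1 := fun i => hNorm_sub_const_mul_le ε (hu.1 i) (hv.1 i) t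
    have h2 := eLpNorm_sub_const_mul_le hu.2.aestronglyMeasurable hv.2.aestronglyMeasurable t
    calc p (u - t • v) ≤ (∑ i, ((hNorm P.K ε fun y => u.1 y i)
          + ‖t‖ₑ * hNorm P.K ε fun y => v.1 y i))
          + (eLpNorm u.2 2 (volume.restrict P.K) + ‖t‖ₑ * eLpNorm v.2 2 (volume.restrict P.K)) :=
          add_le_add (Finset.sum_le_sum fun i _ => h1 i) h2
      _ = _ := by
          simp only [p, Finset.sum_add_distrib, ← Finset.mul_sum]
          ring
  have hp0 : p 0 = 0 := by
    simp [p, hNorm_const_zero P.isOpen]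
  have hxY : (ψ, d) ∈ integrablePairs P.K :=
    ⟨fun i => locallyIntegrableOn_of_memLp P.isOpen (hψ i).1, locallyIntegrableOn_of_memLp P.isOpen hd⟩
  have hlim : Tendsto (fun n => p ((ψ, d) - ((A.D n).opVec ψ, divergence ((A.D n).opVec ψ))))
      atTop (𝓝 0) := by
    have h1 : Tendsto (fun n => ∑ i, hNorm P.K ε fun y => ψ y i - (A.D n).op (fun y => ψ y i) y)
        atTop (𝓝 (∑ _i : Fin 3, 0)) := tendsto_finsetSum _ fun i _ => A.tendsto_hNorm P.isOpen (hψ i)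
    have h2 := A.tendsto_eLpNorm P.isOpen hd A.tendsto_l
    have h3 := h1.add h2
    simp only [Finset.sum_const_zero, add_zero] at h3
    refine h3.congr fun n => ?_
    congr 1
    refine eLpNorm_congr_ae ((ae_restrict_mem P.isOpen.measurableSet).mono fun x hx => ?_)
    change _ = d x - divergence ((A.D n).opVec ψ) x
    rw [(A.D n).divergence_opVec P.isOpen hdiv hx]
  obtain ⟨m, hm, hm0, hmℓ⟩ := exists_seq_tendsto_functionals hp0 hp hxY
    (fun i => (g i).comp (LinearMap.fst ℝ (E3 → E3) (E3 → ℝ))) hM (fun δ hδ => by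
      obtain ⟨n, hn⟩ := (hlim.eventually_le_const hδ).exists
      exact ⟨_, ⟨(A.D n).contDiff_opVec hxY.1, rfl⟩, hn⟩)
  choose ℓ hℓ using hmℓ
  refine ⟨ℓ, fun k => (m k).1, fun k => (hm k).1, fun i => ?_, ?_, fun i => ?_⟩
  · refine tendsto_of_tendsto_of_tendsto_of_le_of_le tendsto_const_nhds hm0 (fun _ => zero_le)
      fun k => ?_
    exact (Finset.single_le_sum (f := fun i => hNorm P.K ε fun y => ((ψ, d) - m k).1 y i)
      (fun _ _ => zero_le) (Finset.mem_univ i)).trans le_self_add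
  · refine tendsto_of_tendsto_of_tendsto_of_le_of_le tendsto_const_nhds hm0 (fun _ => zero_le)
      fun k => ?_
    rw [← (hm k).2]
    exact le_add_self
  · refine (hℓ i).congr fun k => ?_
    exact LinearMap.congr_fun (hg i) ⟨(m k).1, (hm k).1⟩

/-- The divergence theorem passes to the limit, although the fluxes through single faces need not be
continuous. -/
theorem _root_.FaceVEM.HasFaceFluxes.sum_eq (hP : IsStarBall P.K x₀ r) {ε : ℝ} {ψ : E3 → E3} {d : E3 → ℝ}
    (hd : MemLp d 2 (volume.restrict P.K)) {ℓ : Fin P.numFaces → ℝ}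
    (h : HasFaceFluxes P ε ψ d ℓ) : ∑ i, ℓ i = ∫ x in P.K, d x := by
  obtain ⟨Ψ, hΨ, -, h2, h3⟩ := h
  have h4 := hP.tendsto_setIntegral hd
    (fun k => hP.memLp_of_continuous (continuous_divergence (hΨ k))) h2 subset_rfl
  refine tendsto_nhds_unique (tendsto_finsetSum _ fun i _ => h3 i) (h4.congr fun k => ?_)
  exact integral_divergence hP (contDiff_infty.1 (hΨ k) 2)

/-- The constant in the trace inequality of order `s`, for `1 / 2 < s ≤ 1`. -/
def hsTraceConst (a s : ℝ) : ℝ := |fracTraceConst a s| + traceConst a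

theorem hsTraceConst_pos (ha : 0 < a) (s : ℝ) : 0 < hsTraceConst a s :=
  add_pos_of_nonneg_of_pos (abs_nonneg _) (traceConst_pos ha)

/-- The trace inequality of order `s`, for `1 / 2 < s ≤ 1`. -/
theorem lintegral_face_sub_average_le (hP : IsStarBall P.K x₀ r)
    (hh : ∀ x ∈ P.K, ∀ y ∈ P.K, dist x y ≤ h) (ha : 0 < a) (hpos : 0 < h) (har : a * h ≤ r)
    {s : ℝ} (hs : 1 / 2 < s) (hs1 : s ≤ 1) {φ : E3 → ℝ} (hφ : ContDiff ℝ 1 φ)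
    (i : Fin P.numFaces) :
    ∫⁻ u in P.base x₀ i, ‖φ (P.facePt x₀ i u) - ⨍ y in Metric.ball x₀ r, φ y‖ₑ
      ≤ ENNReal.ofReal (hsTraceConst a s * (√h * h ^ s)) * hSeminorm P.K s φ := by
  have htc := traceConst_pos ha
  rcases hs1.lt_or_eq with hs1 | rfl
  · rw [hSeminorm_of_lt_one P.K (by linarith) hs1]
    refine (lintegral_face_sub_average_le_gagliardo hP hh ha hpos har hs hφ.continuous i).trans ?_
    gcongr
    exact (le_abs_self _).trans (le_add_of_nonneg_right htc.le)
  · rw [hSeminorm_one_eq P.isOpen (hasWeakGradient_of_contDiff P.isOpen hφ), Real.rpow_one]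
    refine (Finset.single_le_sum (f := fun i => ∫⁻ u in P.base x₀ i,
      ‖φ (P.facePt x₀ i u) - ⨍ y in Metric.ball x₀ r, φ y‖ₑ) (fun _ _ => zero_le)
      (Finset.mem_univ i)).trans ?_
    refine (sum_lintegral_face_sub_average_le hP hh ha hpos har hφ).trans ?_
    gcongr
    exact le_add_of_nonneg_left (abs_nonneg _)

theorem abs_normal_apply_le (i : Fin P.numFaces) (j : Fin 3) : |P.normal i j| ≤ 1 := by
  rw [← P.norm_normal i]
  exact PiLp.norm_apply_le (P.normal i) j

/-- The means of the components of a vector field. -/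
def averageVec (B : Set E3) (ψ : E3 → E3) : E3 := WithLp.toLp 2 fun j => ⨍ y in B, ψ y j

/-- The flux of a smooth field through a face, compared with the flux of its mean over the ball. -/
theorem enorm_faceIntegral_sub_le (hP : IsStarBall P.K x₀ r)
    (hh : ∀ x ∈ P.K, ∀ y ∈ P.K, dist x y ≤ h) (ha : 0 < a) (hpos : 0 < h) (har : a * h ≤ r)
    {s : ℝ} (hs : 1 / 2 < s) (hs1 : s ≤ 1) {Ψ : E3 → E3} (hΨ : ContDiff ℝ ∞ Ψ)
    (i : Fin P.numFaces) :
    ‖P.faceIntegral i (fun x => ⟪Ψ x, P.normal i⟫)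
        - ⟪averageVec (Metric.ball x₀ r) Ψ, P.normal i⟫ * P.faceIntegral i (fun _ => 1)‖ₑ
      ≤ ENNReal.ofReal (hsTraceConst a s * (√h * h ^ s))
        * ∑ j, hSeminorm P.K s (fun x => Ψ x j) := by
  have hΨj : ∀ j, ContDiff ℝ ∞ fun x => Ψ x j := contDiff_euclidean.1 hΨ
  have h1 : P.faceIntegral i (fun x => ⟪Ψ x, P.normal i⟫)
        - ⟪averageVec (Metric.ball x₀ r) Ψ, P.normal i⟫ * P.faceIntegral i (fun _ => 1)
      = ∑ j, P.normal i j *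
        P.faceIntegral i (fun x => Ψ x j - ⨍ y in Metric.ball x₀ r, Ψ y j) := by
    simp only [faceIntegral_sub_const x₀ i (hΨj _).continuous]
    rw [faceIntegral_inner_normal i hΨ.continuous, inner_eq_sum, Finset.sum_mul,
      ← Finset.sum_sub_distrib]
    refine Finset.sum_congr rfl fun j _ => ?_
    simp only [averageVec]
    ring
  rw [h1, Finset.mul_sum]
  refine (enorm_sum_le _ _).trans (Finset.sum_le_sum fun j _ => ?_)
  rw [enorm_mul]
  have h2 : ‖P.normal i j‖ₑ ≤ 1 := by
    rw [← ofReal_norm, ENNReal.ofReal_le_one]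
    exact abs_normal_apply_le i j
  refine (mul_le_mul_left h2 _).trans ?_
  rw [one_mul]
  exact (enorm_faceIntegral_le x₀ i _).trans
    (lintegral_face_sub_average_le hP hh ha hpos har hs hs1 (contDiff_infty.1 (hΨj j) 1) i)

/-- The fluxes differ from those of the mean value by a multiple of the seminorm. The bound passes
to the limit of the smooth approximations, both sides being continuous in the norm of `[H^s(K)]³`.
-/
theorem _root_.FaceVEM.HasFaceFluxes.enorm_sub_le (hP : IsStarBall P.K x₀ r)
    (hh : ∀ x ∈ P.K, ∀ y ∈ P.K, dist x y ≤ h) (ha : 0 < a) (hpos : 0 < h) (har : a * h ≤ r)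
    {s : ℝ} (hs : 1 / 2 < s) (hs1 : s ≤ 1) {ψ : E3 → E3} {d : E3 → ℝ} (hψ : MemHsVec P.K s ψ)
    {ℓ : Fin P.numFaces → ℝ} (hℓ : HasFaceFluxes P s ψ d ℓ) (i : Fin P.numFaces) :
    ‖ℓ i - ⟪averageVec (Metric.ball x₀ r) ψ, P.normal i⟫ * P.faceIntegral i (fun _ => 1)‖ₑ
      ≤ ENNReal.ofReal (hsTraceConst a s * (√h * h ^ s))
        * ∑ j, hSeminorm P.K s (fun x => ψ x j) := by
  obtain ⟨Ψ, hΨ, hlim, -, hflux⟩ := hℓ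
  have hΨj : ∀ k j, Continuous fun x => Ψ k x j := fun k j =>
    (contDiff_euclidean.1 (hΨ k) j).continuous
  have hl := fun j => locallyIntegrableOn_of_memLp P.isOpen (hψ j).1
  have hlΨ : ∀ k j, LocallyIntegrableOn (fun x => Ψ k x j) P.K volume := fun k j =>
    (hΨj k j).locallyIntegrable.locallyIntegrableOn _
  have hL2 : ∀ j, Tendsto (fun k => eLpNorm (fun x => ψ x j - Ψ k x j) 2 (volume.restrict P.K))
      atTop (𝓝 0) := fun j => by
    refine tendsto_of_tendsto_of_tendsto_of_le_of_le tendsto_const_nhds (hlim j)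
      (fun _ => zero_le) fun k => ?_
    rw [← hSeminorm_zero]
    exact_mod_cast hSeminorm_nat_le_hNorm P.K (j := 0) _ (Nat.ceil_pos.2 (by linarith))
  have hav : ∀ j, Tendsto (fun k => ⨍ y in Metric.ball x₀ r, Ψ k y j) atTop
      (𝓝 (⨍ y in Metric.ball x₀ r, ψ y j)) := fun j => by
    simp only [setAverage_eq]
    exact (hP.tendsto_setIntegral (hψ j).1 (fun k => hP.memLp_of_continuous (hΨj k j)) (hL2 j)
      hP.ball_subset_self).const_smul _
  have hleft : Tendsto (fun k => ‖P.faceIntegral i (fun x => ⟪Ψ k x, P.normal i⟫)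
      - ⟪averageVec (Metric.ball x₀ r) (Ψ k), P.normal i⟫ * P.faceIntegral i (fun _ => 1)‖ₑ)
      atTop (𝓝 ‖ℓ i - ⟪averageVec (Metric.ball x₀ r) ψ, P.normal i⟫
        * P.faceIntegral i (fun _ => 1)‖ₑ) := by
    refine ((hflux i).sub (Tendsto.mul_const _ ?_)).enorm
    simp only [inner_eq_sum, averageVec]
    exact tendsto_finsetSum _ fun j _ => (hav j).mul_const _
  have hright : Tendsto (fun k => ENNReal.ofReal (hsTraceConst a s * (√h * h ^ s))
      * ∑ j, (hSeminorm P.K s (fun x => ψ x j)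
        + ‖(1 : ℝ)‖ₑ * hNorm P.K s (fun x => ψ x j - Ψ k x j))) atTop
      (𝓝 (ENNReal.ofReal (hsTraceConst a s * (√h * h ^ s))
        * ∑ j, hSeminorm P.K s (fun x => ψ x j))) := by
    refine ENNReal.Tendsto.const_mul (tendsto_finsetSum _ fun j _ => ?_)
      (Or.inr ENNReal.ofReal_ne_top)
    have := (ENNReal.Tendsto.const_mul (hlim j) (a := ‖(1 : ℝ)‖ₑ) (Or.inr (by simp)))
    simpa using (tendsto_const_nhds (x := hSeminorm P.K s (fun x => ψ x j))).add this
  refine le_of_tendsto_of_tendsto' hleft hright fun k => ?_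
  refine (enorm_faceIntegral_sub_le hP hh ha hpos har hs hs1 (hΨ k) i).trans ?_
  gcongr with j
  have h1 := hSeminorm_sub_const_mul_le s (hl j) ((hl j).sub (hlΨ k j)) 1
  have h2 : (fun x => ψ x j - 1 * ((fun x => ψ x j) - fun x => Ψ k x j) x)
      = fun x => Ψ k x j := by
    funext x
    simp
  rw [h2] at h1
  refine h1.trans ?_
  gcongr
  exact hSeminorm_le_hNorm _ _ _

end PolyhedralElement

/-! ### Error estimates for face interpolants -/

theorem integrable_inner_of_memLp {μ : Measure E3} {f g : E3 → E3} (hf : MemLp f 2 μ)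
    (hg : MemLp g 2 μ) : Integrable (fun x => ⟪f x, g x⟫) μ := by
  refine (L2.integrable_inner (𝕜 := ℝ) (hf.toLp f) (hg.toLp g)).congr ?_
  filter_upwards [hf.coeFn_toLp, hg.coeFn_toLp] with x h1 h2
  rw [h1, h2]

theorem memLp_of_memHsVec {K : Set E3} {s : ℝ} {ψ : E3 → E3} (h : MemHsVec K s ψ) :
    MemLp ψ 2 (volume.restrict K) :=
  MemLp.of_eval_piLp fun i => (h i).1

theorem HasWeakDiv.sub {K : Set E3} {x₀ : E3} {r : ℝ} (hK : IsStarBall K x₀ r) {ψ₁ ψ₂ : E3 → E3}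
    {d₁ d₂ : E3 → ℝ} (h₁ : HasWeakDiv K ψ₁ d₁) (h₂ : HasWeakDiv K ψ₂ d₂)
    (hψ₁ : MemLp ψ₁ 2 (volume.restrict K)) (hψ₂ : MemLp ψ₂ 2 (volume.restrict K)) :
    HasWeakDiv K (ψ₁ - ψ₂) (fun x => d₁ x - d₂ x) := by
  refine ⟨h₁.locallyIntegrable.sub h₂.locallyIntegrable,
    h₁.locallyIntegrable_div.sub h₂.locallyIntegrable_div, fun φ hφ => ?_⟩
  have hg := hK.memLp_of_continuous hφ.continuous_gradient
  have hi1 := integrableOn_smul_of_tsupport_subset h₁.locallyIntegrable_div hφ.smooth.continuous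
    hφ.compact hφ.support_subset
  have hi2 := integrableOn_smul_of_tsupport_subset h₂.locallyIntegrable_div hφ.smooth.continuous
    hφ.compact hφ.support_subset
  simp only [smul_eq_mul] at hi1 hi2
  simp only [Pi.sub_apply, inner_sub_left, mul_sub]
  rw [integral_sub (integrable_inner_of_memLp hψ₁ hg) (integrable_inner_of_memLp hψ₂ hg),
    integral_sub hi1 hi2, h₁.integral_eq φ hφ, h₂.integral_eq φ hφ]
  ring

namespace IsStarBall

variable {K : Set E3} {x₀ : E3} {r h a : ℝ}

/-- Subtraction of the mean over `K` is bounded in `L²(K)`, uniformly in the domain. -/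
theorem eLpNorm_sub_setAverage_le_two_mul (hK : IsStarBall K x₀ r) {f : E3 → ℝ}
    (hf : MemLp f 2 (volume.restrict K)) :
    eLpNorm (fun x => f x - ⨍ y in K, f y) 2 (volume.restrict K)
      ≤ 2 * eLpNorm f 2 (volume.restrict K) := by
  have hV0 := hK.volume_pos.ne'
  have hVt := hK.volume_lt_top.ne
  have h1 := eLpNorm_sub_le hf.1 (aestronglyMeasurable_const (b := ⨍ y in K, f y))
    (p := 2) (by norm_num)
  refine h1.trans ?_
  rw [two_mul]
  gcongr
  have h2 := enorm_sub_average_sq_le hV0 hVt (hK.integrableOn_of_memLp hf) 0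
  simp only [zero_sub, enorm_neg] at h2
  rw [eLpNorm_two_eq, eLpNorm_two_eq]
  refine ENNReal.rpow_le_rpow ?_ (by norm_num)
  rw [setLIntegral_const]
  refine (mul_le_mul_left h2 _).trans (le_of_eq ?_)
  rw [mul_comm, ← mul_assoc, ENNReal.mul_inv_cancel hV0 hVt, one_mul]

/-- The best approximation by a constant is the mean over `K`; up to a factor `2`, it does not
matter that the Poincaré inequality holds for the mean over the ball. For `s = 0`, the projection
onto the constants is merely bounded. -/
theorem eLpNorm_sub_setAverage_le (hK : IsStarBall K x₀ r)
    (hh : ∀ x ∈ K, ∀ y ∈ K, dist x y ≤ h) (ha : 0 < a) (hpos : 0 < h) (har : a * h ≤ r) {s : ℝ}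
    (hs : 0 ≤ s) (hs1 : s ≤ 1) {f : E3 → ℝ} (hf : MemHs K s f) :
    eLpNorm (fun x => f x - ⨍ y in K, f y) 2 (volume.restrict K)
      ≤ ENNReal.ofReal (2 * (1 + √(10 / a ^ 3)) * h ^ s) * hSeminorm K s f := by
  rcases hs.eq_or_lt with rfl | hs
  · refine (hK.eLpNorm_sub_setAverage_le_two_mul hf.1).trans ?_
    rw [hSeminorm_zero, Real.rpow_zero, mul_one]
    gcongr
    rw [← ENNReal.ofReal_ofNat]
    refine ENNReal.ofReal_le_ofReal ?_
    linarith [Real.sqrt_nonneg (10 / a ^ 3)]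
  · have hfin := hK.isFiniteMeasure
    set m := ⨍ y in Metric.ball x₀ r, f y with hm
    have hfm : MemLp (fun x => f x - m) 2 (volume.restrict K) := hf.1.sub (memLp_const m)
    have h1 : (fun x => f x - ⨍ y in K, f y)
        = fun x => (f x - m) - ⨍ y in K, (f y - m) := by
      have hV : volume.real K ≠ 0 :=
        (ENNReal.toReal_pos hK.volume_pos.ne' hK.volume_lt_top.ne).ne'
      have : ⨍ y in K, (f y - m) = (⨍ y in K, f y) - m := by
        rw [setAverage_eq, setAverage_eq, integral_sub (hK.integrableOn_of_memLp hf.1)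
          (integrable_const m), setIntegral_const, smul_sub, smul_smul,
          inv_mul_cancel₀ hV, one_smul]
      rw [this]
      funext x
      ring
    rw [h1]
    refine (hK.eLpNorm_sub_setAverage_le_two_mul hfm).trans ?_
    refine (mul_le_mul_right (hK.poincare hh ha hpos har hs hs1 hf) 2).trans ?_
    rw [← mul_assoc, ← ENNReal.ofReal_ofNat, ← ENNReal.ofReal_mul (by norm_num)]
    have : 0 ≤ h ^ s := by positivity
    refine mul_le_mul_left (ENNReal.ofReal_le_ofReal ?_) _
    linarith

/-- The Poincaré inequality for vector fields. -/
theorem eLpNorm_sub_averageVec_le (hK : IsStarBall K x₀ r)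
    (hh : ∀ x ∈ K, ∀ y ∈ K, dist x y ≤ h) (ha : 0 < a) (hpos : 0 < h) (har : a * h ≤ r) {s : ℝ}
    (hs : 0 < s) (hs1 : s ≤ 1) {ψ : E3 → E3} (hψ : MemHsVec K s ψ) :
    eLpNorm (fun x => ψ x - PolyhedralElement.averageVec (Metric.ball x₀ r) ψ) 2
        (volume.restrict K)
      ≤ ENNReal.ofReal (√(10 / a ^ 3) * h ^ s) * hSeminormVec K s ψ := by
  have hfin := hK.isFiniteMeasure
  have hm : AEStronglyMeasurable
      (fun x => ψ x - PolyhedralElement.averageVec (Metric.ball x₀ r) ψ) (volume.restrict K) :=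
    (memLp_of_memHsVec hψ).1.sub aestronglyMeasurable_const
  rw [← sum_rpow_half_eLpNorm hm, hSeminormVec, ← rpow_half_sum_mul]
  gcongr with i
  exact hK.poincare hh ha hpos har hs hs1 (hψ i)

end IsStarBall

namespace PolyhedralElement

variable {P : PolyhedralElement} {x₀ : E3} {r h a γ σ : ℝ}

/-- The linear map `w ↦ p ⬝ (w × q)`. -/
def innerCross (p q : E3) : E3 →ₗ[ℝ] ℝ where
  toFun w := ⟪p, cross w q⟫
  map_add' v w := by
    rw [← inner_add_right]
    congr 1
    ext i
    simp [cross]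
  map_smul' c w := by
    rw [RingHom.id_apply, smul_eq_mul, ← inner_smul_right]
    congr 1
    ext i
    simp [cross]

theorem continuous_cross_left (q : E3) : Continuous fun w : E3 => cross w q := by
  refine (PiLp.continuous_toLp 2 _).comp (continuous_pi fun i => ?_)
  fin_cases i <;> simp [crossProduct] <;> fun_prop

/-- The moments of constant fields vanish, by the choice of the barycenter. -/
theorem integral_inner_cross_eq_zero (hP : IsStarBall P.K x₀ r) (p q : E3) :
    ∫ x in P.K, ⟪p, cross (x - P.barycenter) q⟫ = 0 := by
  have hfin := hP.isFiniteMeasure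
  have h1 : ∫ x in P.K, (x - P.barycenter) = 0 := integral_sub_average _ fun x => x
  have h2 := ContinuousLinearMap.integral_comp_comm (μ := volume.restrict P.K)
    (innerCross p q).toContinuousLinearMap
    (hP.integrableOn_of_continuous (f := fun x => x - P.barycenter) (by fun_prop))
  rw [h1, map_zero] at h2
  exact h2

/-- The face space is invariant under the subtraction of constant fields, which are free of
divergence and curl, and whose moments vanish because `x - x_K` has mean zero. -/
theorem _root_.FaceVEM.MemFaceSpaceWith.sub_const (hP : IsStarBall P.K x₀ r) {ψ : E3 → E3}
    {c : Fin P.numFaces → ℝ} (h : MemFaceSpaceWith P ψ c) (p : E3) :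
    MemFaceSpaceWith P (fun x => ψ x - p) (fun i => c i - ⟪p, P.normal i⟫) := by
  have hfin := hP.isFiniteMeasure
  have hp : MemLp (fun _ => p) 2 (volume.restrict P.K) := memLp_const p
  have hm : MemLp (fun x => ψ x - p) 2 (volume.restrict P.K) := h.memLp.sub hp
  have hl := locallyIntegrableOn_of_memLp P.isOpen hm
  obtain ⟨d₀, -, hn⟩ := h.div_normal
  obtain ⟨q, hq⟩ := h.curl
  have hn' : HasFaceNormalComponents P (fun x => ψ x - p) (fun _ => d₀)
      (fun i => c i - ⟪p, P.normal i⟫) := by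
    intro φ hφ hc
    have hg := hP.memLp_of_continuous (continuous_gradient (contDiff_infty.1 hφ 1))
    have h1 := hn φ hφ hc
    have h2 : ∫ x in P.K, ⟪p, gradient φ x⟫ = ∑ i, ⟪p, P.normal i⟫ * P.faceIntegral i φ := by
      have := integral_fderiv hP (contDiff_infty.1 hφ 2) p
      simp only [real_inner_comm p] at this ⊢
      rw [← this]
      refine integral_congr_ae (Eventually.of_forall fun x => ?_)
      simp only
      rw [inner_gradient_eq]
    simp only [inner_sub_left]
    rw [integral_sub (integrable_inner_of_memLp h.memLp hg) (integrable_inner_of_memLp hp hg), h2]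
    simp only [faceIntegral_const_mul] at h1 ⊢
    simp only [sub_mul, Finset.sum_sub_distrib]
    rw [← h1]
    ring
  refine ⟨hm, ⟨d₀, hn'.hasWeakDiv hl
    (continuousOn_const.locallyIntegrableOn P.isOpen.measurableSet), hn'⟩, ⟨q, ?_⟩, fun q₀ => ?_⟩
  · rw [hasWeakCurl_const_iff P.isOpen (locallyIntegrableOn_of_memLp P.isOpen h.memLp)] at hq
    rw [hasWeakCurl_const_iff P.isOpen hl]
    intro χ hχ i
    have hcl := hP.memLp_of_continuous (continuous_curlField hχ.contDiff_one (i + 1) (i + 2))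
    have hpg := hP.mem_gradSpace_of_hasFDerivAt (φ := fun x => ⟪p, x⟫) (Ψ := fun _ => p)
      continuous_const fun x _ => (innerSL ℝ p).hasFDerivAt
    simp only [inner_sub_left]
    rw [integral_sub (integrable_inner_of_memLp h.memLp hcl) (integrable_inner_of_memLp hp hcl),
      hq χ hχ i, hP.integral_inner_curlField_of_mem_gradSpace _ hpg hχ, sub_zero]
  · have hc : Continuous fun x : E3 => cross (x - P.barycenter) q₀ :=
      (continuous_cross_left q₀).comp (continuous_id.sub continuous_const)
    simp only [inner_sub_left]
    rw [integral_sub (integrable_inner_of_memLp h.memLp (hP.memLp_of_continuous hc))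
      (integrable_inner_of_memLp hp (hP.memLp_of_continuous hc)), h.enhancing,
      integral_inner_cross_eq_zero hP, sub_zero]

/-- The divergence of the interpolant times `|K|` is the sum of its fluxes, which is the sum of the
fluxes of `ψ` and hence the integral of `d`. -/
theorem _root_.FaceVEM.IsFaceInterpolant.hasWeakDiv (hP : IsStarBall P.K x₀ r) {ε : ℝ} {ψ ψI : E3 → E3}
    {d : E3 → ℝ} (hd : MemLp d 2 (volume.restrict P.K)) (h : IsFaceInterpolant P ε ψ d ψI) :
    HasWeakDiv P.K ψI (fun _ => ⨍ x in P.K, d x) := by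
  obtain ⟨c, hc, hℓ⟩ := h
  obtain ⟨d₀, hd₀, hn⟩ := hc.div_normal
  have h1 := mul_volume_eq_of_hasFaceNormalComponents hP hn
  have h2 := hℓ.sum_eq hP hd
  have h3 : ∀ i, P.faceIntegral i (fun _ => c i) = c i * P.faceIntegral i (fun _ => 1) :=
    fun i => by rw [← faceIntegral_const_mul, mul_one]
  simp only [h3] at h2
  have hV : volume.real P.K ≠ 0 :=
    (ENNReal.toReal_pos hP.volume_pos.ne' hP.volume_lt_top.ne).ne'
  have h4 : ⨍ x in P.K, d x = d₀ := by
    rw [setAverage_eq, ← h2, ← h1, smul_eq_mul, mul_comm d₀, inv_mul_cancel_left₀ hV]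
  rw [h4]
  exact hd₀

theorem h_pos (P : PolyhedralElement) : 0 < P.h := by
  obtain ⟨x, hx⟩ := P.nonempty
  obtain ⟨δ, hδ, hsub⟩ := Metric.isOpen_iff.1 P.isOpen x hx
  have h1 : dist (x + EuclideanSpace.single 0 (δ / 2)) x = δ / 2 := by
    rw [dist_eq_norm, add_sub_cancel_left, PiLp.norm_single, Real.norm_of_nonneg (by positivity)]
  have h2 : x + EuclideanSpace.single 0 (δ / 2) ∈ P.K := hsub (by
    rw [Metric.mem_ball, h1]
    linarith)
  have h3 := Metric.dist_le_diam_of_mem P.isBounded h2 hx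
  rw [h1] at h3
  exact lt_of_lt_of_le (by positivity) h3

theorem dist_le_h (P : PolyhedralElement) : ∀ x ∈ P.K, ∀ y ∈ P.K, dist x y ≤ P.h :=
  fun _ hx _ hy => Metric.dist_le_diam_of_mem P.isBounded hx hy

theorem IsRegular.exists_isStarBall (hP : P.IsRegular γ σ) (hγ : 0 < γ) :
    ∃ x₀, IsStarBall P.K x₀ (γ / 2 * P.h) := by
  obtain ⟨x₀, h⟩ := hP.star
  have h0 := h_pos P
  exact ⟨x₀, P.isOpen, P.nonempty, P.isBounded, by positivity, by
    rwa [div_mul_eq_mul_div]⟩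

/-- The faces of a regular element are not small: they contain a disc. -/
theorem IsRegular.le_faceIntegral_one (hP : P.IsRegular γ σ) (hγ : 0 < γ) (hσ : 0 < σ)
    (i : Fin P.numFaces) :
    (γ / (2 * σ)) ^ 2 * P.h ^ 2 ≤ P.faceIntegral i (fun _ => 1) := by
  have h0 := h_pos P
  obtain ⟨y₀, hy₀, hstar⟩ := hP.star_face i
  have hF : P.h / σ ≤ P.hFace i := by
    rw [div_le_iff₀ hσ, mul_comm]
    exact (hP.h_face i).1
  obtain ⟨u₀, hu₀⟩ : y₀ ∈ range (P.facePt 0 i) := by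
    rw [range_facePt]
    exact hy₀
  -- the face is star-shaped with respect to each point of the disc, and therefore contains it
  have hsub : Metric.ball u₀ (γ / (2 * σ) * P.h) ⊆ P.base 0 i := fun u hu => by
    refine (hstar _ ⟨?_, facePt_mem_plane i u⟩).mem (P.face_nonempty i)
    rw [← hu₀, Metric.mem_ball, (isometry_facePt i).dist_eq]
    refine (Metric.mem_ball.1 hu).trans_le ?_
    calc γ / (2 * σ) * P.h = γ * (P.h / σ) / 2 := by field_simp
      _ ≤ _ := by gcongr
  have h1 := measureReal_mono hsub (volume_base_lt_top i).ne
  rw [faceIntegral_eq 0, setIntegral_const, smul_eq_mul, mul_one]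
  refine le_trans ?_ h1
  rw [measureReal_def, EuclideanSpace.volume_ball_fin_two, ENNReal.toReal_mul]
  have h2 : 0 ≤ γ / (2 * σ) * P.h := by positivity
  rw [ENNReal.toReal_pow, ENNReal.toReal_ofReal h2, mul_pow]
  have h3 := Real.pi_gt_three
  have h4 : 0 ≤ (γ / (2 * σ)) ^ 2 * P.h ^ 2 := by positivity
  rw [ENNReal.toReal_ofReal Real.pi_pos.le]
  nlinarith

end PolyhedralElement

theorem sum_hSeminorm_le (K : Set E3) (s : ℝ) (ψ : E3 → E3) :
    ∑ j, hSeminorm K s (fun x => ψ x j) ≤ 3 * hSeminormVec K s ψ := by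
  have h : ∀ j, hSeminorm K s (fun x => ψ x j) ≤ hSeminormVec K s ψ := fun j => by
    have h1 : hSeminorm K s (fun x => ψ x j)
        = (hSeminorm K s (fun x => ψ x j) ^ 2) ^ (1 / 2 : ℝ) := by
      rw [← ENNReal.rpow_natCast, ← ENNReal.rpow_mul]
      simp
    rw [h1, hSeminormVec]
    gcongr
    exact Finset.single_le_sum (f := fun j => hSeminorm K s (fun x => ψ x j) ^ 2)
      (fun _ _ => zero_le) (Finset.mem_univ j)
  calc _ ≤ ∑ _j : Fin 3, hSeminormVec K s ψ := Finset.sum_le_sum fun j _ => h j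
    _ = _ := by simp

theorem hSeminormVec_lt_top {K : Set E3} {s : ℝ} {ψ : E3 → E3} (h : MemHsVec K s ψ) :
    hSeminormVec K s ψ < ⊤ := by
  refine ENNReal.rpow_lt_top_of_nonneg (by norm_num) (ENNReal.sum_ne_top.2 fun i _ => ?_)
  exact ENNReal.pow_ne_top (hNorm_lt_top_iff.1 (h i).2).2.ne

theorem rpow_half_add_sq_le {c X Y A B : ℝ≥0∞} (hX : X ≤ c * A) (hY : Y ≤ c * B) :
    (X ^ 2 + Y ^ 2) ^ (1 / 2 : ℝ) ≤ c * (A ^ 2 + B ^ 2) ^ (1 / 2 : ℝ) := by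
  calc (X ^ 2 + Y ^ 2) ^ (1 / 2 : ℝ) ≤ ((c * A) ^ 2 + (c * B) ^ 2) ^ (1 / 2 : ℝ) := by gcongr
    _ = _ := by
      have := rpow_half_sum_mul Finset.univ c ![A, B]
      simpa [Fin.sum_univ_two] using this

namespace PolyhedralElement

variable {P : PolyhedralElement} {x₀ : E3} {r h a κ : ℝ}

theorem faceIntegral_const (i : Fin P.numFaces) (c : ℝ) :
    P.faceIntegral i (fun _ => c) = c * P.faceIntegral i (fun _ => 1) := by
  rw [← faceIntegral_const_mul, mul_one]

/-- The normal components of the interpolant are the fluxes of `ψ` divided by the areas of the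
faces. -/
theorem exists_isFaceInterpolant (hP : IsStarBall P.K x₀ r)
    (hF : ∀ i, P.faceIntegral i (fun _ => 1) ≠ 0) {ε : ℝ} {ψ : E3 → E3} {d : E3 → ℝ}
    (hψ : MemHsVec P.K ε ψ) (hdiv : HasWeakDiv P.K ψ d) (hd : MemLp d 2 (volume.restrict P.K)) :
    ∃ ψI, IsFaceInterpolant P ε ψ d ψI := by
  obtain ⟨ℓ, hℓ⟩ := exists_hasFaceFluxes hP hψ hdiv hd
  obtain ⟨ψI, hψI⟩ := exists_memFaceSpaceWith hP fun i => ℓ i / P.faceIntegral i (fun _ => 1)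
  refine ⟨ψI, _, hψI, ?_⟩
  convert hℓ using 2 with i
  rw [faceIntegral_const, div_mul_cancel₀ _ (hF i)]

/-- The `L²` error of the face interpolant. The interpolant of the mean of `ψ` is the mean itself,
and the remainder is controlled by its fluxes. -/
theorem exists_interpolation_constant (ha : 0 < a) (hκ : 0 < κ) {s : ℝ} (hs : 1 / 2 < s)
    (hs1 : s ≤ 1) : ∃ C > 0,
    ∀ (P : PolyhedralElement) (x₀ : E3) (r h : ℝ), IsStarBall P.K x₀ r →
    (∀ x ∈ P.K, ∀ y ∈ P.K, dist x y ≤ h) → 0 < h → a * h ≤ r →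
    (∀ i, κ * h ^ 2 ≤ P.faceIntegral i (fun _ => 1)) →
    ∀ (ψ ψI : E3 → E3) (d : E3 → ℝ), MemHsVec P.K s ψ → IsFaceInterpolant P s ψ d ψI →
    eLpNorm (ψ - ψI) 2 (volume.restrict P.K) ≤ ENNReal.ofReal (C * h ^ s) * hSeminormVec P.K s ψ := by
  obtain ⟨C, hC, hstab⟩ := exists_stability_constant ha
  have hT := hsTraceConst_pos ha s
  refine ⟨√(10 / a ^ 3) + C * (hsTraceConst a s * 3 / κ), by positivity, ?_⟩
  rintro P x₀ r h hP hh hpos har hF ψ ψI d hψ ⟨c, hc, hℓ⟩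
  have hfin := hP.isFiniteMeasure
  set p := averageVec (Metric.ball x₀ r) ψ with hp
  have hS := (hSeminormVec_lt_top hψ).ne
  set S := (hSeminormVec P.K s ψ).toReal with hSdef
  have hSe : hSeminormVec P.K s ψ = ENNReal.ofReal S := (ENNReal.ofReal_toReal hS).symm
  have hS0 : 0 ≤ S := ENNReal.toReal_nonneg
  have hsub := hc.sub_const hP p
  set M := hsTraceConst a s * (√h * h ^ s) * 3 * S / (κ * h ^ 2) with hM
  have hM0 : 0 ≤ M := by positivity
  have hcM : ∀ i, |c i - ⟪p, P.normal i⟫| ≤ M := fun i => by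
    have h1 := hℓ.enorm_sub_le hP hh ha hpos har hs hs1 hψ i
    have h2 := h1.trans (mul_le_mul_right (sum_hSeminorm_le P.K s ψ) _)
    rw [hSe, ← mul_assoc, ← ENNReal.ofReal_ofNat (n := 3), ← ENNReal.ofReal_mul (by positivity),
      ← ENNReal.ofReal_mul (by positivity), ← ofReal_norm,
      ENNReal.ofReal_le_ofReal_iff (by positivity)] at h2
    have hFp : 0 ≤ P.faceIntegral i (fun _ => 1) := le_trans (by positivity) (hF i)
    rw [faceIntegral_const i (c i), ← sub_mul, norm_mul, Real.norm_eq_abs,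
      Real.norm_of_nonneg hFp] at h2
    rw [hM, le_div_iff₀ (by positivity)]
    exact (mul_le_mul_of_nonneg_left (hF i) (abs_nonneg _)).trans h2
  have hst := hstab P x₀ r h hP hh hpos har _ _ M hsub hM0 hcM
  have hpo := hP.eLpNorm_sub_averageVec_le hh ha hpos har (by linarith) hs1 hψ
  -- Poincaré inequality for the first part, stability of the face space for the second
  have hdec : ψ - ψI = (fun x => ψ x - p) - fun x => ψI x - p := by
    funext x
    simp
  rw [hdec]
  refine (eLpNorm_sub_le ((memLp_of_memHsVec hψ).1.sub aestronglyMeasurable_const) hsub.memLp.1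
    (by norm_num)).trans ?_
  calc _ ≤ ENNReal.ofReal (√(10 / a ^ 3) * h ^ s) * hSeminormVec P.K s ψ
        + ENNReal.ofReal (C * (√h * h) * M) := add_le_add hpo hst
    _ = _ := by
      rw [hSe, ← ENNReal.ofReal_mul (by positivity), ← ENNReal.ofReal_mul (by positivity),
        ← ENNReal.ofReal_add (by positivity) (by positivity)]
      congr 1
      have hss : √h * √h = h := Real.mul_self_sqrt hpos.le
      have : C * (√h * h) * M = C * (hsTraceConst a s * 3 / κ) * h ^ s * S := by
        calc C * (√h * h) * M
            = C * h * (hsTraceConst a s * ((√h * √h) * h ^ s) * 3 * S / (κ * h ^ 2)) := by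
              rw [hM]
              ring
          _ = _ := by
              rw [hss]
              field_simp
      rw [this]
      ring

end PolyhedralElement

end FaceVEM

end

theorem mainTheorem9 (γ σ : ℝ) (hγ : 0 < γ) (hσ : 0 < σ) :
    (∃ C : ℝ, 0 < C ∧
      ∀ P : FaceVEM.PolyhedralElement, P.IsRegular γ σ →
      ∀ ε : ℝ, 0 < ε → ∀ s : ℝ, 0 ≤ s → s ≤ 1 →
      ∀ (ψ : FaceVEM.E3 → FaceVEM.E3) (d : FaceVEM.E3 → ℝ),
        FaceVEM.MemHsVec P.K ε ψ → FaceVEM.HasWeakDiv P.K ψ d → FaceVEM.MemHs P.K s d →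
        (∃ ψI, FaceVEM.IsFaceInterpolant P ε ψ d ψI) ∧
        ∀ ψI, FaceVEM.IsFaceInterpolant P ε ψ d ψI →
          FaceVEM.HasWeakDiv P.K ψI (fun _ => ⨍ x in P.K, d x) ∧
          ∃ δ : FaceVEM.E3 → ℝ, FaceVEM.HasWeakDiv P.K (ψ - ψI) δ ∧
            FaceVEM.l2Norm P.K δ
              ≤ ENNReal.ofReal (C * P.h ^ s) * FaceVEM.hSeminorm P.K s d) ∧
    (∀ s : ℝ, 1 / 2 < s → s ≤ 1 → ∃ C : ℝ, 0 < C ∧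
      ∀ P : FaceVEM.PolyhedralElement, P.IsRegular γ σ →
      ∀ (ψ : FaceVEM.E3 → FaceVEM.E3) (d : FaceVEM.E3 → ℝ),
        FaceVEM.MemHsVec P.K s ψ → FaceVEM.HasWeakDiv P.K ψ d → FaceVEM.MemHs P.K s d →
        ∀ ψI, FaceVEM.IsFaceInterpolant P s ψ d ψI →
          ∃ δ : FaceVEM.E3 → ℝ, FaceVEM.HasWeakDiv P.K (ψ - ψI) δ ∧
            (FaceVEM.l2Norm P.K (ψ - ψI) ^ 2 + FaceVEM.l2Norm P.K δ ^ 2) ^ (1 / 2 : ℝ)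
              ≤ ENNReal.ofReal (C * P.h ^ s) *
                (FaceVEM.hSeminormVec P.K s ψ ^ 2 + FaceVEM.hSeminorm P.K s d ^ 2)
                  ^ (1 / 2 : ℝ)) := by
  have ha : 0 < γ / 2 := by positivity
  have hκ : 0 < (γ / (2 * σ)) ^ 2 := by positivity
  have hdivErr : ∀ (P : FaceVEM.PolyhedralElement) (x₀ : FaceVEM.E3),
      FaceVEM.IsStarBall P.K x₀ (γ / 2 * P.h) →
      ∀ (ε s : ℝ), 0 ≤ s → s ≤ 1 → ∀ (ψ ψI : FaceVEM.E3 → FaceVEM.E3) (d : FaceVEM.E3 → ℝ),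
        FaceVEM.MemHsVec P.K ε ψ → FaceVEM.HasWeakDiv P.K ψ d → FaceVEM.MemHs P.K s d →
        FaceVEM.IsFaceInterpolant P ε ψ d ψI →
        ∃ δ : FaceVEM.E3 → ℝ, FaceVEM.HasWeakDiv P.K (ψ - ψI) δ ∧ FaceVEM.l2Norm P.K δ
          ≤ ENNReal.ofReal (2 * (1 + √(10 / (γ / 2) ^ 3)) * P.h ^ s) *
            FaceVEM.hSeminorm P.K s d := by
    intro P x₀ hP ε s hs hs1 ψ ψI d hψ hdiv hd hI
    have hm : MemLp ψI 2 (volume.restrict P.K) := by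
      obtain ⟨c, hc, -⟩ := hI
      exact hc.memLp
    exact ⟨_, hdiv.sub hP (hI.hasWeakDiv hP hd.1) (FaceVEM.memLp_of_memHsVec hψ) hm,
      hP.eLpNorm_sub_setAverage_le P.dist_le_h ha P.h_pos le_rfl hs hs1 hd⟩
  refine ⟨⟨2 * (1 + √(10 / (γ / 2) ^ 3)), by positivity, ?_⟩, fun s hs hs1 => ?_⟩
  · intro P hreg ε hε s hs hs1 ψ d hψ hdiv hd
    obtain ⟨x₀, hP⟩ := hreg.exists_isStarBall hγ
    have hF : ∀ i, P.faceIntegral i (fun _ => 1) ≠ 0 := fun i =>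
      (lt_of_lt_of_le (mul_pos hκ (pow_pos P.h_pos 2)) (hreg.le_faceIntegral_one hγ hσ i)).ne'
    exact ⟨FaceVEM.PolyhedralElement.exists_isFaceInterpolant hP hF hψ hdiv hd.1, fun ψI hI =>
      ⟨hI.hasWeakDiv hP hd.1, hdivErr P x₀ hP ε s hs hs1 ψ ψI d hψ hdiv hd hI⟩⟩
  · obtain ⟨C, hC, hCψ⟩ := FaceVEM.PolyhedralElement.exists_interpolation_constant ha hκ hs hs1
    refine ⟨C + 2 * (1 + √(10 / (γ / 2) ^ 3)), by positivity, ?_⟩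
    intro P hreg ψ d hψ hdiv hd ψI hI
    obtain ⟨x₀, hP⟩ := hreg.exists_isStarBall hγ
    obtain ⟨δ, hδ, hδ'⟩ := hdivErr P x₀ hP s s (by linarith) hs1 ψ ψI d hψ hdiv hd hI
    have h1 := hCψ P x₀ _ P.h hP P.dist_le_h P.h_pos le_rfl
      (fun i => hreg.le_faceIntegral_one hγ hσ i) ψ ψI d hψ hI
    have hh : 0 ≤ P.h ^ s := Real.rpow_nonneg P.h_pos.le s
    refine ⟨δ, hδ, FaceVEM.rpow_half_add_sq_le (h1.trans ?_) (hδ'.trans ?_)⟩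
    · refine mul_le_mul_left (ENNReal.ofReal_le_ofReal (mul_le_mul_of_nonneg_right ?_ hh)) _
      exact le_add_of_nonneg_right (by positivity)
    · refine mul_le_mul_left (ENNReal.ofReal_le_ofReal (mul_le_mul_of_nonneg_right ?_ hh)) _
      exact le_add_of_nonneg_left hC.le
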